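/- **Setting.** Let $m,n,p,q\in\mathbb N_0$. Let $\mathcal C=\mathcal C_{m+p,2n+2q}$ be the real associative unital algebra generated by $e_1,\dots,e_{m+p},\grave e_1,\dots,\grave e_{2n+2q}$ with $e_je_k+e_ke_j=-2\delta_{jk}$, $e_j\grave e_k+\grave e_ke_j=0$, $\grave e_j\grave e_k-\grave e_k\grave e_j=g_{jk}$, where $g_{2j-1,2k}=-g_{2k,2j-1}=\delta_{jk}$ and all other $g_{jk}$ vanish. Let $\mathfrak G_{2n+2q}$ be the Grassmann algebra on anticommuting variables $\grave x_1,\dots,\grave x_{2n},\grave y_1,\dots,\grave y_{2q}$, which commute with the generators of $\mathcal C$. Consider the supervectors $$\mathbf x=\sum_{j=1}^m x_je_j+\sum_{j=1}^{2n}\grave x_j\grave e_j,\qquad \mathbf y=\sum_{j=1}^p y_je_{m+j}+\sum_{j=1}^{2q}\grave y_j\grave e_{2n+j},$$ put $M=m-2n$, $|\mathbf x|^2=-\mathbf x^2$, and let $$\partial_{\mathbf x}=2\sum_{j=1}^n(\grave e_{2j}\partial_{\grave x_{2j-1}}-\grave e_{2j-1}\partial_{\grave x_{2j}})-\sum_{j=1}^m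 e_j\partial_{x_j}$$ ($\partial_{\grave x_j}$ being left derivatives), define $\partial_{\mathbf y}$ analogously, and let $\Delta_{\mathbf y}=-\partial_{\mathbf y}^2=\sum_{j=1}^p\partial_{y_j}^2-4\sum_{j=1}^q\partial_{\grave y_{2j-1}}\partial_{\grave y_{2j}}$. A series of functions with values in $\mathfrak G_{2n+2q}\otimes\mathcal C$ converges if its terms are spanned by one finite subset of $\mathfrak G_{2n+2q}\otimes\mathcal C$ and all its components converge; normal convergence is also understood componentwise. An *$SO(m)$-normal neighbourhood* of an open set $\Omega_p\subset\mathbb R^p$ is an open $SO(m)$-invariant set in $\mathbb R^{m+p}$ that contains $\{0\}\times\Omega_p$ and whose intersections with all subspaces parallel to $\mathbb R^m$ are convex. Let $P_k(w)=\sum_{j=0}^k\frac{(k-j)!}{j!}w^j$ for $k\in\mathbb N_0$, $P_{-1}=0$, and let $$B_\nu[G]=\sum_{j=0}^\infty\frac{(-1)^j}{j!\,\Gamma(\nu+j+1)}\Big(\frac{|\mathbf x|^2\Delta_{\mathbf y}}4\Big)^jG ,$$ that is, the operator $(t/2)^{-\nu}J_\nu(t)$ with $t=|\mathbf x|\sqrt{\Delta_{\mathbf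 y}}$, expanded as a power series and applied to $G$ ($J_\nu$ is the Bessel function of the first kind). **Theorem (generalized CK-extension in superspace).** Let $\Omega_p\subset\mathbb R^p$ be open, and let $F_j(\mathbf y)$, $j\in\mathbb N_0$, be Clifford-valued superfunctions of $\mathbf y$, analytic on $\Omega_p$ (elements of $\mathcal A(\Omega_p)\otimes\mathfrak G_{2q}\otimes\mathcal C$). Suppose that the series $\sum_{j=0}^\infty\mathbf x^jF_j(\mathbf y)$ converges in an open neighbourhood $\Omega\subset\mathbb R^m\times\Omega_p$ of $\{0\}\times\Omega_p$ and that its sum $F(\mathbf x,\mathbf y)$ is a smooth superfunction on $\Omega$ that is monogenic, i.e. $(\partial_{\mathbf x}+\partial_{\mathbf y})F=0$ on $\Omega$. Then the following hold, where all the series that occur converge on $\Omega$. 1. If $M\notin-2\mathbb N_0$, then on $\Omega$ $$F(\mathbf x,\mathbf y)=\Gamma\big(\tfrac M2\big)\Big(B_{\frac M2-1}[F_0]-\tfrac12\,\mathbf x\,B_{\frac M2}[\partial_{\mathbf y}F_0]\Big).$$ 2. If $M=-2k$ with $k\in\mathbb N_0$ and $m\ne0$, then $\partial_{\mathbf y}^{2k+1}F_0=0$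 on $\Omega_p$ and, on $\Omega$, $$F(\mathbf x,\mathbf y)=\frac1{k!}\Big(P_k\big(\tfrac{|\mathbf x|^2\Delta_{\mathbf y}}4\big)F_0+\tfrac12\,\mathbf x\,P_{k-1}\big(\tfrac{|\mathbf x|^2\Delta_{\mathbf y}}4\big)\partial_{\mathbf y}F_0\Big)+k!\,\mathbf x^{2k+1}\Big(B_k[F_{2k+1}]+\tfrac12\,\mathbf x\,B_{k+1}[\partial_{\mathbf y}F_{2k+1}]\Big).$$ 3. If $m=0$ (so that $M=-2n$), then $\partial_{\mathbf y}^{2n+1}F_0=0$ on $\Omega_p$ and, on $\Omega$, $$F(\mathbf x,\mathbf y)=\frac1{n!}\Big(P_n\big(\tfrac{|\mathbf x|^2\Delta_{\mathbf y}}4\big)F_0+\tfrac12\,\mathbf x\,P_{n-1}\big(\tfrac{|\mathbf x|^2\Delta_{\mathbf y}}4\big)\partial_{\mathbf y}F_0\Big).$$ Moreover, the domain of convergence of $\sum_j\mathbf x^jF_j(\mathbf y)$ (the interior of the set of all points of $\mathbb R^m\times\Omega_p$ at which the series converges) is an $SO(m)$-normal neighbourhood of $\Omega_p$, and there is an $SO(m)$-normal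 neighbourhood $D\subset\Omega$ of $\Omega_p$ on whose compact subsets the series converges normally. -/

import Mathlib

open Filter Topology
open scoped TensorProduct ContDiff

noncomputable section

namespace SuperCK

/-! ### The super Clifford algebra and the Grassmann algebra

`I` indexes the commuting (bosonic) coordinates. The anticommuting (fermionic) coordinates come in
pairs indexed by `J`: `(j, 0)` stands for the odd-numbered member `2j-1` of the `j`-th pair and
`(j, 1)` for the even-numbered member `2j`. -/

/-- The symplectic form: `g_{2j-1,2k} = -g_{2k,2j-1} = δ_{jk}`, all other entries vanish. -/
def symplecticForm {J : Type} [DecidableEq J] (a b : J × Fin 2) : ℝ :=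
  if a.1 = b.1 then
    (if a.2 = 0 ∧ b.2 = 1 then 1 else if a.2 = 1 ∧ b.2 = 0 then -1 else 0)
  else 0

/-- The defining relations of the super Clifford algebra. -/
inductive CliffordRel (I J : Type) [DecidableEq I] [DecidableEq J] :
    FreeAlgebra ℝ (I ⊕ J × Fin 2) → FreeAlgebra ℝ (I ⊕ J × Fin 2) → Prop
  | bos (i k : I) : CliffordRel I J
      (FreeAlgebra.ι ℝ (Sum.inl i) * FreeAlgebra.ι ℝ (Sum.inl k)
        + FreeAlgebra.ι ℝ (Sum.inl k) * FreeAlgebra.ι ℝ (Sum.inl i))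
      (algebraMap ℝ _ (if i = k then -2 else 0))
  | mixed (i : I) (a : J × Fin 2) : CliffordRel I J
      (FreeAlgebra.ι ℝ (Sum.inl i) * FreeAlgebra.ι ℝ (Sum.inr a)
        + FreeAlgebra.ι ℝ (Sum.inr a) * FreeAlgebra.ι ℝ (Sum.inl i))
      0
  | ferm (a b : J × Fin 2) : CliffordRel I J
      (FreeAlgebra.ι ℝ (Sum.inr a) * FreeAlgebra.ι ℝ (Sum.inr b)
        - FreeAlgebra.ι ℝ (Sum.inr b) * FreeAlgebra.ι ℝ (Sum.inr a))
      (algebraMap ℝ _ (symplecticForm a b))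

/-- The super Clifford algebra `𝒞_{|I|, 2|J|}`: the real associative unital algebra with
generators `e_i`, `è_a` and the relations above. -/
def SuperClifford (I J : Type) [DecidableEq I] [DecidableEq J] : Type :=
  RingQuot (CliffordRel I J)

instance (I J : Type) [DecidableEq I] [DecidableEq J] : Ring (SuperClifford I J) :=
  inferInstanceAs (Ring (RingQuot (CliffordRel I J)))

instance (I J : Type) [DecidableEq I] [DecidableEq J] : Algebra ℝ (SuperClifford I J) :=
  inferInstanceAs (Algebra ℝ (RingQuot (CliffordRel I J)))

/-- The generators of the super Clifford algebra. -/
def cliffordGen {I J : Type} [DecidableEq I] [DecidableEq J] (s : I ⊕ J × Fin 2) :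
    SuperClifford I J :=
  RingQuot.mkAlgHom ℝ (CliffordRel I J) (FreeAlgebra.ι ℝ s)

/-- The Grassmann algebra `𝔊_{2|J|}`. -/
abbrev Grassmann (J : Type) : Type := ExteriorAlgebra ℝ (J × Fin 2 → ℝ)

/-- The algebra `𝔊 ⊗ 𝒞` in which Clifford-valued superfunctions take their values; the
Grassmann variables commute with the Clifford generators. -/
abbrev SuperAlg (I J : Type) [DecidableEq I] [DecidableEq J] : Type :=
  Grassmann J ⊗[ℝ] SuperClifford I J

section Generators

variable {I J : Type} [DecidableEq I] [DecidableEq J]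

/-- The fermionic variable with index `a`. -/
def fermVar (a : J × Fin 2) : Grassmann J := ExteriorAlgebra.ι ℝ (Pi.single a 1)

/-- The fermionic variable with index `a`, as an element of `𝔊 ⊗ 𝒞`. -/
def theta (a : J × Fin 2) : SuperAlg I J := fermVar a ⊗ₜ[ℝ] 1

/-- The orthogonal Clifford generator `e_i`. -/
def eBos (i : I) : SuperAlg I J := 1 ⊗ₜ[ℝ] cliffordGen (Sum.inl i)

/-- The symplectic Clifford generator `è_a`. -/
def eFerm (a : J × Fin 2) : SuperAlg I J := 1 ⊗ₜ[ℝ] cliffordGen (Sum.inr a)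

/-- The left derivative with respect to the fermionic variable with index `a`. It kills constants
and satisfies `∂_a (θ_b g) = δ_{ab} g - θ_b (∂_a g)`. -/
def fermDeriv (a : J × Fin 2) : SuperAlg I J →ₗ[ℝ] SuperAlg I J :=
  LinearMap.rTensor (SuperClifford I J)
    (CliffordAlgebra.contractLeft (Q := (0 : QuadraticForm ℝ (J × Fin 2 → ℝ)))
      (LinearMap.proj a : Module.Dual ℝ (J × Fin 2 → ℝ)))

end Generators

/-! ### Calculus for functions with values in a real vector space without topology

All functions of interest take values in a finite-dimensional subspace, where the notions below,
tested against all linear functionals, are the componentwise ones. -/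

section Calculus

variable {I A : Type} [DecidableEq I] [AddCommGroup A] [Module ℝ A]

/-- `f` has the partial derivative `d` with respect to the `i`-th coordinate at `z`. -/
def HasPartialDeriv (i : I) (f : (I → ℝ) → A) (d : A) (z : I → ℝ) : Prop :=
  ∀ φ : Module.Dual ℝ A, HasDerivAt (fun t : ℝ => φ (f (Function.update z i t))) (φ d) (z i)

open Classical in
/-- The partial derivative with respect to the `i`-th coordinate (`0` where it does not exist). -/
def partialDeriv (i : I) (f : (I → ℝ) → A) (z : I → ℝ) : A :=
  if h : ∃ d, HasPartialDeriv i f d z then h.choose else 0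

/-- `f` belongs to `C^∞(Ω) ⊗ A`. -/
def IsSmooth [Fintype I] (Ω : Set (I → ℝ)) (f : (I → ℝ) → A) : Prop :=
  ∃ (s : ℕ) (c : Fin s → (I → ℝ) → ℝ) (a : Fin s → A),
    (∀ r, ContDiffOn ℝ ∞ (c r) Ω) ∧ ∀ z ∈ Ω, f z = ∑ r, c r z • a r

/-- The functions `T j` are all spanned, on `Ω`, by one finite set of elements of `A`. -/
def FinitelySpanned (T : ℕ → (I → ℝ) → A) (Ω : Set (I → ℝ)) : Prop :=
  ∃ V : Submodule ℝ A, FiniteDimensional ℝ V ∧ ∀ j, ∀ z ∈ Ω, T j z ∈ V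

/-- At the point `z` the series `∑ T j` converges, componentwise, to `s`. -/
def ConvergesAt (T : ℕ → (I → ℝ) → A) (z : I → ℝ) (s : A) : Prop :=
  ∀ φ : Module.Dual ℝ A,
    Tendsto (fun N : ℕ => ∑ j ∈ Finset.range N, φ (T j z)) atTop (𝓝 (φ s))

/-- The series `∑ T j` converges on `Ω` (pointwise, componentwise) with sum `S`. -/
def ConvergesOn (T : ℕ → (I → ℝ) → A) (S : (I → ℝ) → A) (Ω : Set (I → ℝ)) : Prop :=
  FinitelySpanned T Ω ∧ ∀ z ∈ Ω, ConvergesAt T z (S z)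

/-- The series `∑ T j` converges normally on the compact subsets of `Ω`, componentwise. -/
def ConvergesNormallyOn (T : ℕ → (I → ℝ) → A) (Ω : Set (I → ℝ)) : Prop :=
  FinitelySpanned T Ω ∧ ∀ φ : Module.Dual ℝ A, ∀ K ⊆ Ω, IsCompact K →
    ∃ u : ℕ → ℝ, Summable u ∧ ∀ j, ∀ z ∈ K, |φ (T j z)| ≤ u j

end Calculus

/-! ### Super vectors, Dirac operators and Laplacians

The maps `ι : I' → I` and `κ : J' → J` select the coordinates that belong to one super vector. -/

section Operators

variable {I J I' J' : Type} [DecidableEq I] [DecidableEq J] [Fintype I'] [Fintype J']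

/-- The super vector variable `∑ x_i e_i + ∑ x̀_a è_a` at the bosonic point `z`. -/
def superVector (ι : I' → I) (κ : J' → J) (z : I → ℝ) : SuperAlg I J :=
  ∑ i : I', z (ι i) • eBos (ι i)
    + ∑ a : J' × Fin 2, theta (κ a.1, a.2) * eFerm (κ a.1, a.2)

/-- The left super Dirac operator
`2 ∑_j (è_{2j} ∂_{x̀_{2j-1}} - è_{2j-1} ∂_{x̀_{2j}}) - ∑_i e_i ∂_{x_i}`. -/
def superDirac (ι : I' → I) (κ : J' → J) (f : (I → ℝ) → SuperAlg I J) (z : I → ℝ) :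
    SuperAlg I J :=
  (2 : ℝ) • ∑ j : J', (eFerm (κ j, 1) * fermDeriv (κ j, 0) (f z)
      - eFerm (κ j, 0) * fermDeriv (κ j, 1) (f z))
    - ∑ i : I', eBos (ι i) * partialDeriv (ι i) f z

/-- The super Laplace operator `∑_i ∂_{x_i}² - 4 ∑_j ∂_{x̀_{2j-1}} ∂_{x̀_{2j}}`. -/
def superLaplacian (ι : I' → I) (κ : J' → J) (f : (I → ℝ) → SuperAlg I J) (z : I → ℝ) :
    SuperAlg I J :=
  ∑ i : I', partialDeriv (ι i) (partialDeriv (ι i) f) z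
    - (4 : ℝ) • ∑ j : J', fermDeriv (κ j, 0) (fermDeriv (κ j, 1) (f z))

end Operators

/-! ### Two orthogonal super vector variables `x` (of type `m|2n`) and `y` (of type `p|2q`) -/

section TwoVectors

/-- The superdimension `M = m - 2n` of `x`. -/
def superdim (m n : ℕ) : ℤ := (m : ℤ) - 2 * n

variable {m n p q : ℕ}

/-- Bosonic points `(x, y)` of `ℝ^{m+p}`. -/
abbrev Pt (m p : ℕ) : Type := Fin m ⊕ Fin p → ℝ

/-- The values `𝔊_{2n+2q} ⊗ 𝒞_{m+p,2n+2q}`. -/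
abbrev Val (m n p q : ℕ) : Type := SuperAlg (Fin m ⊕ Fin p) (Fin n ⊕ Fin q)

/-- The super vector variable `x`. -/
def xVec (z : Pt m p) : Val m n p q := superVector Sum.inl Sum.inl z

/-- The generalized norm squared `|x|² = -x²`. -/
def xNormSq (z : Pt m p) : Val m n p q := -(xVec z) ^ 2

/-- The super Dirac operator `∂_x`. -/
def diracX (f : Pt m p → Val m n p q) : Pt m p → Val m n p q := superDirac Sum.inl Sum.inl f

/-- The super Dirac operator `∂_y`. -/
def diracY (f : Pt m p → Val m n p q) : Pt m p → Val m n p q := superDirac Sum.inr Sum.inr f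

/-- The super Laplacian `Δ_y`. -/
def laplacianY (f : Pt m p → Val m n p q) : Pt m p → Val m n p q :=
  superLaplacian Sum.inr Sum.inr f

/-- A function of the bosonic part of `y`, regarded as a function of both variables. -/
def liftY (G : (Fin p → ℝ) → Val m n p q) : Pt m p → Val m n p q := fun z => G (z ∘ Sum.inr)

/-- `G` belongs to `𝒜(Ω_p) ⊗ 𝔊_{2q} ⊗ 𝒞_{m+p,2n+2q}`: an analytic Clifford-valued superfunction
of the super vector variable `y` alone. -/
def IsAnalyticInY (Ωp : Set (Fin p → ℝ)) (G : (Fin p → ℝ) → Val m n p q) : Prop :=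
  ∃ (s : ℕ) (f : Fin s → (Fin p → ℝ) → ℝ) (g : Fin s → Grassmann (Fin n ⊕ Fin q))
    (c : Fin s → SuperClifford (Fin m ⊕ Fin p) (Fin n ⊕ Fin q)),
    (∀ r, AnalyticOnNhd ℝ (f r) Ωp) ∧
    (∀ r, g r ∈ Algebra.adjoin ℝ
      (Set.range fun a : Fin q × Fin 2 => fermVar ((Sum.inr a.1 : Fin n ⊕ Fin q), a.2))) ∧
    ∀ y ∈ Ωp, G y = ∑ r, f r y • (g r ⊗ₜ[ℝ] c r)

/-- The terms `x^j F_j(y)`. -/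
def ckTerm (F : ℕ → (Fin p → ℝ) → Val m n p q) (j : ℕ) (z : Pt m p) : Val m n p q :=
  xVec z ^ j * liftY (F j) z

/-- The `j`-th term `c_j (|x|² Δ_y / 4)^j G` of a power series `∑ c_j w^j` in the operator
`w = |x|² Δ_y / 4` applied to `G`. -/
def operatorTerm (c : ℕ → ℝ) (G : Pt m p → Val m n p q) (j : ℕ) (z : Pt m p) : Val m n p q :=
  (c j / 4 ^ j) • (xNormSq z ^ j * (laplacianY^[j] G) z)

/-- The coefficients of the Bessel function `J_ν(t) = ∑_j b_j (t/2)^{2j+ν}`. -/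
def besselCoeff (ν : ℝ) (j : ℕ) : ℝ :=
  (-1) ^ j / ((j.factorial : ℝ) * Real.Gamma (ν + j + 1))

/-- The terms of the series `(t/2)^{-ν} J_ν(t) = ∑_j b_j (t/2)^{2j}`, with `t = |x| √Δ_y`, applied
to `G`. -/
def besselTerm (ν : ℝ) (G : Pt m p → Val m n p q) : ℕ → Pt m p → Val m n p q :=
  operatorTerm (besselCoeff ν) G

/-- The Appell polynomial `P_k(w) = ∑_{j ≤ k} (k-j)!/j! w^j`. -/
def appellP (k : ℕ) : Polynomial ℝ :=
  ∑ j ∈ Finset.range (k + 1), Polynomial.monomial j (((k - j).factorial : ℝ) / j.factorial)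

/-- The polynomial `P_{k-1}`, with the convention `P_{-1} = 0`. -/
def appellPred : ℕ → Polynomial ℝ
  | 0 => 0
  | k + 1 => appellP k

/-- `P(|x|² Δ_y / 4) G` for a polynomial `P`. -/
def polyOperator (P : Polynomial ℝ) (G : Pt m p → Val m n p q) (z : Pt m p) : Val m n p q :=
  ∑ j ∈ P.support, operatorTerm P.coeff G j z

/-- `D` is an `SO(m)`-normal neighbourhood of `Ω_p` in `ℝ^{m+p}`: an open `SO(m)`-invariant set
that contains `{0} × Ω_p` and whose intersections with the subspaces parallel to `ℝ^m` are
convex. -/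
structure IsSONormalNhd (Ωp : Set (Fin p → ℝ)) (D : Set (Pt m p)) : Prop where
  isOpen : IsOpen D
  contains : ∀ y ∈ Ωp, Sum.elim (0 : Fin m → ℝ) y ∈ D
  invariant : ∀ R ∈ Matrix.specialOrthogonalGroup (Fin m) ℝ, ∀ x : Fin m → ℝ, ∀ y : Fin p → ℝ,
    Sum.elim x y ∈ D → Sum.elim (R.mulVec x) y ∈ D
  convex : ∀ y : Fin p → ℝ, Convex ℝ {x : Fin m → ℝ | Sum.elim x y ∈ D}

/-- The domain of convergence of `∑ x^j F_j(y)`: the interior of the set of all points over `Ω_p`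
at which the series converges. -/
def convergenceDomain (Ωp : Set (Fin p → ℝ)) (F : ℕ → (Fin p → ℝ) → Val m n p q) :
    Set (Pt m p) :=
  interior {z | z ∘ Sum.inr ∈ Ωp ∧ ∃ S, ConvergesOn (ckTerm F) S {z}}

end TwoVectors

end SuperCK

end

/-!
Write `x = x_b + w` with `x_b` the bosonic part (`bosX`) and `w` the fermionic part (`fermVec`).
Then `x² = -|x_b|² + w²`, where `w²` (`fermNil`) is central and nilpotent. The algebra endomorphism
`body` sets the fermionic variables of `x` to zero; it fixes the coefficients `F_j` and maps `x`
to `x_b`, which is invertible wherever it does not vanish.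

*Recurrence.* Since `∂_x (x^j g) = c_j x^{j-1} g` for `g` free of `x`, with `c_{2j} = 2j` and
`c_{2j+1} = 2j + M` (`dimFactor`), and since `∂_y` anticommutes with `x`, a series `∑ x^j F_j` is
monogenic iff `c_{j+1} F_{j+1} = (-1)^{j+1} ∂_y F_j` for all `j` (`IsCKSequence`), provided that it
may be differentiated termwise and that its coefficients are unique. Pointwise convergence does not
give this at once. For `m ≥ 1` the body of `∂_x S = -∂_y S` is instead expanded in a power series
along a line `t e` through a point with `x_b = 0`, and Taylor coefficients are compared
(`isCKSequence_of_monogenic`). The derivatives along the line and along `y` come from the series for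
`S` on the line; those in a direction `e_i` orthogonal to `e` are read off from
`(t e + s e_i)² = -(t² + s²)`; the fermionic part of `∂_x` contributes `-2n` on odd powers and
nothing on even ones. For `m = 0` the series is a polynomial in the nilpotent `w`, whose powers up
to `w^{2n}` are independent over functions of `y` (`eq_zero_of_sum_fermVec_pow_mul`), while the
coefficients of the vanishing higher powers are arbitrary and may be replaced by zero
(`isCKSequence_of_monogenic_fermionic`).

*Explicit form.* As `∂_y² = -Δ_y`, iterating the recurrence shows that `Δ_y^j F_i` is `F_{i+2j}`
times a product of factors `c_l`. These products are quotients of Gamma values, so the terms of the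
Bessel series applied to `F_0` and `∂_y F_0` are multiples of `x^{2j} F_{2j}` and `x^{2j} F_{2j+1}`
(`besselTerm_lift_zero`, `besselTerm_dirac_zero`), and the first representation is the splitting of
`∑ x^j F_j` by parity. If `M = -2k`, then `c_{2k+1} = 0`. This yields `∂_y^{2k+1} F_0 = 0` and
decouples the coefficients before and after the index `2k + 1`: the Appell polynomials produce the
first `2k + 1` terms (`appell_part_eq`), and Bessel series started at `F_{2k+1}` produce the rest.
For `m = 0` there is no rest, because `x^{2n+1} = 0`.

*Convergence.* Splitting by parity needs absolute convergence. At a point with `x_b ≠ 0`,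
convergence slightly further out bounds the coefficients geometrically (`geomBound_of_ckTerm_bound`).
At `x_b = 0` the bound comes from the recurrence and Cauchy's estimates for the iterated Laplacians,
`|Δ_y^j F_i| ≤ C (2j)! K^j` (`exists_bound_analyticLap_pow`), which even give geometric bounds that
are uniform in `y` near a given point (`IsCKSequence.exists_local_bound`). Conversely such bounds
give normal convergence for smaller `|x_b|`, since the nilpotent `w²` only introduces factors that
are polynomial in `j` (`GeomBound.smul_one_add_pow`). Hence the slices of the domain of convergence
over the points `y` are balls around `x_b = 0`, and so are those of the union of the cylinders on
which the convergence is uniformly dominated; such open sets are `SO(m)`-normal neighbourhoods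
(`isSONormalNhd_of_slices`).
-/

noncomputable section

namespace SuperCK

/-! ### Relations among the generators -/

section Relations

variable {I J : Type} [DecidableEq I] [DecidableEq J]

lemma cliffordGen_bos_anticomm (i k : I) :
    (cliffordGen (Sum.inl i) * cliffordGen (Sum.inl k) +
      cliffordGen (Sum.inl k) * cliffordGen (Sum.inl i) : SuperClifford I J) =
        algebraMap ℝ _ (if i = k then -2 else 0) := by
  have h := RingQuot.mkAlgHom_rel ℝ (CliffordRel.bos (J := J) i k)
  rw [map_add, map_mul, map_mul, AlgHom.commutes] at h
  exact h

lemma cliffordGen_mixed_anticomm (i : I) (a : J × Fin 2) :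
    (cliffordGen (Sum.inl i) * cliffordGen (Sum.inr a) +
      cliffordGen (Sum.inr a) * cliffordGen (Sum.inl i) : SuperClifford I J) = 0 := by
  have h := RingQuot.mkAlgHom_rel ℝ (CliffordRel.mixed i a)
  rw [map_add, map_mul, map_mul, map_zero] at h
  exact h

lemma cliffordGen_ferm_comm (a b : J × Fin 2) :
    (cliffordGen (Sum.inr a) * cliffordGen (Sum.inr b) -
      cliffordGen (Sum.inr b) * cliffordGen (Sum.inr a) : SuperClifford I J) =
        algebraMap ℝ _ (symplecticForm a b) := by
  have h := RingQuot.mkAlgHom_rel ℝ (CliffordRel.ferm (I := I) a b)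
  rw [map_sub, map_mul, map_mul, AlgHom.commutes] at h
  exact h

lemma one_tmul_algebraMap (r : ℝ) :
    ((1 : Grassmann J) ⊗ₜ[ℝ] (algebraMap ℝ (SuperClifford I J) r)) = r • (1 : SuperAlg I J) := by
  rw [Algebra.algebraMap_eq_smul_one, TensorProduct.tmul_smul, Algebra.TensorProduct.one_def]

lemma eBos_sq (i : I) : (eBos i * eBos i : SuperAlg I J) = -1 := by
  have h := cliffordGen_bos_anticomm (J := J) i i
  rw [if_pos rfl, ← two_smul ℝ] at h
  have h2 : (cliffordGen (Sum.inl i) * cliffordGen (Sum.inl i) : SuperClifford I J) =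
      algebraMap ℝ _ (-1) := by
    have := congrArg (fun v => (1 / 2 : ℝ) • v) h
    simp only [smul_smul] at this
    rw [Algebra.algebraMap_eq_smul_one, smul_smul, ← Algebra.algebraMap_eq_smul_one] at this
    norm_num at this
    simpa using this
  rw [eBos, Algebra.TensorProduct.tmul_mul_tmul, h2, one_mul, one_tmul_algebraMap]
  simp

lemma eBos_anticomm {i k : I} (h : i ≠ k) :
    (eBos i * eBos k : SuperAlg I J) = -(eBos k * eBos i) := by
  have h1 := cliffordGen_bos_anticomm (J := J) i k
  rw [if_neg h, map_zero] at h1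
  rw [eBos, eBos, Algebra.TensorProduct.tmul_mul_tmul, Algebra.TensorProduct.tmul_mul_tmul,
    eq_neg_of_add_eq_zero_left h1, TensorProduct.tmul_neg]

lemma eBos_mul_eFerm (i : I) (a : J × Fin 2) :
    (eBos i * eFerm a : SuperAlg I J) = -(eFerm a * eBos i) := by
  rw [eBos, eFerm, Algebra.TensorProduct.tmul_mul_tmul, Algebra.TensorProduct.tmul_mul_tmul,
    eq_neg_of_add_eq_zero_left (cliffordGen_mixed_anticomm i a), TensorProduct.tmul_neg]

lemma eFerm_mul_eFerm (a b : J × Fin 2) :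
    (eFerm a * eFerm b : SuperAlg I J) = eFerm b * eFerm a + symplecticForm a b • 1 := by
  rw [eFerm, eFerm, Algebra.TensorProduct.tmul_mul_tmul, Algebra.TensorProduct.tmul_mul_tmul,
    sub_eq_iff_eq_add'.mp (cliffordGen_ferm_comm a b), TensorProduct.tmul_add, one_mul,
    one_tmul_algebraMap]

lemma eFerm_one_mul_eFerm_zero (j : J) :
    (eFerm (j, 1) * eFerm (j, 0) : SuperAlg I J) = eFerm (j, 0) * eFerm (j, 1) - 1 := by
  rw [eFerm_mul_eFerm]
  simp [symplecticForm, sub_eq_add_neg]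

lemma eFerm_comm {a b : J × Fin 2} (h : a.1 ≠ b.1) :
    Commute (eFerm a : SuperAlg I J) (eFerm b) := by
  rw [commute_iff_eq, eFerm_mul_eFerm]
  simp [symplecticForm, h]

lemma theta_comm_eBos (a : J × Fin 2) (i : I) :
    Commute (theta a : SuperAlg I J) (eBos i) := by
  rw [commute_iff_eq, theta, eBos]
  simp

lemma theta_comm_eFerm (a b : J × Fin 2) :
    Commute (theta a : SuperAlg I J) (eFerm b) := by
  rw [commute_iff_eq, theta, eFerm]
  simp

lemma theta_anticomm (a b : J × Fin 2) :
    (theta a * theta b : SuperAlg I J) = -(theta b * theta a) := by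
  have h := ExteriorAlgebra.ι_add_mul_swap (R := ℝ) (Pi.single a (1 : ℝ) : J × Fin 2 → ℝ)
    (Pi.single b 1)
  rw [theta, theta, Algebra.TensorProduct.tmul_mul_tmul, Algebra.TensorProduct.tmul_mul_tmul,
    fermVar, fermVar, eq_neg_of_add_eq_zero_left h, TensorProduct.neg_tmul]

lemma theta_sq (a : J × Fin 2) : (theta a * theta a : SuperAlg I J) = 0 := by
  rw [theta, Algebra.TensorProduct.tmul_mul_tmul, fermVar, ExteriorAlgebra.ι_sq_zero,
    TensorProduct.zero_tmul]

lemma ι_mul_ι_commute {V : Type*} [AddCommGroup V] [Module ℝ V] (v w : V)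
    (g : ExteriorAlgebra ℝ V) :
    Commute (ExteriorAlgebra.ι ℝ v * ExteriorAlgebra.ι ℝ w) g := by
  induction g using ExteriorAlgebra.induction with
  | algebraMap r => exact Algebra.commute_algebraMap_right r _
  | ι u =>
    have h1 := eq_neg_of_add_eq_zero_left (ExteriorAlgebra.ι_add_mul_swap (R := ℝ) w u)
    have h2 := eq_neg_of_add_eq_zero_left (ExteriorAlgebra.ι_add_mul_swap (R := ℝ) v u)
    rw [commute_iff_eq, mul_assoc, h1, mul_neg, ← mul_assoc, h2, neg_mul, neg_neg, mul_assoc]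
  | mul a b ha hb => exact ha.mul_right hb
  | add a b ha hb => exact ha.add_right hb

lemma theta_mul_theta_commute (a b : J × Fin 2) (g : SuperAlg I J) :
    Commute (theta a * theta b) g := by
  induction g using TensorProduct.induction_on with
  | zero => exact Commute.zero_right _
  | tmul g c =>
    have h := ι_mul_ι_commute (Pi.single a 1) (Pi.single b 1) g
    rw [commute_iff_eq] at h ⊢
    simp only [theta, fermVar, Algebra.TensorProduct.tmul_mul_tmul, h, one_mul, mul_one]
  | add x y hx hy => exact hx.add_right hy

end Relations

/-! ### Fermionic derivatives -/

section Derivatives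

variable {I J : Type} [DecidableEq I] [DecidableEq J]

lemma fermDeriv_tmul (a : J × Fin 2) (g : Grassmann J) (c : SuperClifford I J) :
    fermDeriv a (g ⊗ₜ[ℝ] c) =
      (CliffordAlgebra.contractLeft (Q := (0 : QuadraticForm ℝ (J × Fin 2 → ℝ)))
        (LinearMap.proj a : Module.Dual ℝ (J × Fin 2 → ℝ)) g) ⊗ₜ[ℝ] c := rfl

lemma fermDeriv_theta_mul (a b : J × Fin 2) (g : SuperAlg I J) :
    fermDeriv a (theta b * g) = (if a = b then g else 0) - theta b * fermDeriv a g := by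
  induction g using TensorProduct.induction_on with
  | zero => simp
  | tmul g c =>
    simp only [theta, fermVar, Algebra.TensorProduct.tmul_mul_tmul, fermDeriv_tmul, one_mul]
    rw [show (ExteriorAlgebra.ι ℝ (Pi.single b (1 : ℝ)) : Grassmann J) =
      CliffordAlgebra.ι 0 (Pi.single b (1 : ℝ)) from rfl, CliffordAlgebra.contractLeft_ι_mul,
      TensorProduct.sub_tmul]
    congr 1
    by_cases h : a = b
    · subst h; simp
    · simp [h]
  | add x y hx hy =>
    rw [mul_add, map_add, hx, hy, map_add, mul_add]
    split_ifs <;> abel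

lemma fermDeriv_eBos_mul (a : J × Fin 2) (i : I) (g : SuperAlg I J) :
    fermDeriv a (eBos i * g) = eBos i * fermDeriv a g := by
  induction g using TensorProduct.induction_on with
  | zero => simp
  | tmul g c => simp only [eBos, Algebra.TensorProduct.tmul_mul_tmul, fermDeriv_tmul, one_mul]
  | add x y hx hy => rw [mul_add, map_add, hx, hy, map_add, mul_add]

lemma fermDeriv_eFerm_mul (a b : J × Fin 2) (g : SuperAlg I J) :
    fermDeriv a (eFerm b * g) = eFerm b * fermDeriv a g := by
  induction g using TensorProduct.induction_on with
  | zero => simp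
  | tmul g c => simp only [eFerm, Algebra.TensorProduct.tmul_mul_tmul, fermDeriv_tmul, one_mul]
  | add x y hx hy => rw [mul_add, map_add, hx, hy, map_add, mul_add]

lemma fermDeriv_fermDeriv (a b : J × Fin 2) (g : SuperAlg I J) :
    fermDeriv a (fermDeriv b g) = -fermDeriv b (fermDeriv a g) := by
  induction g using TensorProduct.induction_on with
  | zero => simp
  | tmul g c =>
    simp only [fermDeriv_tmul]
    rw [CliffordAlgebra.contractLeft_comm, TensorProduct.neg_tmul]
  | add x y hx hy => rw [map_add, map_add, map_add, map_add, hx, hy, neg_add]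

lemma fermDeriv_self (a : J × Fin 2) (g : SuperAlg I J) : fermDeriv a (fermDeriv a g) = 0 := by
  have h := fermDeriv_fermDeriv a a g
  have h2 : (2 : ℝ) • fermDeriv a (fermDeriv a g) = 0 := by
    rw [two_smul]; nth_rewrite 1 [h]; exact neg_add_cancel _
  exact (smul_eq_zero.mp h2).resolve_left two_ne_zero

end Derivatives

/-! ### Sums of anticommuting and of square-zero elements -/

section RingLemmas

variable {R ι : Type*} [Ring R]

lemma sum_mul_self_of_anticomm (s : Finset ι) (a : ι → R)
    (h : ∀ i ∈ s, ∀ j ∈ s, i ≠ j → a i * a j = -(a j * a i)) :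
    (∑ i ∈ s, a i) * (∑ i ∈ s, a i) = ∑ i ∈ s, a i * a i := by
  classical
  induction s using Finset.induction_on with
  | empty => simp
  | insert i s hi ih =>
    have h2 : a i * ∑ j ∈ s, a j = -((∑ j ∈ s, a j) * a i) := by
      rw [Finset.mul_sum, Finset.sum_mul, ← Finset.sum_neg_distrib]
      refine Finset.sum_congr rfl fun j hj => h i (Finset.mem_insert_self _ _) j
        (Finset.mem_insert_of_mem hj) ?_
      rintro rfl; exact hi hj
    rw [Finset.sum_insert hi, Finset.sum_insert hi, add_mul, mul_add, mul_add, h2,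
      ih fun j hj k hk => h j (Finset.mem_insert_of_mem hj) k (Finset.mem_insert_of_mem hk)]
    abel

/-- The square of a Dirac operator in the abstract: `b` is its fermionic part, the `a i` are the
bosonic summands, and all cross terms cancel. -/
lemma sub_sum_mul_self_of_anticomm (s : Finset ι) (b : R) (a c : ι → R)
    (hb : ∀ i ∈ s, b * a i = -(a i * b))
    (ha : ∀ i ∈ s, ∀ j ∈ s, i ≠ j → a i * a j = -(a j * a i))
    (hc : ∀ i ∈ s, a i * a i = -c i) :
    (b - ∑ i ∈ s, a i) * (b - ∑ i ∈ s, a i) = b * b - ∑ i ∈ s, c i := by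
  have h : b * ∑ i ∈ s, a i = -((∑ i ∈ s, a i) * b) := by
    rw [Finset.mul_sum, Finset.sum_mul, ← Finset.sum_neg_distrib]
    exact Finset.sum_congr rfl hb
  rw [sub_mul, mul_sub, mul_sub, sum_mul_self_of_anticomm s a ha, Finset.sum_congr rfl hc, h,
    Finset.sum_neg_distrib]
  abel

lemma add_pow_succ_of_sq_zero {a b : R} (hab : Commute a b) (ha : a * a = 0) (k : ℕ) :
    (a + b) ^ (k + 1) = b ^ (k + 1) + (k + 1) • (a * b ^ k) := by
  induction k with
  | zero => simp [add_comm]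
  | succ k ih =>
    have h1 : b ^ (k + 1) * a = a * b ^ (k + 1) := ((hab.pow_right (k + 1)).eq).symm
    have h2 : a * b ^ k * a = 0 := by
      rw [mul_assoc, ← (hab.pow_right k).eq, ← mul_assoc, ha, zero_mul]
    rw [pow_succ, ih, add_mul, mul_add, mul_add, smul_mul_assoc, smul_mul_assoc, h1, h2,
      mul_assoc a, ← pow_succ b k, smul_zero, zero_add, ← pow_succ, add_smul (k + 1) 1, one_smul]
    abel

lemma sum_pow_eq_zero_of_sq_zero (s : Finset ι) (a : ι → R)
    (hc : ∀ i j, Commute (a i) (a j)) (h0 : ∀ i, a i * a i = 0) :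
    (∑ i ∈ s, a i) ^ (s.card + 1) = 0 := by
  classical
  induction s using Finset.induction_on with
  | empty => simp
  | insert i s hi ih =>
    rw [Finset.sum_insert hi, Finset.card_insert_of_notMem hi,
      add_pow_succ_of_sq_zero (Commute.sum_right _ _ _ fun j _ => hc i j) (h0 i), pow_succ, ih]
    simp

end RingLemmas

/-! ### Super vectors -/

section Vectors

variable {I J I' J' : Type} [DecidableEq I] [DecidableEq J] [Fintype I'] [Fintype J']

/-- The bosonic part `∑ x_i e_i` of a super vector. -/
def bosVec (ι : I' → I) (z : I → ℝ) : SuperAlg I J := ∑ i : I', z (ι i) • eBos (ι i)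

/-- The summand `x̀_{2j-1} è_{2j-1} + x̀_{2j} è_{2j}` of a super vector. -/
def fermPair (j : J) : SuperAlg I J := theta (j, 0) * eFerm (j, 0) + theta (j, 1) * eFerm (j, 1)

/-- The fermionic part `∑ x̀_a è_a` of a super vector. -/
def fermVec (κ : J' → J) : SuperAlg I J := ∑ j : J', fermPair (κ j)

/-- The square `∑ x̀_{2j-1} x̀_{2j}` of the fermionic part of a super vector. -/
def fermNil (κ : J' → J) : SuperAlg I J := ∑ j : J', theta (κ j, 0) * theta (κ j, 1)

/-- The summand `è_{2j} ∂_{x̀_{2j-1}} - è_{2j-1} ∂_{x̀_{2j}}` of the super Dirac operator. -/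
def diracPair (j : J) : Module.End ℝ (SuperAlg I J) :=
  LinearMap.mulLeft ℝ (eFerm (j, 1)) ∘ₗ fermDeriv (j, 0) -
    LinearMap.mulLeft ℝ (eFerm (j, 0)) ∘ₗ fermDeriv (j, 1)

/-- The fermionic part of the super Dirac operator. -/
def fermDirac (κ : J' → J) : Module.End ℝ (SuperAlg I J) := (2 : ℝ) • ∑ j : J', diracPair (κ j)

lemma diracPair_apply (j : J) (g : SuperAlg I J) :
    diracPair j g = eFerm (j, 1) * fermDeriv (j, 0) g - eFerm (j, 0) * fermDeriv (j, 1) g := rfl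

lemma fermDirac_apply (κ : J' → J) (g : SuperAlg I J) :
    fermDirac κ g = (2 : ℝ) • ∑ j : J', (eFerm (κ j, 1) * fermDeriv (κ j, 0) g
      - eFerm (κ j, 0) * fermDeriv (κ j, 1) g) := by
  simp [fermDirac, diracPair_apply]

lemma superVector_eq (ι : I' → I) (κ : J' → J) (z : I → ℝ) :
    superVector ι κ z = bosVec ι z + fermVec κ := by
  simp only [superVector, bosVec, fermVec, fermPair, Fintype.sum_prod_type, Fin.sum_univ_two]

lemma bosVec_sq {ι : I' → I} (hι : Function.Injective ι) (z : I → ℝ) :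
    (bosVec ι z * bosVec ι z : SuperAlg I J) = (-∑ i, z (ι i) ^ 2) • 1 := by
  rw [bosVec, sum_mul_self_of_anticomm]
  · simp only [smul_mul_smul_comm, eBos_sq, neg_smul, Finset.sum_smul, smul_neg,
      Finset.sum_neg_distrib, pow_two (z _)]
  · intro i _ k _ h
    rw [smul_mul_smul_comm, smul_mul_smul_comm, eBos_anticomm (hι.ne h), smul_neg, mul_comm]

lemma fermPair_anticomm {j k : J} (h : j ≠ k) :
    (fermPair j * fermPair k : SuperAlg I J) = -(fermPair k * fermPair j) := by
  have key : ∀ u v : Fin 2, (theta (j, u) * eFerm (j, u) * (theta (k, v) * eFerm (k, v)) :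
      SuperAlg I J) = -(theta (k, v) * eFerm (k, v) * (theta (j, u) * eFerm (j, u))) := by
    intro u v
    have h1 : Commute (eFerm (j, u) : SuperAlg I J) (eFerm (k, v)) := eFerm_comm h
    rw [mul_assoc, ← mul_assoc (eFerm _), ← (theta_comm_eFerm _ _).eq, mul_assoc (theta _) (eFerm _),
      h1.eq, ← mul_assoc, theta_anticomm, mul_assoc (theta (k, v)) (eFerm _),
      ← mul_assoc (eFerm (k, v)), ← (theta_comm_eFerm _ _).eq]
    simp only [neg_mul, mul_assoc]
  simp only [fermPair, mul_add, add_mul, key]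
  abel

lemma fermPair_sq (j : J) :
    (fermPair j * fermPair j : SuperAlg I J) = theta (j, 0) * theta (j, 1) := by
  have key : ∀ u v : Fin 2, (theta (j, u) * eFerm (j, u) * (theta (j, v) * eFerm (j, v)) :
      SuperAlg I J) = theta (j, u) * theta (j, v) * (eFerm (j, u) * eFerm (j, v)) := by
    intro u v
    rw [mul_assoc, ← mul_assoc (eFerm _), ← (theta_comm_eFerm _ _).eq]
    simp only [mul_assoc]
  simp only [fermPair, mul_add, add_mul, key, theta_sq, zero_mul, add_zero, zero_add,
    eFerm_one_mul_eFerm_zero]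
  rw [theta_anticomm (j, 1) (j, 0)]
  noncomm_ring

lemma fermVec_sq {κ : J' → J} (hκ : Function.Injective κ) :
    (fermVec κ * fermVec κ : SuperAlg I J) = fermNil κ := by
  rw [fermVec, sum_mul_self_of_anticomm _ _ fun i _ k _ h => fermPair_anticomm (hκ.ne h)]
  simp only [fermPair_sq, fermNil]

lemma eBos_mul_fermPair (i : I) (j : J) :
    (eBos i * fermPair j : SuperAlg I J) = -(fermPair j * eBos i) := by
  have key : ∀ u : Fin 2, (eBos i * (theta (j, u) * eFerm (j, u)) : SuperAlg I J) =
      -(theta (j, u) * eFerm (j, u) * eBos i) := by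
    intro u
    rw [← mul_assoc, ← (theta_comm_eBos _ _).eq, mul_assoc, eBos_mul_eFerm, mul_neg, mul_assoc]
  simp only [fermPair, mul_add, add_mul, key]
  abel

lemma eBos_mul_fermVec (i : I) (κ : J' → J) :
    (eBos i * fermVec κ : SuperAlg I J) = -(fermVec κ * eBos i) := by
  simp only [fermVec, Finset.mul_sum, Finset.sum_mul, eBos_mul_fermPair, Finset.sum_neg_distrib]

lemma bosVec_mul_fermVec (ι : I' → I) (κ : J' → J) (z : I → ℝ) :
    (bosVec ι z * fermVec κ : SuperAlg I J) = -(fermVec κ * bosVec ι z) := by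
  simp only [bosVec, Finset.mul_sum, Finset.sum_mul, smul_mul_assoc, mul_smul_comm,
    eBos_mul_fermVec, smul_neg, Finset.sum_neg_distrib]

lemma superVector_sq {ι : I' → I} {κ : J' → J} (hι : Function.Injective ι)
    (hκ : Function.Injective κ) (z : I → ℝ) :
    (superVector ι κ z ^ 2 : SuperAlg I J) = (-∑ i, z (ι i) ^ 2) • 1 + fermNil κ := by
  rw [superVector_eq, pow_two, add_mul, mul_add, mul_add, bosVec_sq hι, fermVec_sq hκ,
    bosVec_mul_fermVec]
  abel

lemma fermNil_commute (κ : J' → J) (g : SuperAlg I J) : Commute (fermNil κ) g :=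
  Commute.sum_left _ _ _ fun _ _ => theta_mul_theta_commute _ _ g

lemma thetaPair_sq (j : J) :
    (theta (j, 0) * theta (j, 1) * (theta (j, 0) * theta (j, 1)) : SuperAlg I J) = 0 := by
  rw [mul_assoc, ← mul_assoc (theta (j, 1)), theta_anticomm (j, 1) (j, 0), neg_mul, mul_neg,
    ← mul_assoc, ← mul_assoc, theta_sq, zero_mul, zero_mul, neg_zero]

lemma fermNil_pow_eq_zero (κ : J' → J) {k : ℕ} (hk : Fintype.card J' < k) :
    (fermNil κ : SuperAlg I J) ^ k = 0 := by
  refine pow_eq_zero_of_le (m := Fintype.card J' + 1) hk ?_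
  exact sum_pow_eq_zero_of_sq_zero Finset.univ _ (fun i j => theta_mul_theta_commute _ _ _)
    fun j => thetaPair_sq _

lemma thetaPair_mul_fermPair (j : J) :
    (theta (j, 0) * theta (j, 1) * fermPair j : SuperAlg I J) = 0 := by
  have h1 : (theta (j, 0) * theta (j, 1) * theta (j, 0) : SuperAlg I J) = 0 := by
    rw [(theta_mul_theta_commute _ _ _).eq, ← mul_assoc, theta_sq, zero_mul]
  rw [fermPair, mul_add, ← mul_assoc, ← mul_assoc, h1, mul_assoc (theta (j, 0)) (theta _) (theta _),
    theta_sq]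
  simp

/-- The top power of the fermionic square is killed by every fermionic variable. -/
lemma fermNil_pow_card_mul_fermVec (κ : J' → J) :
    (fermNil κ ^ Fintype.card J' * fermVec κ : SuperAlg I J) = 0 := by
  classical
  rw [fermVec, Finset.mul_sum]
  refine Finset.sum_eq_zero fun j _ => ?_
  set B : SuperAlg I J := ∑ k ∈ Finset.univ.erase j, theta (κ k, 0) * theta (κ k, 1) with hB
  have hcard : Fintype.card J' = (Finset.univ.erase j).card + 1 := by
    rw [Finset.card_erase_add_one (Finset.mem_univ j)]; rfl
  have hN : (fermNil κ : SuperAlg I J) = theta (κ j, 0) * theta (κ j, 1) + B :=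
    (Finset.add_sum_erase _ _ (Finset.mem_univ j)).symm
  have hB0 : B ^ ((Finset.univ.erase j).card + 1) = 0 :=
    sum_pow_eq_zero_of_sq_zero _ _ (fun i j => theta_mul_theta_commute _ _ _)
      fun j => thetaPair_sq _
  rw [hN, hcard, add_pow_succ_of_sq_zero (theta_mul_theta_commute _ _ _) (thetaPair_sq _), hB0,
    zero_add, (theta_mul_theta_commute _ _ _).eq, smul_mul_assoc, mul_assoc,
    thetaPair_mul_fermPair, mul_zero, smul_zero]

/-- The fermionic part of `∂_x x² = 2 x + x² ∂_x`. -/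
lemma fermDirac_fermNil_mul {κ : J' → J} (hκ : Function.Injective κ) (g : SuperAlg I J) :
    fermDirac κ (fermNil κ * g) = (2 : ℝ) • (fermVec κ * g) + fermNil κ * fermDirac κ g := by
  classical
  have h0 : ∀ j : J', fermDeriv (κ j, 0) (fermNil κ * g) =
      theta (κ j, 1) * g + fermNil κ * fermDeriv (κ j, 0) g := by
    intro j
    have : ∀ k : J', fermDeriv (κ j, 0) (theta (κ k, 0) * theta (κ k, 1) * g) =
        (if j = k then theta (κ k, 1) * g else 0) +
          theta (κ k, 0) * theta (κ k, 1) * fermDeriv (κ j, 0) g := by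
      intro k
      rw [mul_assoc, fermDeriv_theta_mul, fermDeriv_theta_mul]
      by_cases h : j = k
      · simp [h, mul_assoc]
      · simp [h, hκ.ne h, mul_assoc]
    simp only [fermNil, Finset.sum_mul, map_sum, this, Finset.sum_add_distrib]
    simp
  have h1 : ∀ j : J', fermDeriv (κ j, 1) (fermNil κ * g) =
      -(theta (κ j, 0) * g) + fermNil κ * fermDeriv (κ j, 1) g := by
    intro j
    have : ∀ k : J', fermDeriv (κ j, 1) (theta (κ k, 0) * theta (κ k, 1) * g) =
        (if j = k then -(theta (κ k, 0) * g) else 0) +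
          theta (κ k, 0) * theta (κ k, 1) * fermDeriv (κ j, 1) g := by
      intro k
      rw [mul_assoc, fermDeriv_theta_mul, fermDeriv_theta_mul]
      by_cases h : j = k
      · simp [h, mul_assoc, mul_add, sub_eq_add_neg, add_comm]
      · simp [h, hκ.ne h, mul_assoc]
    simp only [fermNil, Finset.sum_mul, map_sum, this, Finset.sum_add_distrib]
    simp
  have hc : ∀ (a : J × Fin 2) (v : SuperAlg I J),
      eFerm a * (fermNil κ * v) = fermNil κ * (eFerm a * v) := fun a v => by
    rw [← mul_assoc, ← (fermNil_commute κ _).eq, mul_assoc]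
  rw [fermDirac_apply, fermDirac_apply, mul_smul_comm, ← smul_add, fermVec, Finset.mul_sum,
    Finset.sum_mul, ← Finset.sum_add_distrib]
  congr 1
  refine Finset.sum_congr rfl fun j _ => ?_
  rw [h0, h1, mul_add, mul_add, mul_neg, hc, hc, mul_sub, fermPair, add_mul,
    (theta_comm_eFerm (κ j, 0) (κ j, 0)).eq, (theta_comm_eFerm (κ j, 1) (κ j, 1)).eq, mul_assoc,
    mul_assoc]
  abel

/-- On elements without the fermionic variables in question, `∂_x̀ x̀ = -2n`. -/
lemma fermDirac_fermVec_mul {κ : J' → J} (hκ : Function.Injective κ) {g : SuperAlg I J}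
    (hg : ∀ (j : J') (u : Fin 2), fermDeriv (κ j, u) g = 0) :
    fermDirac κ (fermVec κ * g) = (-2 * (Fintype.card J' : ℝ)) • g := by
  classical
  have h : ∀ (j : J') (u : Fin 2), fermDeriv (κ j, u) (fermVec κ * g) = eFerm (κ j, u) * g := by
    intro j u
    have : ∀ k : J', fermDeriv (κ j, u) (fermPair (κ k) * g) =
        if j = k then eFerm (κ j, u) * g else 0 := by
      intro k
      rw [fermPair, add_mul, map_add, mul_assoc, mul_assoc, fermDeriv_theta_mul,
        fermDeriv_theta_mul, fermDeriv_eFerm_mul, fermDeriv_eFerm_mul, hg]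
      by_cases h : j = k
      · subst h
        fin_cases u <;> simp
      · simp [h, hκ.ne h]
    simp only [fermVec, Finset.sum_mul, map_sum, this]
    simp
  rw [fermDirac_apply]
  have h2 : ∀ j : J', eFerm (κ j, 1) * fermDeriv (κ j, 0) (fermVec κ * g) -
      eFerm (κ j, 0) * fermDeriv (κ j, 1) (fermVec κ * g) = -g := by
    intro j
    rw [h, h, ← mul_assoc, ← mul_assoc, ← sub_mul, eFerm_one_mul_eFerm_zero]
    simp
  simp only [h2, Finset.sum_const, Finset.card_univ, ← Nat.cast_smul_eq_nsmul ℝ, smul_neg,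
    smul_smul, neg_mul, neg_smul]

lemma fermDirac_eBos_mul (κ : J' → J) (i : I) (g : SuperAlg I J) :
    fermDirac κ (eBos i * g) = -(eBos i * fermDirac κ g) := by
  rw [fermDirac_apply, fermDirac_apply, mul_smul_comm, ← smul_neg, Finset.mul_sum,
    ← Finset.sum_neg_distrib]
  congr 1
  refine Finset.sum_congr rfl fun j _ => ?_
  rw [fermDeriv_eBos_mul, fermDeriv_eBos_mul, mul_sub, ← mul_assoc, ← mul_assoc, ← mul_assoc,
    ← mul_assoc, eBos_mul_eFerm, eBos_mul_eFerm]
  noncomm_ring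

lemma fermDirac_fermPair_mul {κ : J' → J} {k : J} (hk : ∀ j, κ j ≠ k) (g : SuperAlg I J) :
    fermDirac κ (fermPair k * g) = -(fermPair k * fermDirac κ g) := by
  have key : ∀ (j : J') (u v w : Fin 2), eFerm (κ j, u) *
      fermDeriv (κ j, v) (theta (k, w) * eFerm (k, w) * g) =
        -(theta (k, w) * eFerm (k, w) * (eFerm (κ j, u) * fermDeriv (κ j, v) g)) := by
    intro j u v w
    have hc : Commute (eFerm (κ j, u) : SuperAlg I J) (eFerm (k, w)) := eFerm_comm (hk j)
    have h0 : ((κ j, v) : J × Fin 2) ≠ (k, w) := fun h => hk j (congrArg Prod.fst h)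
    rw [mul_assoc, fermDeriv_theta_mul, fermDeriv_eFerm_mul, if_neg h0, zero_sub, mul_neg,
      ← mul_assoc, ← (theta_comm_eFerm _ _).eq, mul_assoc, ← mul_assoc (eFerm _) (eFerm _), hc.eq]
    simp only [mul_assoc]
  rw [fermDirac_apply, fermDirac_apply, mul_smul_comm, ← smul_neg, Finset.mul_sum,
    ← Finset.sum_neg_distrib]
  congr 1
  refine Finset.sum_congr rfl fun j _ => ?_
  simp only [fermPair, add_mul, map_add, mul_add, mul_sub, key]
  abel

lemma fermDirac_fermVec_mul_of_disjoint {J'' : Type} [Fintype J''] {κ : J' → J} {κ' : J'' → J}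
    (h : ∀ j k, κ j ≠ κ' k) (g : SuperAlg I J) :
    fermDirac κ (fermVec κ' * g) = -(fermVec κ' * fermDirac κ g) := by
  simp only [fermVec, Finset.sum_mul, map_sum, fermDirac_fermPair_mul fun j => h j _,
    Finset.sum_neg_distrib]

lemma diracPair_anticomm {j k : J} (h : j ≠ k) :
    (diracPair j * diracPair k : Module.End ℝ (SuperAlg I J)) = -(diracPair k * diracPair j) := by
  refine LinearMap.ext fun g => ?_
  have key : ∀ u v u' v' : Fin 2, (eFerm (j, u) * fermDeriv (j, v)
      (eFerm (k, u') * fermDeriv (k, v') g) : SuperAlg I J) =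
        -(eFerm (k, u') * fermDeriv (k, v') (eFerm (j, u) * fermDeriv (j, v) g)) := by
    intro u v u' v'
    have hc : Commute (eFerm (j, u) : SuperAlg I J) (eFerm (k, u')) := eFerm_comm h
    rw [fermDeriv_eFerm_mul, fermDeriv_eFerm_mul, ← mul_assoc, ← mul_assoc, hc.eq,
      fermDeriv_fermDeriv, mul_neg]
  change diracPair j (diracPair k g) = -(diracPair k (diracPair j g))
  simp only [diracPair_apply, map_sub, key]
  abel

lemma diracPair_sq (j : J) :
    (diracPair j * diracPair j : Module.End ℝ (SuperAlg I J)) =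
      fermDeriv (j, 0) * fermDeriv (j, 1) := by
  refine LinearMap.ext fun g => ?_
  change diracPair j (diracPair j g) = fermDeriv (j, 0) (fermDeriv (j, 1) g)
  simp only [diracPair_apply, map_sub, fermDeriv_eFerm_mul, fermDeriv_self, mul_zero]
  rw [← mul_assoc, ← mul_assoc, eFerm_one_mul_eFerm_zero, fermDeriv_fermDeriv (j, 1) (j, 0)]
  noncomm_ring

lemma fermDirac_sq {κ : J' → J} (hκ : Function.Injective κ) :
    (fermDirac κ * fermDirac κ : Module.End ℝ (SuperAlg I J)) =
      (4 : ℝ) • ∑ j : J', fermDeriv (κ j, 0) * fermDeriv (κ j, 1) := by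
  rw [fermDirac, smul_mul_smul_comm,
    sum_mul_self_of_anticomm _ _ fun i _ k _ h => diracPair_anticomm (hκ.ne h)]
  simp only [diracPair_sq]
  norm_num

/-- The fermionic part of the super Laplace operator. -/
def fermLap (κ : J' → J) : Module.End ℝ (SuperAlg I J) :=
  ∑ j : J', (-4 : ℝ) • (fermDeriv (κ j, 0) * fermDeriv (κ j, 1))

lemma fermLap_pow_eq_zero (κ : J' → J) {k : ℕ} (hk : Fintype.card J' < k) :
    (fermLap κ : Module.End ℝ (SuperAlg I J)) ^ k = 0 := by
  refine pow_eq_zero_of_le (m := Fintype.card J' + 1) hk ?_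
  refine sum_pow_eq_zero_of_sq_zero Finset.univ _ (fun i j => ?_) fun j => ?_
  · refine (Commute.smul_left ?_ _).smul_right _
    have h : ∀ a b c : J × Fin 2,
        Commute (fermDeriv a * fermDeriv b : Module.End ℝ (SuperAlg I J)) (fermDeriv c) := by
      intro a b c
      refine LinearMap.ext fun g => ?_
      change fermDeriv a (fermDeriv b (fermDeriv c g)) = fermDeriv c (fermDeriv a (fermDeriv b g))
      rw [fermDeriv_fermDeriv b c, map_neg, fermDeriv_fermDeriv a c, neg_neg]
    exact (h _ _ _).mul_right (h _ _ _)
  · rw [smul_mul_smul_comm]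
    refine LinearMap.ext fun g => ?_
    change (-4 * -4 : ℝ) • fermDeriv (κ j, 0) (fermDeriv (κ j, 1)
      (fermDeriv (κ j, 0) (fermDeriv (κ j, 1) g))) = 0
    rw [fermDeriv_fermDeriv (κ j, 1) (κ j, 0), map_neg, fermDeriv_self, neg_zero, smul_zero]

end Vectors

/-! ### Setting one group of fermionic variables to zero -/

section Body

variable {I I' Jx Jy : Type} [DecidableEq I] [DecidableEq Jx] [DecidableEq Jy]

/-- The projection of the span of the fermionic variables that kills those of the first group. -/
def dropLeft (Jx Jy : Type) : ((Jx ⊕ Jy) × Fin 2 → ℝ) →ₗ[ℝ] ((Jx ⊕ Jy) × Fin 2 → ℝ) :=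
  LinearMap.pi fun a => Sum.elim (fun _ => 0) (fun _ => LinearMap.proj a) a.1

/-- The algebra endomorphism of `𝔊 ⊗ 𝒞` that sets the first group of fermionic variables to zero
and fixes the other generators. -/
def body : SuperAlg I (Jx ⊕ Jy) →ₐ[ℝ] SuperAlg I (Jx ⊕ Jy) :=
  Algebra.TensorProduct.map (ExteriorAlgebra.map (dropLeft Jx Jy)) (AlgHom.id ℝ _)

lemma body_tmul (g : Grassmann (Jx ⊕ Jy)) (c : SuperClifford I (Jx ⊕ Jy)) :
    body (g ⊗ₜ[ℝ] c) = ExteriorAlgebra.map (dropLeft Jx Jy) g ⊗ₜ[ℝ] c := rfl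

lemma dropLeft_single_inl (j : Jx) (u : Fin 2) :
    dropLeft Jx Jy (Pi.single (Sum.inl j, u) 1) = 0 := by
  ext ⟨a | a, v⟩
  · simp [dropLeft]
  · simp [dropLeft]

lemma dropLeft_single_inr (j : Jy) (u : Fin 2) :
    dropLeft Jx Jy (Pi.single (Sum.inr j, u) 1) = Pi.single (Sum.inr j, u) 1 := by
  ext ⟨a | a, v⟩
  · simp [dropLeft]
  · simp [dropLeft]

lemma map_dropLeft_fermVar (j : Jy) (u : Fin 2) :
    ExteriorAlgebra.map (dropLeft Jx Jy) (fermVar (Sum.inr j, u)) = fermVar (Sum.inr j, u) := by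
  rw [fermVar, ExteriorAlgebra.map_apply_ι, dropLeft_single_inr]

lemma body_theta_inl (j : Jx) (u : Fin 2) :
    (body (theta (Sum.inl j, u)) : SuperAlg I (Jx ⊕ Jy)) = 0 := by
  rw [theta, body_tmul, fermVar, ExteriorAlgebra.map_apply_ι, dropLeft_single_inl, map_zero,
    TensorProduct.zero_tmul]

lemma body_eBos (i : I) : (body (eBos i) : SuperAlg I (Jx ⊕ Jy)) = eBos i := by
  rw [eBos, body_tmul, map_one]

lemma body_eFerm (a : (Jx ⊕ Jy) × Fin 2) :
    (body (eFerm a) : SuperAlg I (Jx ⊕ Jy)) = eFerm a := by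
  rw [eFerm, body_tmul, map_one]

/-- Contraction is natural in the underlying vector space. -/
lemma contractLeft_map {V W : Type*} [AddCommGroup V] [Module ℝ V] [AddCommGroup W] [Module ℝ W]
    (L : V →ₗ[ℝ] W) (d : Module.Dual ℝ W) (g : ExteriorAlgebra ℝ V) :
    CliffordAlgebra.contractLeft (Q := (0 : QuadraticForm ℝ W)) d (ExteriorAlgebra.map L g) =
      ExteriorAlgebra.map L
        (CliffordAlgebra.contractLeft (Q := (0 : QuadraticForm ℝ V)) (d ∘ₗ L) g) := by
  induction g using CliffordAlgebra.left_induction with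
  | algebraMap r =>
    rw [AlgHom.commutes, CliffordAlgebra.contractLeft_algebraMap]
    erw [CliffordAlgebra.contractLeft_algebraMap]
    rw [map_zero]
  | add x y hx hy => rw [map_add, map_add, hx, hy, map_add, map_add]
  | ι_mul x m hx =>
    rw [map_mul, CliffordAlgebra.contractLeft_ι_mul,
      show ExteriorAlgebra.map L (CliffordAlgebra.ι 0 m) = CliffordAlgebra.ι 0 (L m) from
        ExteriorAlgebra.map_apply_ι L m, CliffordAlgebra.contractLeft_ι_mul, hx, map_sub, map_smul,
      map_mul, show ExteriorAlgebra.map L (CliffordAlgebra.ι 0 m) = CliffordAlgebra.ι 0 (L m) from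
        ExteriorAlgebra.map_apply_ι L m]
    rfl

lemma fermDeriv_inl_body (j : Jx) (u : Fin 2) (g : SuperAlg I (Jx ⊕ Jy)) :
    fermDeriv (Sum.inl j, u) (body g) = 0 := by
  induction g using TensorProduct.induction_on with
  | zero => simp
  | tmul g c =>
    have h : (LinearMap.proj (Sum.inl j, u) : Module.Dual ℝ ((Jx ⊕ Jy) × Fin 2 → ℝ)) ∘ₗ
        dropLeft Jx Jy = 0 := by ext; simp [dropLeft]
    rw [body_tmul, fermDeriv_tmul, contractLeft_map, h, map_zero, LinearMap.zero_apply, map_zero,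
      TensorProduct.zero_tmul]
  | add x y hx hy => rw [map_add, map_add, hx, hy, add_zero]

lemma fermDeriv_inr_body (j : Jy) (u : Fin 2) (g : SuperAlg I (Jx ⊕ Jy)) :
    fermDeriv (Sum.inr j, u) (body g) = body (fermDeriv (Sum.inr j, u) g) := by
  induction g using TensorProduct.induction_on with
  | zero => simp
  | tmul g c =>
    have h : (LinearMap.proj (Sum.inr j, u) : Module.Dual ℝ ((Jx ⊕ Jy) × Fin 2 → ℝ)) ∘ₗ
        dropLeft Jx Jy = LinearMap.proj (Sum.inr j, u) := by ext; simp [dropLeft]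
    rw [body_tmul, fermDeriv_tmul, contractLeft_map, h, fermDeriv_tmul, body_tmul]
  | add x y hx hy => simp only [map_add, hx, hy]

lemma body_fermVec_inl [Fintype Jx] : (body (fermVec Sum.inl) : SuperAlg I (Jx ⊕ Jy)) = 0 := by
  simp [fermVec, fermPair, body_theta_inl]

lemma body_fermNil_inl [Fintype Jx] : (body (fermNil Sum.inl) : SuperAlg I (Jx ⊕ Jy)) = 0 := by
  simp [fermNil, body_theta_inl]

lemma body_bosVec [Fintype I'] (ι : I' → I) (z : I → ℝ) :
    (body (bosVec ι z) : SuperAlg I (Jx ⊕ Jy)) = bosVec ι z := by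
  simp [bosVec, body_eBos]

lemma body_superVector [Fintype I'] [Fintype Jx] (ι : I' → I) (z : I → ℝ) :
    (body (superVector ι Sum.inl z) : SuperAlg I (Jx ⊕ Jy)) = bosVec ι z := by
  rw [superVector_eq, map_add, body_fermVec_inl, body_bosVec, add_zero]

lemma fermDirac_inr_body [Fintype Jy] (g : SuperAlg I (Jx ⊕ Jy)) :
    fermDirac Sum.inr (body g) = body (fermDirac Sum.inr g) := by
  simp only [fermDirac_apply, fermDeriv_inr_body, map_smul, map_sum, map_sub, map_mul, body_eFerm]

end Body

/-! ### Partial derivatives tested against functionals -/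

section PartialDerivatives

variable {I A B : Type} [DecidableEq I] [AddCommGroup A] [Module ℝ A] [AddCommGroup B] [Module ℝ B]

lemma eq_of_forall_dual {a b : A} (h : ∀ φ : Module.Dual ℝ A, φ a = φ b) : a = b := by
  rw [← sub_eq_zero, ← Module.forall_dual_apply_eq_zero_iff ℝ]
  intro φ
  rw [map_sub, h, sub_self]

variable {i : I} {f g : (I → ℝ) → A} {d d' : A} {z : I → ℝ}

lemma HasPartialDeriv.unique (h : HasPartialDeriv i f d z) (h' : HasPartialDeriv i f d' z) :
    d = d' :=
  eq_of_forall_dual fun φ => (h φ).unique (h' φ)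

lemma HasPartialDeriv.partialDeriv_eq (h : HasPartialDeriv i f d z) : partialDeriv i f z = d := by
  have hex : ∃ d, HasPartialDeriv i f d z := ⟨d, h⟩
  rw [partialDeriv, dif_pos hex]
  exact hex.choose_spec.unique h

lemma HasPartialDeriv.add (h : HasPartialDeriv i f d z) (h' : HasPartialDeriv i g d' z) :
    HasPartialDeriv i (f + g) (d + d') z := fun φ => by
  simpa only [Pi.add_apply, map_add] using (h φ).fun_add (h' φ)

lemma HasPartialDeriv.const_smul (c : ℝ) (h : HasPartialDeriv i f d z) :
    HasPartialDeriv i (c • f) (c • d) z := fun φ => by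
  simpa only [Pi.smul_apply, map_smul, smul_eq_mul] using (h φ).const_mul c

lemma HasPartialDeriv.comp_linear (L : A →ₗ[ℝ] B) (h : HasPartialDeriv i f d z) :
    HasPartialDeriv i (fun z => L (f z)) (L d) z := fun φ => h (φ ∘ₗ L)

lemma hasDerivAt_comp_update [Fintype I] {F : (I → ℝ) → ℝ} (hF : DifferentiableAt ℝ F z) :
    HasDerivAt (fun t => F (Function.update z i t)) (fderiv ℝ F z (Pi.single i 1)) (z i) := by
  have h1 := hasDerivAt_update z i (z i)
  have h2 : HasFDerivAt F (fderiv ℝ F z) (Function.update z i (z i)) := by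
    rw [Function.update_eq_self]; exact hF.hasFDerivAt
  exact h2.comp_hasDerivAt (z i) h1

lemma hasPartialDeriv_of_fderiv [Fintype I]
    (hf : ∀ φ : Module.Dual ℝ A, DifferentiableAt ℝ (fun z => φ (f z)) z)
    (hd : ∀ φ : Module.Dual ℝ A, φ d = fderiv ℝ (fun z => φ (f z)) z (Pi.single i 1)) :
    HasPartialDeriv i f d z := fun φ => by
  rw [hd]; exact hasDerivAt_comp_update (hf φ)

lemma HasPartialDeriv.dual_eq_fderiv [Fintype I] (h : HasPartialDeriv i f d z)
    (φ : Module.Dual ℝ A) (hf : DifferentiableAt ℝ (fun z => φ (f z)) z) :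
    φ d = fderiv ℝ (fun z => φ (f z)) z (Pi.single i 1) :=
  (h φ).unique (hasDerivAt_comp_update hf)

end PartialDerivatives

/-! ### Analytic functions with values in a vector space without topology -/

section AnalyticModule

variable {I A : Type} [Fintype I] [AddCommGroup A] [Module ℝ A]

/-- The functions `∑ f_r • a_r` with `f_r` analytic on `U`, extended by zero outside `U`. The
extension makes functions that agree on `U` equal, so that differential operators on `U` become
endomorphisms of this space. -/
def analyticFunctions (U : Set (I → ℝ)) (A : Type) [AddCommGroup A] [Module ℝ A] :
    Submodule ℝ ((I → ℝ) → A) :=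
  Submodule.span ℝ {G | ∃ (f : (I → ℝ) → ℝ) (a : A), AnalyticOnNhd ℝ f U ∧
    G = fun y => U.indicator f y • a}

variable {U : Set (I → ℝ)}

lemma indicator_smul_mem {f : (I → ℝ) → ℝ} (hf : AnalyticOnNhd ℝ f U) (a : A) :
    (fun y => U.indicator f y • a) ∈ analyticFunctions U A :=
  Submodule.subset_span ⟨f, a, hf, rfl⟩

lemma analyticFunctions_eq_zero {G : (I → ℝ) → A} (hG : G ∈ analyticFunctions U A) {y : I → ℝ}
    (hy : y ∉ U) : G y = 0 := by
  induction hG using Submodule.span_induction with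
  | mem G h => obtain ⟨f, a, _, rfl⟩ := h; simp [hy]
  | zero => rfl
  | add G H _ _ hG hH => simp [hG, hH]
  | smul c G _ hG => simp [hG]

lemma analyticFunctions_ext {G H : analyticFunctions U A} (h : ∀ y ∈ U, G.1 y = H.1 y) :
    G = H := by
  ext y
  by_cases hy : y ∈ U
  · exact h y hy
  · rw [analyticFunctions_eq_zero G.2 hy, analyticFunctions_eq_zero H.2 hy]

lemma analyticOnNhd_dual (hU : IsOpen U) {G : (I → ℝ) → A} (hG : G ∈ analyticFunctions U A)
    (φ : Module.Dual ℝ A) : AnalyticOnNhd ℝ (fun y => φ (G y)) U := by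
  induction hG using Submodule.span_induction with
  | mem G h =>
    obtain ⟨f, a, hf, rfl⟩ := h
    have : AnalyticOnNhd ℝ (fun y => f y * φ a) U := hf.mul analyticOnNhd_const
    refine this.congr hU fun y hy => ?_
    simp [hy]
  | zero => simpa using analyticOnNhd_const
  | add G H _ _ hG hH =>
    simp only [Pi.add_apply, map_add]
    exact AnalyticOnNhd.add hG hH
  | smul c G _ hG => simpa using analyticOnNhd_const.mul hG

lemma comp_linear_mem {B : Type} [AddCommGroup B] [Module ℝ B] (L : A →ₗ[ℝ] B) {G : (I → ℝ) → A}
    (hG : G ∈ analyticFunctions U A) : (fun y => L (G y)) ∈ analyticFunctions U B := by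
  induction hG using Submodule.span_induction with
  | mem G h =>
    obtain ⟨f, a, hf, rfl⟩ := h
    simpa using indicator_smul_mem hf (L a)
  | zero =>
    simp only [Pi.zero_apply, map_zero]
    exact zero_mem _
  | add G H _ _ hG hH =>
    simp only [Pi.add_apply, map_add]
    exact add_mem hG hH
  | smul c G _ hG =>
    simp only [Pi.smul_apply, map_smul]
    exact Submodule.smul_mem _ c hG

/-- Linear maps act on vector-valued analytic functions by composition. -/
def postcomp {B : Type} [AddCommGroup B] [Module ℝ B] (U : Set (I → ℝ)) (L : A →ₗ[ℝ] B) :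
    analyticFunctions U A →ₗ[ℝ] analyticFunctions U B where
  toFun G := ⟨fun y => L (G.1 y), comp_linear_mem L G.2⟩
  map_add' G H := by ext y; exact map_add L _ _
  map_smul' c G := by ext y; exact map_smul L _ _

/-- `postcomp` as a homomorphism of algebras. -/
def postEnd (U : Set (I → ℝ)) (A : Type) [AddCommGroup A] [Module ℝ A] :
    Module.End ℝ A →ₐ[ℝ] Module.End ℝ (analyticFunctions U A) :=
  AlgHom.ofLinearMap
    { toFun := fun L => postcomp U L
      map_add' := fun _ _ => rfl
      map_smul' := fun _ _ => rfl } rfl fun _ _ => rfl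

lemma postEnd_apply (L : Module.End ℝ A) (G : analyticFunctions U A) (y : I → ℝ) :
    (postEnd U A L G).1 y = L (G.1 y) := rfl

variable [DecidableEq I]

lemma exists_hasPartialDeriv (hU : IsOpen U) (i : I) {G : (I → ℝ) → A}
    (hG : G ∈ analyticFunctions U A) :
    ∃ G' ∈ analyticFunctions U A, ∀ y ∈ U, HasPartialDeriv i G (G' y) y := by
  induction hG using Submodule.span_induction with
  | mem G h =>
    obtain ⟨f, a, hf, rfl⟩ := h
    refine ⟨_, indicator_smul_mem (f := fun y => fderiv ℝ f y (Pi.single i 1))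
      (fun y hy => (ContinuousLinearMap.apply ℝ ℝ (Pi.single i (1 : ℝ) : I → ℝ)).analyticAt _ |>.comp
        (hf.fderiv y hy)) a, fun y hy φ => ?_⟩
    have h1 := (hasDerivAt_comp_update (i := i) (hf y hy).differentiableAt).mul_const (φ a)
    have h2 : ∀ᶠ t in 𝓝 (y i), Function.update y i t ∈ U := by
      have : ContinuousAt (Function.update y i) (y i) :=
        (continuous_const.update i continuous_id).continuousAt
      apply this
      rw [Function.update_eq_self]
      exact hU.mem_nhds hy
    simp only [hy, Set.indicator_of_mem, map_smul, smul_eq_mul]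
    refine h1.congr_of_eventuallyEq (h2.mono fun t ht => ?_)
    simp [ht]
  | zero =>
    refine ⟨0, zero_mem _, fun y _ φ => ?_⟩
    simpa using hasDerivAt_const (y i) (0 : ℝ)
  | add G H _ _ hG hH =>
    obtain ⟨G', hG', h1⟩ := hG
    obtain ⟨H', hH', h2⟩ := hH
    exact ⟨G' + H', add_mem hG' hH', fun y hy => (h1 y hy).add (h2 y hy)⟩
  | smul c G _ hG =>
    obtain ⟨G', hG', h1⟩ := hG
    exact ⟨c • G', Submodule.smul_mem _ c hG', fun y hy => (h1 y hy).const_smul c⟩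

/-- The partial derivative of an analytic function, extended by zero. -/
def pderiv (hU : IsOpen U) (i : I) : Module.End ℝ (analyticFunctions U A) where
  toFun G := ⟨(exists_hasPartialDeriv hU i G.2).choose,
    (exists_hasPartialDeriv hU i G.2).choose_spec.1⟩
  map_add' G H := analyticFunctions_ext fun y hy =>
    ((exists_hasPartialDeriv hU i (G + H).2).choose_spec.2 y hy).unique
      (((exists_hasPartialDeriv hU i G.2).choose_spec.2 y hy).add
        ((exists_hasPartialDeriv hU i H.2).choose_spec.2 y hy))
  map_smul' c G := analyticFunctions_ext fun y hy =>
    ((exists_hasPartialDeriv hU i (c • G).2).choose_spec.2 y hy).unique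
      (((exists_hasPartialDeriv hU i G.2).choose_spec.2 y hy).const_smul c)

lemma hasPartialDeriv_pderiv (hU : IsOpen U) (i : I) (G : analyticFunctions U A) {y : I → ℝ}
    (hy : y ∈ U) : HasPartialDeriv i G.1 ((pderiv hU i G).1 y) y :=
  (exists_hasPartialDeriv hU i G.2).choose_spec.2 y hy

lemma dual_pderiv (hU : IsOpen U) (i : I) (G : analyticFunctions U A) (φ : Module.Dual ℝ A)
    {y : I → ℝ} (hy : y ∈ U) :
    φ ((pderiv hU i G).1 y) = fderiv ℝ (fun y => φ (G.1 y)) y (Pi.single i 1) :=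
  (hasPartialDeriv_pderiv hU i G hy).dual_eq_fderiv φ
    (analyticOnNhd_dual hU G.2 φ y hy).differentiableAt

lemma fderiv_fderiv_comm {E : Type*} [NormedAddCommGroup E] [NormedSpace ℝ E] {F : E → ℝ} {y : E}
    (hF : ContDiffAt ℝ 2 F y) (u v : E) :
    fderiv ℝ (fun y => fderiv ℝ F y u) y v = fderiv ℝ (fun y => fderiv ℝ F y v) y u := by
  have hd : DifferentiableAt ℝ (fderiv ℝ F) y :=
    (hF.fderiv_right (m := 1) (by norm_num)).differentiableAt (by norm_num)
  have h : ∀ w : E, fderiv ℝ (fun y => fderiv ℝ F y w) y =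
      (fderiv ℝ (fderiv ℝ F) y).flip w := by
    intro w
    rw [fderiv_clm_apply hd (differentiableAt_const w)]
    simp
  rw [h, h, ContinuousLinearMap.flip_apply, ContinuousLinearMap.flip_apply]
  exact (hF.isSymmSndFDerivAt (by simp)).eq v u

lemma pderiv_comm (hU : IsOpen U) (i k : I) :
    Commute (pderiv hU i : Module.End ℝ (analyticFunctions U A)) (pderiv hU k) := by
  refine LinearMap.ext fun G => analyticFunctions_ext fun y hy => eq_of_forall_dual fun φ => ?_
  change φ ((pderiv hU i (pderiv hU k G)).1 y) = φ ((pderiv hU k (pderiv hU i G)).1 y)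
  have h : ∀ k, (fun y => φ ((pderiv hU k G).1 y)) =ᶠ[𝓝 y]
      fun y => fderiv ℝ (fun y => φ (G.1 y)) y (Pi.single k 1) := fun k => by
    filter_upwards [hU.mem_nhds hy] with y' hy' using dual_pderiv hU k G φ hy'
  rw [dual_pderiv hU _ _ _ hy, dual_pderiv hU _ _ _ hy, (h k).fderiv_eq, (h i).fderiv_eq]
  exact fderiv_fderiv_comm (analyticOnNhd_dual hU G.2 φ y hy).contDiffAt _ _

lemma pderiv_postcomp {B : Type} [AddCommGroup B] [Module ℝ B] (hU : IsOpen U) (i : I)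
    (L : A →ₗ[ℝ] B) (G : analyticFunctions U A) :
    pderiv hU i (postcomp U L G) = postcomp U L (pderiv hU i G) :=
  analyticFunctions_ext fun _ hy => (hasPartialDeriv_pderiv hU i _ hy).unique
    ((hasPartialDeriv_pderiv hU i G hy).comp_linear L)

lemma pderiv_postEnd (hU : IsOpen U) (i : I) (L : Module.End ℝ A) :
    Commute (pderiv hU i) (postEnd U A L) :=
  LinearMap.ext fun G => pderiv_postcomp hU i L G

end AnalyticModule

/-! ### The super Dirac and Laplace operators on analytic superfunctions -/

section AnalyticOperators

variable {I J I' J' : Type} [DecidableEq I] [DecidableEq J] [DecidableEq I'] [Fintype I']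
  [Fintype J'] {U : Set (I' → ℝ)}

/-- The super Dirac operator on analytic superfunctions. -/
def analyticDirac (hU : IsOpen U) (ι : I' → I) (κ : J' → J) :
    Module.End ℝ (analyticFunctions U (SuperAlg I J)) :=
  postEnd U _ (fermDirac κ) - ∑ i, postEnd U _ (LinearMap.mulLeft ℝ (eBos (ι i))) * pderiv hU i

/-- The bosonic Laplace operator on vector-valued analytic functions. -/
def analyticBosLap (hU : IsOpen U) (A : Type) [AddCommGroup A] [Module ℝ A] :
    Module.End ℝ (analyticFunctions U A) :=
  ∑ i, pderiv hU i * pderiv hU i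

/-- The super Laplace operator on analytic superfunctions. -/
def analyticLap (hU : IsOpen U) (κ : J' → J) :
    Module.End ℝ (analyticFunctions U (SuperAlg I J)) :=
  analyticBosLap hU _ + postEnd U _ (fermLap κ)

lemma analyticDirac_sq (hU : IsOpen U) {ι : I' → I} {κ : J' → J} (hι : Function.Injective ι)
    (hκ : Function.Injective κ) :
    analyticDirac hU ι κ * analyticDirac hU ι κ = -analyticLap hU κ := by
  have hm : ∀ (i : I') (g : SuperAlg I J) (G : analyticFunctions U (SuperAlg I J)),
      pderiv hU i (postEnd U _ (LinearMap.mulLeft ℝ g) G) =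
        postEnd U _ (LinearMap.mulLeft ℝ g) (pderiv hU i G) :=
    fun i g G => pderiv_postcomp hU i _ G
  have h := sub_sum_mul_self_of_anticomm (R := Module.End ℝ (analyticFunctions U (SuperAlg I J)))
    Finset.univ (postEnd U _ (fermDirac κ))
    (fun i => postEnd U _ (LinearMap.mulLeft ℝ (eBos (ι i))) * pderiv hU i)
    (fun i => pderiv hU i * pderiv hU i) (fun i _ => ?_) (fun i _ k _ h => ?_) (fun i _ => ?_)
  · refine h.trans ?_
    refine LinearMap.ext fun G => ?_
    have hf := LinearMap.congr_fun (fermDirac_sq (I := I) hκ)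
    change _ - analyticBosLap hU _ G = -(analyticBosLap hU _ G + postEnd U _ (fermLap κ) G)
    rw [neg_add, sub_eq_neg_add]
    congr 1
    ext y
    refine (hf (G.1 y)).trans ?_
    change _ = -(fermLap κ (G.1 y))
    simp [fermLap, Finset.smul_sum]
  · refine LinearMap.ext fun G => ?_
    change postEnd U _ (fermDirac κ) (postEnd U _ _ (pderiv hU i G)) =
      -(postEnd U _ _ (pderiv hU i (postcomp U (fermDirac κ) G)))
    rw [pderiv_postcomp]
    ext y
    exact fermDirac_eBos_mul κ _ _
  · refine LinearMap.ext fun G => ?_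
    change postEnd U _ _ (pderiv hU i (postEnd U _ _ (pderiv hU k G))) =
      -(postEnd U _ _ (pderiv hU k (postEnd U _ _ (pderiv hU i G))))
    rw [hm, hm, show pderiv hU i (pderiv hU k G) = pderiv hU k (pderiv hU i G) from
      LinearMap.congr_fun (pderiv_comm hU i k) G]
    ext y
    change eBos _ * (eBos _ * _) = -(eBos _ * (eBos _ * _))
    rw [← mul_assoc, ← mul_assoc, eBos_anticomm (hι.ne h), neg_mul]
  · refine LinearMap.ext fun G => ?_
    change postEnd U _ _ (pderiv hU i (postEnd U _ _ (pderiv hU i G))) =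
      -(pderiv hU i (pderiv hU i G))
    rw [hm]
    ext y
    change eBos _ * (eBos _ * _) = -_
    rw [← mul_assoc, eBos_sq, neg_one_mul]

end AnalyticOperators

/-! ### Growth of iterated derivatives of analytic functions -/

section Growth

open scoped NNReal ENNReal in
/-- Cauchy's estimates: the iterated derivatives of an analytic function grow at most like
`k! K ^ k`, locally uniformly. -/
lemma exists_bound_iteratedFDeriv {E : Type*} [NormedAddCommGroup E] [NormedSpace ℝ E]
    {f : E → ℝ} {y₀ : E} (hf : AnalyticAt ℝ f y₀) :
    ∃ C K : ℝ, 0 ≤ C ∧ 1 ≤ K ∧ ∀ᶠ y in 𝓝 y₀, ∀ (k : ℕ) (v : Fin k → E), (∀ i, ‖v i‖ ≤ 1) →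
      |iteratedFDeriv ℝ k f y v| ≤ C * k.factorial * K ^ k := by
  obtain ⟨p, r, hp⟩ := hf
  obtain ⟨R, hR0, hR⟩ := ENNReal.lt_iff_exists_nnreal_btwn.mp hp.r_pos
  have hR0' : 0 < R := by exact_mod_cast hR0
  -- Recentring at `x` with `‖x‖ < ρ` keeps a radius `ρ`, as `2 ρ` is below the radius of
  -- convergence; `ρ ≤ 1` makes `K = ρ⁻¹` at least `1`.
  set ρ : ℝ≥0 := min (R / 2) 1 with hρ
  have hρ0 : 0 < ρ := lt_min (half_pos hR0') one_pos
  have hρR : (ρ + ρ : ℝ≥0∞) < p.radius := by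
    refine lt_of_le_of_lt ?_ (hR.trans_le hp.r_le)
    have : ρ + ρ ≤ R := (add_le_add (min_le_left _ _) (min_le_left _ _)).trans (add_halves R).le
    exact_mod_cast this
  have hsum := p.changeOriginSeries_summable_aux₁ hρR
  have hsum2 := (NNReal.summable_sigma.1 hsum).2
  have hfib := (NNReal.summable_sigma.1 hsum).1
  set C : ℝ≥0 := ∑' k : ℕ, ∑' s : Σ l : ℕ, { s : Finset (Fin (k + l)) // s.card = l },
    ‖p (k + s.1)‖₊ * ρ ^ s.1 * ρ ^ k with hC
  have hρr : (ρ : ℝ≥0∞) < r := by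
    refine lt_of_le_of_lt ?_ hR
    exact_mod_cast (min_le_left _ _).trans (half_le_self hR0'.le)
  have key : ∀ x : E, ‖x‖₊ < ρ → ∀ k, ‖p.changeOrigin x k‖₊ * ρ ^ k ≤ C := by
    intro x hx k
    have hxr : (‖x‖₊ : ℝ≥0∞) < p.radius := by
      refine lt_of_lt_of_le ?_ hp.r_le
      exact lt_trans (by exact_mod_cast hx) hρr
    have hsx := p.changeOriginSeries_summable_aux₂ (r := ρ) (hρr.trans_le hp.r_le) k
    calc ‖p.changeOrigin x k‖₊ * ρ ^ k
        ≤ (∑' s : Σ l : ℕ, { s : Finset (Fin (k + l)) // s.card = l },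
            ‖p (k + s.1)‖₊ * ‖x‖₊ ^ s.1) * ρ ^ k := by
          gcongr; exact p.nnnorm_changeOrigin_le k hxr
      _ ≤ (∑' s : Σ l : ℕ, { s : Finset (Fin (k + l)) // s.card = l },
            ‖p (k + s.1)‖₊ * ρ ^ s.1) * ρ ^ k := by
          refine mul_le_mul_of_nonneg_right ?_ (zero_le)
          refine (p.changeOriginSeries_summable_aux₂ hxr k).tsum_le_tsum (fun s => ?_) hsx
          gcongr
      _ = ∑' s : Σ l : ℕ, { s : Finset (Fin (k + l)) // s.card = l },
            ‖p (k + s.1)‖₊ * ρ ^ s.1 * ρ ^ k := NNReal.tsum_mul_right _ _ |>.symm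
      _ ≤ C := hsum2.le_tsum k fun _ _ => zero_le
  refine ⟨C, (ρ : ℝ)⁻¹, C.2, ?_, ?_⟩
  · rw [one_le_inv₀ (by exact_mod_cast hρ0)]
    exact_mod_cast (min_le_right _ _ : ρ ≤ 1)
  · have hball : Metric.ball y₀ ρ ∈ 𝓝 y₀ := Metric.ball_mem_nhds _ (by exact_mod_cast hρ0)
    filter_upwards [hball] with y hy k v hv
    set x : E := y - y₀ with hx
    have hxρ : ‖x‖₊ < ρ := by
      have : ‖y - y₀‖ < ρ := by rwa [Metric.mem_ball, dist_eq_norm] at hy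
      exact_mod_cast this
    have hps := hp.changeOrigin (y := x) (lt_trans (by exact_mod_cast hxρ) hρr)
    have hyx : y₀ + x = y := by rw [hx]; abel
    rw [hyx] at hps
    rw [hps.iteratedFDeriv_eq_sum_of_completeSpace]
    have hterm : ∀ σ : Equiv.Perm (Fin k), |p.changeOrigin x k fun i => v (σ i)| ≤
        C * (ρ : ℝ)⁻¹ ^ k := by
      intro σ
      have h1 : |p.changeOrigin x k fun i => v (σ i)| ≤ ‖p.changeOrigin x k‖ * ∏ i, ‖v (σ i)‖ :=
        (p.changeOrigin x k).le_opNorm _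
      have h2 : ∏ i, ‖v (σ i)‖ ≤ 1 := Finset.prod_le_one (fun _ _ => norm_nonneg _) fun i _ => hv _
      have h3 : ‖p.changeOrigin x k‖ * (ρ : ℝ) ^ k ≤ C := by exact_mod_cast key x hxρ k
      have h4 : (0 : ℝ) < (ρ : ℝ) ^ k := pow_pos (by exact_mod_cast hρ0) k
      calc _ ≤ ‖p.changeOrigin x k‖ * 1 := h1.trans (by gcongr)
        _ ≤ C * (ρ : ℝ)⁻¹ ^ k := by
          rw [mul_one, inv_pow, ← div_eq_mul_inv, le_div_iff₀ h4]; exact h3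
    calc _ ≤ ∑ σ : Equiv.Perm (Fin k), |p.changeOrigin x k fun i => v (σ i)| :=
          Finset.abs_sum_le_sum_abs _ _
      _ ≤ ∑ _σ : Equiv.Perm (Fin k), C * (ρ : ℝ)⁻¹ ^ k := Finset.sum_le_sum fun σ _ => hterm σ
      _ = C * k.factorial * (ρ : ℝ)⁻¹ ^ k := by
        rw [Finset.sum_const, Finset.card_univ, Fintype.card_perm, Fintype.card_fin, nsmul_eq_mul]
        ring

variable {I : Type} [Fintype I] [DecidableEq I] {U : Set (I → ℝ)}

lemma pderiv_iteratedFDeriv (hU : IsOpen U) (i : I) (f g : analyticFunctions U ℝ) (k : ℕ)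
    (v : Fin k → I → ℝ) (hg : ∀ y ∈ U, g.1 y = iteratedFDeriv ℝ k f.1 y v) {y : I → ℝ}
    (hy : y ∈ U) :
    (pderiv hU i g).1 y = iteratedFDeriv ℝ (k + 1) f.1 y (Fin.cons (Pi.single i 1) v) := by
  have h := dual_pderiv hU i g LinearMap.id hy
  have hgy : (fun y => (LinearMap.id : ℝ →ₗ[ℝ] ℝ) (g.1 y)) =ᶠ[𝓝 y]
      fun y => iteratedFDeriv ℝ k f.1 y v := by
    filter_upwards [hU.mem_nhds hy] with y' hy' using hg y' hy'
  have hf : AnalyticAt ℝ f.1 y := analyticOnNhd_dual hU f.2 LinearMap.id y hy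
  have hd : DifferentiableAt ℝ (iteratedFDeriv ℝ k f.1) y :=
    (hf.contDiffAt (n := ∞)).differentiableAt_iteratedFDeriv (by exact_mod_cast ENat.natCast_lt_top k)
  rw [hgy.fderiv_eq] at h
  rw [iteratedFDeriv_succ_apply_left, Fin.cons_zero, Fin.tail_cons]
  refine h.trans ?_
  rw [fderiv_continuousMultilinear_apply_const_apply hd]

/-- `Δ^j` applied to a `k`-th derivative is a sum of `|I| ^ j` derivatives of order `k + 2j`. The
order `N = k + 2j` is a separate variable so that the induction on `j` needs no casts between
multilinear maps. -/
lemma abs_analyticBosLap_pow_le (hU : IsOpen U) (f : analyticFunctions U ℝ) {y : I → ℝ}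
    (hy : y ∈ U) (j : ℕ) : ∀ (k N : ℕ) (v : Fin k → I → ℝ) (g : analyticFunctions U ℝ) (B : ℝ),
      N = k + 2 * j → (∀ i, ‖v i‖ ≤ 1) → (∀ y ∈ U, g.1 y = iteratedFDeriv ℝ k f.1 y v) →
      (∀ w : Fin N → I → ℝ, (∀ i, ‖w i‖ ≤ 1) → |iteratedFDeriv ℝ N f.1 y w| ≤ B) →
      |((analyticBosLap hU ℝ ^ j) g).1 y| ≤ (Fintype.card I : ℝ) ^ j * B := by
  induction j with
  | zero =>
    intro k N v g B hN hv hg hB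
    obtain rfl : N = k := hN
    simpa [hg y hy] using hB v hv
  | succ j ih =>
    intro k N v g B hN hv hg hB
    have hsingle : ∀ i : I, ‖(Pi.single i 1 : I → ℝ)‖ ≤ 1 := fun i => by
      rw [pi_norm_le_iff_of_nonneg zero_le_one]
      intro k
      by_cases h : k = i
      · subst h; simp
      · simp [h]
    have hstep : ((analyticBosLap hU ℝ ^ (j + 1)) g).1 y =
        ∑ i, ((analyticBosLap hU ℝ ^ j) (pderiv hU i (pderiv hU i g))).1 y := by
      have h1 : (analyticBosLap hU ℝ ^ (j + 1)) g =
          (analyticBosLap hU ℝ ^ j) (∑ i, pderiv hU i (pderiv hU i g)) := by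
        rw [pow_succ, Module.End.mul_apply]
        congr 1
        simp [analyticBosLap]
      rw [h1, map_sum, AddSubmonoidClass.coe_finsetSum, Finset.sum_apply]
    rw [hstep]
    calc _ ≤ ∑ i, |((analyticBosLap hU ℝ ^ j) (pderiv hU i (pderiv hU i g))).1 y| :=
          Finset.abs_sum_le_sum_abs _ _
      _ ≤ ∑ _i : I, (Fintype.card I : ℝ) ^ j * B := by
        refine Finset.sum_le_sum fun i _ => ?_
        refine ih (k + 2) N (Fin.cons (Pi.single i 1) (Fin.cons (Pi.single i 1) v)) _ B
          (by omega) ?_ ?_ hB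
        · refine Fin.cases (hsingle i) (Fin.cases (hsingle i) hv)
        · intro y hy
          refine pderiv_iteratedFDeriv hU i f _ (k + 1) _ (fun y hy => ?_) hy
          exact pderiv_iteratedFDeriv hU i f _ k _ hg hy
      _ = (Fintype.card I : ℝ) ^ (j + 1) * B := by
        rw [Finset.sum_const, Finset.card_univ, nsmul_eq_mul]; ring

lemma abs_analyticBosLap_pow_le_of_bound (hU : IsOpen U) (f : analyticFunctions U ℝ) {y : I → ℝ}
    (hy : y ∈ U) (j : ℕ) {B : ℝ} (hB : ∀ w : Fin (2 * j) → I → ℝ, (∀ i, ‖w i‖ ≤ 1) →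
      |iteratedFDeriv ℝ (2 * j) f.1 y w| ≤ B) :
    |((analyticBosLap hU ℝ ^ j) f).1 y| ≤ (Fintype.card I : ℝ) ^ j * B :=
  abs_analyticBosLap_pow_le hU f hy j 0 (2 * j) Fin.elim0 f B (by omega) (fun i => i.elim0)
    (fun y _ => by simp) hB

lemma analyticBosLap_pow_postcomp {A B : Type} [AddCommGroup A] [Module ℝ A] [AddCommGroup B]
    [Module ℝ B] (hU : IsOpen U) (L : A →ₗ[ℝ] B) (j : ℕ) (G : analyticFunctions U A) :
    (analyticBosLap hU B ^ j) (postcomp U L G) = postcomp U L ((analyticBosLap hU A ^ j) G) := by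
  induction j generalizing G with
  | zero => rfl
  | succ j ih =>
    rw [pow_succ, pow_succ, Module.End.mul_apply, Module.End.mul_apply, ← ih]
    congr 1
    simp only [analyticBosLap, LinearMap.sum_apply, Module.End.mul_apply, pderiv_postcomp, map_sum]

variable {K J' : Type} [DecidableEq K] {J : Type} [DecidableEq J] [Fintype J']

/-- The iterated super Laplacians of an analytic superfunction grow at most like `(2j)! K ^ j`,
locally uniformly, with the same `K` for all components. -/
lemma exists_bound_analyticLap_pow (hU : IsOpen U) (κ : J' → J)
    (u : analyticFunctions U (SuperAlg K J)) {y₀ : I → ℝ} (hy₀ : y₀ ∈ U) :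
    ∃ R : ℝ, 1 ≤ R ∧ ∃ W ∈ 𝓝 y₀, W ⊆ U ∧ ∀ φ : Module.Dual ℝ (SuperAlg K J), ∃ C : ℝ, 0 ≤ C ∧
      ∀ y ∈ W, ∀ j : ℕ, |φ (((analyticLap hU κ ^ j) u).1 y)| ≤ C * (2 * j).factorial * R ^ j := by
  obtain ⟨G, hG⟩ := u
  induction hG using Submodule.span_induction with
  | zero =>
    refine ⟨1, le_rfl, U, hU.mem_nhds hy₀, subset_rfl, fun φ => ⟨0, le_rfl, fun y _ j => ?_⟩⟩
    have : (analyticLap hU κ ^ j) (⟨0, zero_mem _⟩ : analyticFunctions U (SuperAlg K J)) = 0 :=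
      map_zero _
    rw [this]
    simp
  | add G H hG hH ihG ihH =>
    obtain ⟨R, hR, W, hW, hWU, h⟩ := ihG
    obtain ⟨R', hR', W', hW', -, h'⟩ := ihH
    refine ⟨max R R', hR.trans (le_max_left _ _), W ∩ W', inter_mem hW hW',
      Set.inter_subset_left.trans hWU, fun φ => ?_⟩
    obtain ⟨C, hC, hφ⟩ := h φ
    obtain ⟨C', hC', hφ'⟩ := h' φ
    refine ⟨C + C', add_nonneg hC hC', fun y hy j => ?_⟩
    have : (analyticLap hU κ ^ j) (⟨G + H, add_mem hG hH⟩ : analyticFunctions U (SuperAlg K J)) =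
        (analyticLap hU κ ^ j) ⟨G, hG⟩ + (analyticLap hU κ ^ j) ⟨H, hH⟩ :=
      LinearMap.map_add (analyticLap hU κ ^ j) ⟨G, hG⟩ ⟨H, hH⟩
    rw [this, Submodule.coe_add, Pi.add_apply, map_add]
    calc _ ≤ _ := abs_add_le _ _
      _ ≤ C * (2 * j).factorial * R ^ j + C' * (2 * j).factorial * R' ^ j :=
        add_le_add (hφ y hy.1 j) (hφ' y hy.2 j)
      _ ≤ C * (2 * j).factorial * max R R' ^ j + C' * (2 * j).factorial * max R R' ^ j := by
        have : 0 ≤ R := zero_le_one.trans hR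
        have : 0 ≤ R' := zero_le_one.trans hR'
        gcongr
        · exact le_max_left _ _
        · exact le_max_right _ _
      _ = _ := by ring
  | smul c G hG ihG =>
    obtain ⟨R, hR, W, hW, hWU, h⟩ := ihG
    refine ⟨R, hR, W, hW, hWU, fun φ => ?_⟩
    obtain ⟨C, hC, hφ⟩ := h φ
    refine ⟨|c| * C, by positivity, fun y hy j => ?_⟩
    have : (analyticLap hU κ ^ j) (⟨c • G, Submodule.smul_mem _ c hG⟩ :
        analyticFunctions U (SuperAlg K J)) = c • (analyticLap hU κ ^ j) ⟨G, hG⟩ :=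
      LinearMap.map_smul (analyticLap hU κ ^ j) c ⟨G, hG⟩
    rw [this, Submodule.coe_smul, Pi.smul_apply, map_smul, smul_eq_mul, abs_mul, mul_assoc,
      mul_assoc]
    gcongr
    rw [← mul_assoc]
    exact hφ y hy j
  | mem G h =>
    obtain ⟨f, a, hf, rfl⟩ := h
    obtain ⟨C, M, hC, hM, hbound⟩ := exists_bound_iteratedFDeriv (hf y₀ hy₀)
    set f₁ : analyticFunctions U ℝ :=
      ⟨fun y => U.indicator f y • (1 : ℝ), indicator_smul_mem hf 1⟩ with hf₁
    set P : ℝ := Fintype.card I + 1 with hP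
    have hP1 : 1 ≤ P := by rw [hP]; linarith [(Nat.cast_nonneg (Fintype.card I) : (0 : ℝ) ≤ _)]
    have hM0 : 0 ≤ M := zero_le_one.trans hM
    have hscal : ∀ y ∈ {y | ∀ (k : ℕ) (v : Fin k → I → ℝ), (∀ i, ‖v i‖ ≤ 1) →
        |iteratedFDeriv ℝ k f y v| ≤ C * k.factorial * M ^ k} ∩ U, ∀ i j : ℕ, i ≤ j →
        |((analyticBosLap hU ℝ ^ i) f₁).1 y| ≤ C * (2 * j).factorial * (P * M ^ 2) ^ j := by
      intro y hy i j hij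
      have hev : f₁.1 =ᶠ[𝓝 y] f := by
        filter_upwards [hU.mem_nhds hy.2] with y' hy'
        simp [hf₁, hy']
      have h1 := abs_analyticBosLap_pow_le_of_bound hU f₁ hy.2 i
        (B := C * (2 * i).factorial * M ^ (2 * i)) fun w hw => by
          rw [(hev.iteratedFDeriv ℝ (2 * i)).eq_of_nhds]
          exact hy.1 _ w hw
      have hfac : ((2 * i).factorial : ℝ) ≤ (2 * j).factorial := by
        exact_mod_cast Nat.factorial_le (by omega)
      calc _ ≤ _ := h1
        _ ≤ P ^ i * (C * (2 * j).factorial * M ^ (2 * i)) := by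
          gcongr
          rw [hP]; linarith
        _ = C * (2 * j).factorial * (P * M ^ 2) ^ i := by rw [mul_pow, ← pow_mul]; ring
        _ ≤ C * (2 * j).factorial * (P * M ^ 2) ^ j := by
          gcongr
          exact one_le_mul_of_one_le_of_one_le hP1 (one_le_pow₀ hM)
    refine ⟨2 * (P * M ^ 2), ?_, _, inter_mem hbound (hU.mem_nhds hy₀), Set.inter_subset_right,
      fun φ => ?_⟩
    · have := one_le_mul_of_one_le_of_one_le hP1 (one_le_pow₀ (n := 2) hM)
      linarith
    set Φ : ℝ := ∑ l ∈ Finset.range (Fintype.card J' + 1), |φ ((fermLap κ ^ l) a)| with hΦ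
    have hΦ0 : 0 ≤ Φ := Finset.sum_nonneg fun _ _ => abs_nonneg _
    have hΦl : ∀ l, |φ ((fermLap κ ^ l) a)| ≤ Φ := by
      intro l
      by_cases hl : Fintype.card J' < l
      · rw [fermLap_pow_eq_zero κ hl]; simpa using hΦ0
      · exact Finset.single_le_sum (f := fun l => |φ ((fermLap κ ^ l) a)|)
          (fun _ _ => abs_nonneg _) (Finset.mem_range.mpr (by omega))
    refine ⟨Φ * C, mul_nonneg hΦ0 hC, fun y hy j => ?_⟩
    have hu : (⟨fun y => U.indicator f y • a, indicator_smul_mem hf a⟩ :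
        analyticFunctions U (SuperAlg K J)) = postcomp U (LinearMap.toSpanSingleton ℝ _ a) f₁ := by
      refine analyticFunctions_ext fun y hy => ?_
      simp [postcomp, hf₁]
    have hcomm : Commute (postEnd U (SuperAlg K J) (fermLap κ)) (analyticBosLap hU _) := by
      refine Commute.sum_right _ _ _ fun i _ => ?_
      exact (pderiv_postEnd hU i _).symm.mul_right (pderiv_postEnd hU i _).symm
    -- Binomial expansion of `Δ^j`, with commuting bosonic and fermionic parts.
    have hexp : ((analyticLap hU κ ^ j) (postcomp U (LinearMap.toSpanSingleton ℝ _ a) f₁)).1 y =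
        ∑ l ∈ Finset.range (j + 1), (j.choose l : ℝ) •
          (((analyticBosLap hU ℝ ^ (j - l)) f₁).1 y • (fermLap κ ^ l) a) := by
      rw [analyticLap, add_comm, hcomm.add_pow, LinearMap.sum_apply, AddSubmonoidClass.coe_finsetSum,
        Finset.sum_apply]
      refine Finset.sum_congr rfl fun l _ => ?_
      rw [mul_assoc, Module.End.mul_apply, Module.End.mul_apply, ← map_pow, postEnd_apply]
      have : ((j.choose l : Module.End ℝ (analyticFunctions U (SuperAlg K J)))
          (postcomp U (LinearMap.toSpanSingleton ℝ _ a) f₁)) =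
          (j.choose l : ℝ) • (postcomp U (LinearMap.toSpanSingleton ℝ _ a) f₁) := by
        rw [Module.End.natCast_apply, Nat.cast_smul_eq_nsmul]
      rw [this, map_smul, analyticBosLap_pow_postcomp, Submodule.coe_smul, Pi.smul_apply, map_smul]
      congr 1
      exact map_smul (fermLap κ ^ l) _ a
    rw [hu, hexp, map_sum]
    have hterm : ∀ l ∈ Finset.range (j + 1), |φ ((j.choose l : ℝ) •
          (((analyticBosLap hU ℝ ^ (j - l)) f₁).1 y • (fermLap κ ^ l) a))| ≤
        (j.choose l : ℝ) * (C * (2 * j).factorial * (P * M ^ 2) ^ j * Φ) := by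
      intro l _
      rw [map_smul, map_smul, smul_eq_mul, smul_eq_mul, abs_mul, abs_mul, Nat.abs_cast]
      have := hscal y hy (j - l) j (Nat.sub_le _ _)
      gcongr
      exact hΦl l
    calc _ ≤ _ := Finset.abs_sum_le_sum_abs _ _
      _ ≤ _ := Finset.sum_le_sum hterm
      _ = Φ * C * (2 * j).factorial * (2 * (P * M ^ 2)) ^ j := by
        rw [← Finset.sum_mul, ← Nat.cast_sum, Nat.sum_range_choose, mul_pow 2]
        push_cast
        ring

end Growth

/-! ### The recurrence of the coefficients -/

section Recurrence

/-- The factor in `∂_x x^j = c_j x^{j-1}`: it is `j` for even `j` and `j - 1 + M` for odd `j`. -/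
def dimFactor (M : ℤ) (j : ℕ) : ℝ := if Even j then (j : ℝ) else (j : ℝ) - 1 + M

lemma dimFactor_even (M : ℤ) (j : ℕ) : dimFactor M (2 * j) = 2 * j := by
  rw [dimFactor, if_pos (even_two_mul j)]; push_cast; ring

lemma dimFactor_odd (M : ℤ) (j : ℕ) : dimFactor M (2 * j + 1) = 2 * j + M := by
  rw [dimFactor, if_neg (by simp)]; push_cast; ring

variable {X : Type*} [AddCommGroup X] [Module ℝ X] {D L : Module.End ℝ X} {M : ℤ} {f : ℕ → X}

/-- The relation between consecutive coefficients that expresses the monogenicity of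
`∑ x^j f_j`. -/
def IsCKSequence (M : ℤ) (D : Module.End ℝ X) (f : ℕ → X) : Prop :=
  ∀ j, dimFactor M (j + 1) • f (j + 1) = (-1 : ℝ) ^ (j + 1) • D (f j)

lemma IsCKSequence.lap (h : IsCKSequence M D f) (hD : D * D = -L) (j : ℕ) :
    L (f j) = (dimFactor M (j + 1) * dimFactor M (j + 2)) • f (j + 2) := by
  have h1 := h j
  have h2 := h (j + 1)
  have h3 : D (D (f j)) = -L (f j) := LinearMap.congr_fun hD (f j)
  rw [mul_smul, h2, smul_comm, ← map_smul, h1, map_smul, h3, smul_smul, smul_neg, ← pow_add]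
  have : (-1 : ℝ) ^ (j + 1 + 1 + (j + 1)) = -1 := Odd.neg_one_pow ⟨j + 1, by ring⟩
  rw [this]
  simp

lemma IsCKSequence.lap_pow (h : IsCKSequence M D f) (hD : D * D = -L) (i j : ℕ) :
    (L ^ j) (f i) =
      (∏ l ∈ Finset.range j, dimFactor M (i + 2 * l + 1) * dimFactor M (i + 2 * l + 2)) •
        f (i + 2 * j) := by
  induction j with
  | zero => simp
  | succ j ih =>
    rw [pow_succ', Module.End.mul_apply, ih, map_smul, h.lap hD, smul_smul, Finset.prod_range_succ]
    rfl

lemma IsCKSequence.dirac (h : IsCKSequence M D f) (j : ℕ) :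
    D (f j) = ((-1) ^ (j + 1) * dimFactor M (j + 1)) • f (j + 1) := by
  rw [mul_smul, h, smul_smul, ← pow_add, Even.neg_one_pow ⟨j + 1, rfl⟩, one_smul]

lemma IsCKSequence.exists_dirac_pow (h : IsCKSequence M D f) (j : ℕ) :
    ∃ c : ℝ, (D ^ j) (f 0) = c • f j := by
  induction j with
  | zero => exact ⟨1, by simp⟩
  | succ j ih =>
    obtain ⟨c, hc⟩ := ih
    exact ⟨_, by rw [pow_succ', Module.End.mul_apply, hc, map_smul, h.dirac, smul_smul]⟩

lemma IsCKSequence.lap_pow_dirac (h : IsCKSequence M D f) (hD : D * D = -L) (i j : ℕ) :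
    (L ^ j) (D (f i)) =
      ((-1) ^ (i + 1) * dimFactor M (i + 1) *
        ∏ l ∈ Finset.range j, dimFactor M (i + 1 + 2 * l + 1) * dimFactor M (i + 1 + 2 * l + 2)) •
        f (i + 1 + 2 * j) := by
  rw [h.dirac, map_smul, h.lap_pow hD, smul_smul]

/-- From the index `1 - M` on, the factors of the recurrence are at least the distance to that index;
in particular none vanishes beyond it. -/
lemma le_dimFactor {i : ℕ} (hi : 1 - M ≤ i) (l : ℕ) : (l : ℝ) ≤ dimFactor M (i + l) := by
  have hi' : 1 - (M : ℝ) ≤ i := by exact_mod_cast hi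
  rw [dimFactor]
  split_ifs
  · push_cast; linarith [(Nat.cast_nonneg i : (0 : ℝ) ≤ i)]
  · push_cast; linarith

/-- The coefficients far out are iterated Laplacians with factorially decaying factors. -/
lemma IsCKSequence.exists_eq_lap_pow (h : IsCKSequence M D f) (hD : D * D = -L) {i : ℕ}
    (hi : 1 - M ≤ i) (j : ℕ) :
    ∃ γ : ℝ, |γ| ≤ 1 / (2 * j).factorial ∧ f (i + 2 * j) = γ • (L ^ j) (f i) := by
  set P := ∏ l ∈ Finset.range j, dimFactor M (i + 2 * l + 1) * dimFactor M (i + 2 * l + 2) with hP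
  have hle : ((2 * j).factorial : ℝ) ≤ P := by
    rw [hP]
    clear hP P
    induction j with
    | zero => simp
    | succ j ih =>
      have h1 := le_dimFactor hi (2 * j + 1)
      have h2 := le_dimFactor hi (2 * j + 2)
      rw [← add_assoc] at h1 h2
      rw [Finset.prod_range_succ, show 2 * (j + 1) = 2 * j + 1 + 1 by ring, Nat.factorial_succ,
        Nat.factorial_succ, ← mul_assoc, mul_comm, Nat.cast_mul, mul_comm (2 * j + 1 + 1) _,
        Nat.cast_mul]
      gcongr
      · exact (Nat.cast_nonneg _).trans ih
      · exact (Nat.cast_nonneg _).trans h1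
  have hfac : (0 : ℝ) < (2 * j).factorial := by exact_mod_cast Nat.factorial_pos _
  have hP0 : 0 < P := hfac.trans_le hle
  refine ⟨P⁻¹, ?_, ?_⟩
  · rw [abs_of_pos (inv_pos.mpr hP0), one_div]
    exact inv_anti₀ hfac hle
  · rw [h.lap_pow hD, smul_smul, inv_mul_cancel₀ hP0.ne', one_smul]

end Recurrence

section LocalBound

variable {I I' J J' : Type} [Fintype I'] [DecidableEq I'] [DecidableEq I] [DecidableEq J]
  [Fintype J'] {U : Set (I' → ℝ)}

/-- The coefficients of a monogenic series grow at most geometrically, locally uniformly, with the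
same ratio for all components. -/
lemma IsCKSequence.exists_local_bound (hU : IsOpen U) {ι : I' → I} {κ : J' → J}
    (hι : Function.Injective ι) (hκ : Function.Injective κ) {M : ℤ}
    {f : ℕ → analyticFunctions U (SuperAlg I J)}
    (h : IsCKSequence M (analyticDirac hU ι κ) f) {y₀ : I' → ℝ} (hy₀ : y₀ ∈ U) :
    ∃ s : ℝ, 0 < s ∧ ∃ W ∈ 𝓝 y₀, W ⊆ U ∧ ∀ φ : Module.Dual ℝ (SuperAlg I J), ∃ C : ℝ,
      ∀ y ∈ W, ∀ j : ℕ, |φ ((f j).1 y)| * s ^ j ≤ C := by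
  choose R hR W hW hWU hbd using fun i => exists_bound_analyticLap_pow hU κ (f i) hy₀
  -- From the index `N` on, each coefficient is an iterated Laplacian of `f N` or `f (N + 1)`.
  set N : ℕ := (1 - M).toNat with hN
  set T : ℝ := ∑ i ∈ Finset.range (N + 2), R i with hT
  have hRT : ∀ i ∈ Finset.range (N + 2), R i ≤ T := fun i hi =>
    Finset.single_le_sum (fun i _ => zero_le_one.trans (hR i)) hi
  have hT1 : 1 ≤ T := (hR 0).trans (hRT 0 (by simp))
  have hT0 : 0 < T := zero_lt_one.trans_le hT1
  refine ⟨T⁻¹, inv_pos.mpr hT0, ⋂ i ∈ Finset.range (N + 2), W i,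
    (Filter.biInter_finset_mem _).mpr fun i _ => hW i,
    (Set.biInter_subset_of_mem (Finset.mem_coe.mpr (by simp : 0 ∈ Finset.range (N + 2)))).trans
      (hWU 0), fun φ => ?_⟩
  choose C hC hφ using fun i => hbd i φ
  have hCT : ∀ i ∈ Finset.range (N + 2), C i ≤ ∑ i ∈ Finset.range (N + 2), C i := fun i hi =>
    Finset.single_le_sum (fun i _ => hC i) hi
  refine ⟨∑ i ∈ Finset.range (N + 2), C i, fun y hy j => ?_⟩
  have hyW : ∀ i ∈ Finset.range (N + 2), y ∈ W i := fun i hi => Set.mem_iInter₂.mp hy i hi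
  have hinv1 : T⁻¹ ≤ 1 := inv_le_one_of_one_le₀ hT1
  have hinv0 : 0 ≤ T⁻¹ := inv_nonneg.mpr hT0.le
  have hfar : ∀ i ∈ Finset.range (N + 2), 1 - M ≤ i → ∀ l : ℕ,
      |φ ((f (i + 2 * l)).1 y)| * T⁻¹ ^ (i + 2 * l) ≤ ∑ i ∈ Finset.range (N + 2), C i := by
    intro i hi hiM l
    obtain ⟨γ, hγ, hf⟩ := h.exists_eq_lap_pow (analyticDirac_sq hU hι hκ) hiM l
    have hfac : (0 : ℝ) < (2 * l).factorial := by exact_mod_cast Nat.factorial_pos _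
    have h1 : |φ ((f (i + 2 * l)).1 y)| ≤ C i * R i ^ l := by
      rw [hf, Submodule.coe_smul, Pi.smul_apply, map_smul, smul_eq_mul, abs_mul]
      calc _ ≤ 1 / ((2 * l).factorial : ℝ) * (C i * (2 * l).factorial * R i ^ l) :=
            mul_le_mul hγ (hφ i y (hyW i hi) l) (abs_nonneg _) (by positivity)
        _ = C i * R i ^ l := by field_simp
    have h2 : T⁻¹ ^ (i + 2 * l) ≤ T⁻¹ ^ l :=
      pow_le_pow_of_le_one hinv0 hinv1 (by omega)
    calc _ ≤ C i * R i ^ l * T⁻¹ ^ l := by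
          have := hC i
          have := zero_le_one.trans (hR i)
          gcongr
      _ = C i * (R i * T⁻¹) ^ l := by rw [mul_pow]; ring
      _ ≤ C i * 1 := by
          have h0 : 0 ≤ R i * T⁻¹ := mul_nonneg (zero_le_one.trans (hR i)) hinv0
          have h1 : R i * T⁻¹ ≤ 1 := by
            rw [← div_eq_mul_inv, div_le_one hT0]; exact hRT i hi
          exact mul_le_mul_of_nonneg_left (pow_le_one₀ h0 h1) (hC i)
      _ ≤ _ := by rw [mul_one]; exact hCT i hi
  by_cases hj : j < N
  · have h1 := hφ j y (hyW j (by simp; omega)) 0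
    simp only [mul_zero, Nat.factorial_zero, Nat.cast_one, pow_zero, mul_one, Module.End.one_apply]
      at h1
    calc _ ≤ C j * 1 := mul_le_mul h1 (pow_le_one₀ hinv0 hinv1) (by positivity) (hC j)
      _ ≤ _ := by rw [mul_one]; exact hCT j (by simp; omega)
  · rcases Nat.even_or_odd' (j - N) with ⟨l, hl | hl⟩
    · have := hfar N (by simp) (by omega) l
      rwa [show N + 2 * l = j by omega] at this
    · have := hfar (N + 1) (by simp) (by push_cast; omega) l
      rwa [show N + 1 + 2 * l = j by omega] at this

end LocalBound

/-! ### The super Dirac and Laplace operators in `y` -/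

section OperatorsInY

variable {m n p q : ℕ} {U : Set (Fin p → ℝ)}

lemma hasPartialDeriv_lift (hU : IsOpen U) {f : Pt m p → Val m n p q}
    (G : analyticFunctions U (Val m n p q)) (hf : ∀ z, z ∘ Sum.inr ∈ U → f z = G.1 (z ∘ Sum.inr))
    (i : Fin p) {z : Pt m p} (hz : z ∘ Sum.inr ∈ U) :
    HasPartialDeriv (Sum.inr i) f ((pderiv hU i G).1 (z ∘ Sum.inr)) z := by
  have hupd : ∀ t, Function.update z (Sum.inr i) t ∘ Sum.inr =
      Function.update (z ∘ Sum.inr) i t := fun t =>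
    Function.update_comp_eq_of_injective z Sum.inr_injective i t
  have h2 : ∀ᶠ t in 𝓝 (z (Sum.inr i)), Function.update (z ∘ Sum.inr) i t ∈ U := by
    have : ContinuousAt (Function.update (z ∘ Sum.inr) i) (z (Sum.inr i)) :=
      (continuous_const.update i continuous_id).continuousAt
    apply this
    rw [show z (Sum.inr i) = (z ∘ Sum.inr) i from rfl, Function.update_eq_self]
    exact hU.mem_nhds hz
  intro φ
  refine (hasPartialDeriv_pderiv hU i G hz φ).congr_of_eventuallyEq (h2.mono fun t ht => ?_)
  simp only
  rw [hf _ (by rwa [hupd]), hupd]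

/-- Over `U`, `diracY` is the operator `analyticDirac`; all partial derivatives that occur exist, so
that `partialDeriv` takes no default values. -/
lemma diracY_eq (hU : IsOpen U) {f : Pt m p → Val m n p q}
    {G : analyticFunctions U (Val m n p q)} (hf : ∀ z, z ∘ Sum.inr ∈ U → f z = G.1 (z ∘ Sum.inr))
    (z : Pt m p) (hz : z ∘ Sum.inr ∈ U) :
    diracY f z = (analyticDirac hU Sum.inr Sum.inr G).1 (z ∘ Sum.inr) := by
  have h : (analyticDirac hU Sum.inr Sum.inr G).1 (z ∘ Sum.inr) =
      fermDirac Sum.inr (G.1 (z ∘ Sum.inr)) -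
        ∑ i, eBos (Sum.inr i) * (pderiv hU i G).1 (z ∘ Sum.inr) := by
    simp only [analyticDirac, LinearMap.sub_apply, LinearMap.sum_apply, Submodule.coe_sub,
      AddSubmonoidClass.coe_finsetSum, Pi.sub_apply, Finset.sum_apply, Module.End.mul_apply,
      postEnd_apply, LinearMap.mulLeft_apply]
  rw [h, diracY, superDirac, fermDirac_apply, hf z hz]
  congr 1
  exact Finset.sum_congr rfl fun i _ => by
    rw [(hasPartialDeriv_lift hU G hf i hz).partialDeriv_eq]

lemma laplacianY_eq (hU : IsOpen U) {f : Pt m p → Val m n p q}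
    {G : analyticFunctions U (Val m n p q)} (hf : ∀ z, z ∘ Sum.inr ∈ U → f z = G.1 (z ∘ Sum.inr))
    (z : Pt m p) (hz : z ∘ Sum.inr ∈ U) :
    laplacianY f z = (analyticLap hU Sum.inr G).1 (z ∘ Sum.inr) := by
  have h : (analyticLap hU Sum.inr G).1 (z ∘ Sum.inr) =
      ∑ i, (pderiv hU i (pderiv hU i G)).1 (z ∘ Sum.inr) +
        fermLap Sum.inr (G.1 (z ∘ Sum.inr)) := by
    simp only [analyticLap, analyticBosLap, LinearMap.add_apply, LinearMap.sum_apply,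
      Submodule.coe_add, AddSubmonoidClass.coe_finsetSum, Pi.add_apply, Finset.sum_apply,
      Module.End.mul_apply, postEnd_apply]
  rw [h, laplacianY, superLaplacian, sub_eq_add_neg]
  congr 1
  · refine Finset.sum_congr rfl fun i _ => ?_
    exact (hasPartialDeriv_lift hU _ (fun z hz =>
      (hasPartialDeriv_lift hU G hf i hz).partialDeriv_eq) i hz).partialDeriv_eq
  · rw [hf z hz]
    simp [fermLap, Finset.smul_sum]

lemma diracY_iterate_eq (hU : IsOpen U) {f : Pt m p → Val m n p q}
    {G : analyticFunctions U (Val m n p q)} (hf : ∀ z, z ∘ Sum.inr ∈ U → f z = G.1 (z ∘ Sum.inr))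
    (j : ℕ) : ∀ z : Pt m p, z ∘ Sum.inr ∈ U →
      (diracY^[j] f) z = ((analyticDirac hU Sum.inr Sum.inr ^ j) G).1 (z ∘ Sum.inr) := by
  induction j with
  | zero => exact hf
  | succ j ih =>
    rw [Function.iterate_succ_apply', pow_succ', Module.End.mul_apply]
    exact diracY_eq hU ih

lemma laplacianY_iterate_eq (hU : IsOpen U) {f : Pt m p → Val m n p q}
    {G : analyticFunctions U (Val m n p q)} (hf : ∀ z, z ∘ Sum.inr ∈ U → f z = G.1 (z ∘ Sum.inr))
    (j : ℕ) : ∀ z : Pt m p, z ∘ Sum.inr ∈ U →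
      (laplacianY^[j] f) z = ((analyticLap hU Sum.inr ^ j) G).1 (z ∘ Sum.inr) := by
  induction j with
  | zero => exact hf
  | succ j ih =>
    rw [Function.iterate_succ_apply', pow_succ', Module.End.mul_apply]
    exact laplacianY_eq hU ih

end OperatorsInY

/-! ### Componentwise convergence in finite-dimensional subspaces -/

section Sums

variable {A : Type} [AddCommGroup A] [Module ℝ A]

/-- Componentwise summability within a finite-dimensional space yields a sum in the algebra. -/
lemma exists_hasSum_of_finiteDimensional {T : ℕ → A} {V : Submodule ℝ A}
    (hV : FiniteDimensional ℝ V) (hT : ∀ j, T j ∈ V)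
    (hs : ∀ φ : Module.Dual ℝ A, Summable fun j => φ (T j)) :
    ∃ s : A, ∀ φ : Module.Dual ℝ A, HasSum (fun j => φ (T j)) (φ s) := by
  set b := Module.finBasis ℝ V with hb
  choose ψ hψ using fun i => LinearMap.exists_extend (b.coord i)
  refine ⟨∑ i, (∑' j, ψ i (T j)) • (b i : A), fun φ => ?_⟩
  have hTj : ∀ j, φ (T j) = ∑ i, ψ i (T j) * φ (b i) := by
    intro j
    have h1 := b.sum_repr ⟨T j, hT j⟩
    have h2 : ∀ i, b.repr ⟨T j, hT j⟩ i = ψ i (T j) := fun i =>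
      (LinearMap.congr_fun (hψ i) ⟨T j, hT j⟩).symm
    have h3 := congrArg (fun v : V => φ (v : A)) h1
    simp only [AddSubmonoidClass.coe_finsetSum, Submodule.coe_smul, map_sum, map_smul, h2,
      smul_eq_mul] at h3
    exact h3.symm
  simp only [hTj, map_sum, map_smul, smul_eq_mul]
  exact hasSum_sum fun i _ => (hs (ψ i)).hasSum.mul_right _

lemma convergesAt_of_hasSum {I : Type} {T : ℕ → (I → ℝ) → A} {z : I → ℝ} {s : A}
    (h : ∀ φ : Module.Dual ℝ A, HasSum (fun j => φ (T j z)) (φ s)) : ConvergesAt T z s :=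
  fun φ => (h φ).tendsto_sum_nat

lemma ConvergesAt.exists_bound {I : Type} {T : ℕ → (I → ℝ) → A} {z : I → ℝ} {s : A}
    (h : ConvergesAt T z s) (φ : Module.Dual ℝ A) : ∃ C, ∀ j, |φ (T j z)| ≤ C := by
  have h1 := h φ
  have h2 : Tendsto (fun j => φ (T j z)) atTop (𝓝 0) := by
    have := (h1.comp (tendsto_add_atTop_nat 1)).sub h1
    simpa [Function.comp_def, Finset.sum_range_succ] using this
  obtain ⟨C, hC⟩ := (Metric.isBounded_range_of_tendsto _ h2).exists_norm_le
  exact ⟨C, fun j => hC _ ⟨j, rfl⟩⟩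

/-- The families `b j` decay componentwise at least like `T ^ (-j)`, uniformly on `W`. -/
def GeomBound {Y : Type*} (W : Set Y) (b : ℕ → Y → A) (T : ℝ) : Prop :=
  ∀ φ : Module.Dual ℝ A, ∃ C : ℝ, ∀ y ∈ W, ∀ j, |φ (b j y)| * T ^ j ≤ C

variable {Y : Type*} {W : Set Y} {b : ℕ → Y → A} {T : ℝ}

lemma GeomBound.comp_linear {B : Type} [AddCommGroup B] [Module ℝ B] (h : GeomBound W b T)
    (L : A →ₗ[ℝ] B) : GeomBound W (fun j y => L (b j y)) T := fun φ => h (φ ∘ₗ L)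

lemma GeomBound.shift (h : GeomBound W b T) (hT : 0 < T) (d : ℕ) :
    GeomBound W (fun j y => b (2 * j + d) y) (T ^ 2) := fun φ => by
  obtain ⟨C, hC⟩ := h φ
  refine ⟨C / T ^ d, fun y hy j => ?_⟩
  rw [le_div_iff₀ (pow_pos hT d), mul_assoc, ← pow_mul, ← pow_add]
  exact hC y hy _

lemma GeomBound.summable {y : Y} (h : GeomBound {y} b T) (hT : 1 < T) (φ : Module.Dual ℝ A) :
    Summable fun j => φ (b j y) := by
  obtain ⟨C, hC⟩ := h φ
  have hT0 : 0 < T := zero_lt_one.trans hT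
  refine Summable.of_norm_bounded (g := fun j => C * T⁻¹ ^ j)
    ((summable_geometric_of_lt_one (inv_nonneg.mpr hT0.le) (inv_lt_one_of_one_lt₀ hT)).mul_left C)
    fun j => ?_
  rw [inv_pow, ← div_eq_mul_inv, le_div_iff₀ (pow_pos hT0 j)]
  exact hC y rfl j

end Sums

/-! ### Powers of a scalar plus a nilpotent element -/

section Nilpotent

variable {A : Type} [Ring A] [Algebra ℝ A] {N : A} {n : ℕ}

lemma smul_one_add_pow (a : ℝ) (N : A) (j : ℕ) :
    (a • (1 : A) + N) ^ j =
      ∑ i ∈ Finset.range (j + 1), ((j.choose i : ℝ) * a ^ (j - i)) • N ^ i := by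
  have hc : Commute N (a • (1 : A)) := (Commute.one_right N).smul_right a
  rw [add_comm, hc.add_pow]
  refine Finset.sum_congr rfl fun i _ => ?_
  rw [smul_pow, one_pow, mul_smul_comm, mul_one, ← nsmul_eq_mul', ← Nat.cast_smul_eq_nsmul ℝ,
    smul_smul]

lemma smul_one_add_pow_mem (hN : ∀ k, n < k → N ^ k = 0) (a : ℝ) (j : ℕ) :
    (a • (1 : A) + N) ^ j ∈ Submodule.span ℝ ((fun i => N ^ i) '' Set.Iic n) := by
  rw [smul_one_add_pow]
  refine Submodule.sum_mem _ fun i _ => Submodule.smul_mem _ _ ?_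
  by_cases hi : n < i
  · rw [hN i hi]; exact zero_mem _
  · exact Submodule.subset_span ⟨i, not_lt.mp hi, rfl⟩

/-- A nilpotent perturbation does not change the radius of convergence: the polynomial factors it
produces are absorbed by any loss `a₀ < q` in the radius. -/
lemma GeomBound.smul_one_add_pow (hN : ∀ k, n < k → N ^ k = 0) {Y : Type*} {W : Set Y}
    {b : ℕ → Y → A} {T a₀ q : ℝ} (h : GeomBound W b T) (hT : 0 < T) (ha₀ : 0 ≤ a₀) (hq : a₀ < q) :
    GeomBound {w : ℝ × Y | |w.1| ≤ a₀ ∧ w.2 ∈ W} (fun j w => (w.1 • (1 : A) + N) ^ j * b j w.2)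
      (T / q) := fun φ => by
  choose C hC using fun i => (h.comp_linear (LinearMap.mulLeft ℝ (N ^ i))) φ
  have hq0 : 0 < q := ha₀.trans_lt hq
  have hδ : 0 < q - a₀ := sub_pos.mpr hq
  refine ⟨∑ i ∈ Finset.range (n + 1), ((q - a₀) ^ i)⁻¹ * |C i|, fun w hw j => ?_⟩
  set D : ℕ → ℝ := fun i => ((j.choose i : ℝ) * w.1 ^ (j - i)) * φ (N ^ i * b j w.2) with hD
  have hsum : φ ((w.1 • (1 : A) + N) ^ j * b j w.2) =
      ∑ i ∈ (Finset.range (j + 1)).filter (· ≤ n), D i := by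
    rw [SuperCK.smul_one_add_pow, Finset.sum_mul, map_sum, Finset.sum_filter]
    refine Finset.sum_congr rfl fun i _ => ?_
    split_ifs with hi
    · rw [smul_mul_assoc, map_smul, smul_eq_mul]
    · rw [hN i (not_le.mp hi)]; simp
  have hDi : ∀ i ∈ (Finset.range (j + 1)).filter (· ≤ n),
      |D i| * (T / q) ^ j ≤ ((q - a₀) ^ i)⁻¹ * |C i| := by
    intro i hi
    have hij : i ≤ j := by
      have := (Finset.mem_filter.mp hi).1
      rw [Finset.mem_range] at this; omega
    -- One term of the binomial expansion of `q ^ j = ((q - a₀) + a₀) ^ j`.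
    have h1 : (j.choose i : ℝ) * a₀ ^ (j - i) * (q - a₀) ^ i ≤ q ^ j := by
      have h2 := add_pow (q - a₀) a₀ j
      rw [sub_add_cancel] at h2
      rw [h2]
      refine le_trans (le_of_eq ?_) (Finset.single_le_sum (f := fun i =>
        (q - a₀) ^ i * a₀ ^ (j - i) * (j.choose i : ℝ)) (fun i _ => by positivity)
        (Finset.mem_range.mpr (Nat.lt_succ_of_le hij)))
      ring
    have h3 : |φ (N ^ i * b j w.2)| * T ^ j ≤ |C i| := (hC i w.2 hw.2 j).trans (le_abs_self _)
    have h4 : |w.1| ^ (j - i) ≤ a₀ ^ (j - i) := pow_le_pow_left₀ (abs_nonneg _) hw.1 _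
    have h5 : (j.choose i : ℝ) * |w.1| ^ (j - i) ≤ ((q - a₀) ^ i)⁻¹ * q ^ j := by
      rw [inv_mul_eq_div, le_div_iff₀ (pow_pos hδ i)]
      refine le_trans ?_ h1
      gcongr
    calc |D i| * (T / q) ^ j
        = ((j.choose i : ℝ) * |w.1| ^ (j - i)) * (|φ (N ^ i * b j w.2)| * T ^ j) * (q ^ j)⁻¹ := by
          rw [hD, abs_mul, abs_mul, abs_pow, Nat.abs_cast, div_pow]; ring
      _ ≤ (((q - a₀) ^ i)⁻¹ * q ^ j) * |C i| * (q ^ j)⁻¹ := by gcongr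
      _ = _ := by field_simp
  rw [hsum]
  calc _ ≤ (∑ i ∈ (Finset.range (j + 1)).filter (· ≤ n), |D i|) * (T / q) ^ j := by
        gcongr; exact Finset.abs_sum_le_sum_abs _ _
    _ ≤ ∑ i ∈ (Finset.range (j + 1)).filter (· ≤ n), ((q - a₀) ^ i)⁻¹ * |C i| := by
        rw [Finset.sum_mul]; exact Finset.sum_le_sum hDi
    _ ≤ _ := by
        refine Finset.sum_le_sum_of_subset_of_nonneg (fun i hi => ?_) fun i _ _ => by positivity
        rw [Finset.mem_range]
        have := (Finset.mem_filter.mp hi).2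
        omega

end Nilpotent

/-! ### Powers of the super vector variable -/

section Powers

variable {m n p q : ℕ}

/-- The square of the norm of the bosonic part of `x`. -/
def bosNormSq (z : Pt m p) : ℝ := ∑ i : Fin m, z (Sum.inl i) ^ 2

/-- The bosonic part of `x`. -/
def bosX (z : Pt m p) : Val m n p q := bosVec Sum.inl z

lemma bosNormSq_nonneg (z : Pt m p) : 0 ≤ bosNormSq z := Finset.sum_nonneg fun _ _ => sq_nonneg _

lemma continuous_bosNormSq : Continuous (bosNormSq : Pt m p → ℝ) := by
  unfold bosNormSq; fun_prop

lemma xVec_eq (z : Pt m p) : (xVec z : Val m n p q) = bosX z + fermVec Sum.inl :=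
  superVector_eq _ _ _

lemma xVec_sq (z : Pt m p) :
    (xVec z ^ 2 : Val m n p q) = (-bosNormSq z) • 1 + fermNil Sum.inl :=
  superVector_sq Sum.inl_injective Sum.inl_injective z

lemma bosX_sq (z : Pt m p) : (bosX z * bosX z : Val m n p q) = (-bosNormSq z) • 1 :=
  bosVec_sq Sum.inl_injective z

lemma body_xVec (z : Pt m p) : (body (xVec z) : Val m n p q) = bosX z := body_superVector _ _

lemma fermNil_inl_pow {k : ℕ} (hk : n < k) : (fermNil Sum.inl : Val m n p q) ^ k = 0 :=
  fermNil_pow_eq_zero _ (by simpa using hk)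

lemma bosX_pow_even (z : Pt m p) (j : ℕ) :
    (bosX z ^ (2 * j) : Val m n p q) = (-bosNormSq z) ^ j • 1 := by
  rw [pow_mul, pow_two, bosX_sq, smul_pow, one_pow]

/-- All powers of `x`, at all points, lie in one finite-dimensional space. -/
lemma exists_xVec_pow_mem : ∃ V : Submodule ℝ (Val m n p q), V.FG ∧
    ∀ (z : Pt m p) (j : ℕ), xVec z ^ j ∈ V := by
  set V₀ : Submodule ℝ (Val m n p q) :=
    Submodule.span ℝ ((fun i => (fermNil Sum.inl : Val m n p q) ^ i) '' Set.Iic n) with hV₀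
  have hV₀fg : V₀.FG := Submodule.fg_span ((Set.finite_Iic n).image _)
  set V₁ : Submodule ℝ (Val m n p q) := Submodule.span ℝ
    (insert (fermVec Sum.inl) (Set.range fun i : Fin m => eBos (Sum.inl i))) with hV₁
  have hV₁fg : V₁.FG := Submodule.fg_span ((Set.finite_range _).insert _)
  have hx : ∀ z : Pt m p, xVec z ∈ V₁ := by
    intro z
    rw [xVec_eq, bosX, bosVec]
    refine add_mem (Submodule.sum_mem _ fun i _ => Submodule.smul_mem _ _
      (Submodule.subset_span (Set.mem_insert_of_mem _ ⟨i, rfl⟩)))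
      (Submodule.subset_span (Set.mem_insert _ _))
  have heven : ∀ (z : Pt m p) (l : ℕ), xVec z ^ (2 * l) ∈ V₀ := by
    intro z l
    rw [pow_mul, xVec_sq]
    exact smul_one_add_pow_mem (fun k hk => fermNil_inl_pow hk) _ _
  refine ⟨V₀ ⊔ V₁ * V₀, hV₀fg.sup (hV₁fg.mul hV₀fg), fun z j => ?_⟩
  rcases Nat.even_or_odd' j with ⟨l, rfl | rfl⟩
  · exact Submodule.mem_sup_left (heven z l)
  · rw [pow_succ']
    exact Submodule.mem_sup_right (Submodule.mul_mem_mul (hx z) (heven z l))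

lemma exists_xVec_pow_mul_mem {V : Submodule ℝ (Val m n p q)} (hV : V.FG) :
    ∃ V' : Submodule ℝ (Val m n p q), FiniteDimensional ℝ V' ∧
      ∀ (z : Pt m p) (j : ℕ), ∀ v ∈ V, xVec z ^ j * v ∈ V' := by
  obtain ⟨E, hE, hx⟩ := exists_xVec_pow_mem (m := m) (n := n) (p := p) (q := q)
  exact ⟨E * V, (Module.Finite.iff_fg).mpr (hE.mul hV), fun z j v hv =>
    Submodule.mul_mem_mul (hx z j) hv⟩

variable {W : Set (Fin p → ℝ)} {F : ℕ → (Fin p → ℝ) → Val m n p q} {s r : ℝ}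

/-- With `x² = -|x_b|² + w²`, the even powers of `x` are powers of a scalar plus a nilpotent element. -/
lemma GeomBound.xVec_pow_even (h : GeomBound W F s) (hs : 0 < s) (hr : 0 ≤ r) (hrs : r < s)
    (d : ℕ) : ∃ T, 1 < T ∧ GeomBound {z : Pt m p | bosNormSq z ≤ r ^ 2 ∧ z ∘ Sum.inr ∈ W}
      (fun j z => xVec z ^ (2 * j) * F (2 * j + d) (z ∘ Sum.inr)) T := by
  obtain ⟨c, hc1, hc2⟩ := exists_between (pow_lt_pow_left₀ hrs hr two_ne_zero)
  have hc0 : 0 < c := (sq_nonneg r).trans_lt hc1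
  refine ⟨s ^ 2 / c, (one_lt_div hc0).mpr hc2, fun φ => ?_⟩
  obtain ⟨C, hC⟩ := (h.shift hs d).smul_one_add_pow
    (fun k hk => fermNil_inl_pow (m := m) (n := n) (p := p) (q := q) hk) (pow_pos hs 2) (sq_nonneg r) hc1 φ
  refine ⟨C, fun z hz j => ?_⟩
  have := hC (-bosNormSq z, z ∘ Sum.inr)
    ⟨by simpa [abs_of_nonneg (bosNormSq_nonneg z)] using hz.1, hz.2⟩ j
  change |φ (xVec z ^ (2 * j) * _)| * _ ≤ C
  rw [pow_mul, xVec_sq]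
  exact this

lemma abs_dual_xVec_mul_le (φ : Module.Dual ℝ (Val m n p q)) {z : Pt m p} (hr : 0 ≤ r)
    (hz : bosNormSq z ≤ r ^ 2) (v : Val m n p q) :
    |φ (xVec z * v)| ≤ r * ∑ i : Fin m, |φ (eBos (Sum.inl i) * v)| + |φ (fermVec Sum.inl * v)| := by
  have hzi : ∀ i : Fin m, |z (Sum.inl i)| ≤ r := fun i => by
    refine abs_le_of_sq_le_sq (le_trans ?_ hz) hr
    exact Finset.single_le_sum (f := fun i : Fin m => z (Sum.inl i) ^ 2)
      (fun i _ => sq_nonneg _) (Finset.mem_univ i)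
  rw [xVec_eq, add_mul, map_add, bosX, bosVec, Finset.sum_mul, map_sum]
  refine (abs_add_le _ _).trans (add_le_add_left ((Finset.abs_sum_le_sum_abs _ _).trans ?_) _)
  rw [Finset.mul_sum]
  refine Finset.sum_le_sum fun i _ => ?_
  rw [smul_mul_assoc, map_smul, smul_eq_mul, abs_mul]
  gcongr
  exact hzi i

/-- If the coefficients are bounded by a geometric sequence of ratio `1 / s`, then `∑ x^j F_j`
converges geometrically where `|x| ≤ r < s`. -/
lemma GeomBound.exists_ckTerm_bound (h : GeomBound W F s) (hs : 0 < s) (hr : 0 ≤ r) (hrs : r < s)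
    (φ : Module.Dual ℝ (Val m n p q)) : ∃ u : ℕ → ℝ, Summable u ∧
      ∀ j, ∀ z : Pt m p, bosNormSq z ≤ r ^ 2 → z ∘ Sum.inr ∈ W → |φ (ckTerm F j z)| ≤ u j := by
  obtain ⟨T, hT, h0⟩ := h.xVec_pow_even hs hr hrs 0
  obtain ⟨T', hT', h1⟩ := h.xVec_pow_even hs hr hrs 1
  obtain ⟨C, hC⟩ := h0 φ
  choose D hD using fun i : Fin m => h1.comp_linear (LinearMap.mulLeft ℝ (eBos (Sum.inl i))) φ
  obtain ⟨D', hD'⟩ := h1.comp_linear (LinearMap.mulLeft ℝ (fermVec Sum.inl)) φ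
  have hT0 := zero_lt_one.trans hT
  have hT0' := zero_lt_one.trans hT'
  set B := r * ∑ i, D i + D' with hB
  set u : ℕ → ℝ := fun j => if Even j then C * T⁻¹ ^ (j / 2) else B * T'⁻¹ ^ (j / 2) with hu
  have hue : ∀ l, u (2 * l) = C * T⁻¹ ^ l := fun l => by simp [hu]
  have huo : ∀ l, u (2 * l + 1) = B * T'⁻¹ ^ l := fun l => by
    simp [hu, show (2 * l + 1) / 2 = l by omega]
  refine ⟨u, ?_, fun j z hz hzW => ?_⟩
  · have h1 : Summable fun l => u (2 * l) := by
      simp only [hue]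
      exact (summable_geometric_of_lt_one (inv_nonneg.mpr hT0.le)
        (inv_lt_one_of_one_lt₀ hT)).mul_left C
    have h2 : Summable fun l => u (2 * l + 1) := by
      simp only [huo]
      exact (summable_geometric_of_lt_one (inv_nonneg.mpr hT0'.le)
        (inv_lt_one_of_one_lt₀ hT')).mul_left B
    exact (h1.hasSum.even_add_odd h2.hasSum).summable
  · rcases Nat.even_or_odd' j with ⟨l, rfl | rfl⟩
    · rw [hue, inv_pow, ← div_eq_mul_inv, le_div_iff₀ (pow_pos hT0 l)]
      exact hC z ⟨hz, hzW⟩ l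
    · rw [huo, inv_pow, ← div_eq_mul_inv, le_div_iff₀ (pow_pos hT0' l), ckTerm, pow_succ', mul_assoc]
      have hTl := pow_pos hT0' l
      refine (mul_le_mul_of_nonneg_right (abs_dual_xVec_mul_le φ hr hz _) hTl.le).trans ?_
      rw [add_mul, mul_assoc, Finset.sum_mul, hB]
      gcongr with i
      · exact hD i z ⟨hz, hzW⟩ l
      · exact hD' z ⟨hz, hzW⟩ l

variable {z : Pt m p}

lemma body_ckTerm (hF : ∀ j, body (F j (z ∘ Sum.inr)) = F j (z ∘ Sum.inr)) (j : ℕ) :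
    body (ckTerm F j z) = bosX z ^ j * F j (z ∘ Sum.inr) := by
  rw [ckTerm, map_mul, map_pow, body_xVec, liftY, hF]

/-- Off `x = 0`, a bound for the terms `x^j F_j` bounds the coefficients `F_j`. The fermionic
variables of `x` are set to zero first, so that `x` becomes an invertible vector. -/
lemma geomBound_of_ckTerm_bound (hF : ∀ j, body (F j (z ∘ Sum.inr)) = F j (z ∘ Sum.inr))
    (hz : 0 < bosNormSq z)
    (hb : ∀ φ : Module.Dual ℝ (Val m n p q), ∃ C, ∀ j, |φ (ckTerm F j z)| ≤ C) :
    GeomBound {z ∘ Sum.inr} F √(bosNormSq z) := by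
  intro φ
  obtain ⟨C, hC⟩ := hb (φ ∘ₗ body.toLinearMap)
  -- Odd powers of the bosonic part of `x` become scalars after one more multiplication by it.
  obtain ⟨C', hC'⟩ := hb (φ ∘ₗ LinearMap.mulLeft ℝ (bosX z) ∘ₗ body.toLinearMap)
  set t := bosNormSq z with ht
  have hts : 0 < √t := Real.sqrt_pos.mpr hz
  refine ⟨max C (C' / √t), ?_⟩
  rintro _ rfl j
  rcases Nat.even_or_odd' j with ⟨l, rfl | rfl⟩
  · refine le_max_of_le_left (le_trans (le_of_eq ?_) (hC (2 * l)))
    change _ = |φ (body (ckTerm F (2 * l) z))|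
    rw [body_ckTerm hF, bosX_pow_even, smul_mul_assoc, one_mul, map_smul, smul_eq_mul, abs_mul,
      abs_pow, abs_neg, abs_of_pos hz, pow_mul, Real.sq_sqrt hz.le, mul_comm]
  · refine le_max_of_le_right ?_
    rw [le_div_iff₀ hts]
    refine le_trans (le_of_eq ?_) (hC' (2 * l + 1))
    change _ = |φ (bosX z * body (ckTerm F (2 * l + 1) z))|
    rw [body_ckTerm hF, ← mul_assoc, ← pow_succ', show 2 * l + 1 + 1 = 2 * (l + 1) by ring,
      bosX_pow_even, smul_mul_assoc, one_mul, map_smul, smul_eq_mul, abs_mul,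
      abs_pow, abs_neg, abs_of_pos hz, mul_assoc, ← pow_succ,
      show 2 * l + 1 + 1 = 2 * (l + 1) by ring, pow_mul, Real.sq_sqrt hz.le, mul_comm]

/-- Off `x = 0`, the coefficients are spanned by one finite set if the terms are. -/
lemma exists_coeff_mem {V : Submodule ℝ (Val m n p q)} (hV : V.FG) :
    ∃ V' : Submodule ℝ (Val m n p q), V'.FG ∧ ∀ z : Pt m p,
      (∀ j, body (F j (z ∘ Sum.inr)) = F j (z ∘ Sum.inr)) → 0 < bosNormSq z →
      (∀ j, ckTerm F j z ∈ V) → ∀ j, F j (z ∘ Sum.inr) ∈ V' := by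
  set E : Submodule ℝ (Val m n p q) := Submodule.span ℝ
    (insert 1 (Set.range fun i : Fin m => eBos (Sum.inl i))) with hE
  have hEfg : E.FG := Submodule.fg_span ((Set.finite_range _).insert _)
  refine ⟨E * V.map body.toLinearMap, hEfg.mul (hV.map _), fun z hF hz hT j => ?_⟩
  have h1 : (1 : Val m n p q) ∈ E := Submodule.subset_span (Set.mem_insert _ _)
  have hx : bosX z ∈ E := by
    rw [bosX, bosVec]
    exact Submodule.sum_mem _ fun i _ => Submodule.smul_mem _ _
      (Submodule.subset_span (Set.mem_insert_of_mem _ ⟨i, rfl⟩))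
  have hbT : ∀ j, body (ckTerm F j z) ∈ V.map (body (I := Fin m ⊕ Fin p)).toLinearMap :=
    fun j => Submodule.mem_map_of_mem (f := (body (I := Fin m ⊕ Fin p)).toLinearMap) (hT j)
  have hz' : -bosNormSq z ≠ 0 := neg_ne_zero.mpr hz.ne'
  rcases Nat.even_or_odd' j with ⟨l, rfl | rfl⟩
  · have h2 := Submodule.mul_mem_mul h1 (hbT (2 * l))
    rw [one_mul, body_ckTerm hF, bosX_pow_even, smul_mul_assoc, one_mul] at h2
    exact (Submodule.smul_mem_iff _ (pow_ne_zero l hz')).mp h2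
  · have h2 := Submodule.mul_mem_mul hx (hbT (2 * l + 1))
    rw [body_ckTerm hF, ← mul_assoc, ← pow_succ', show 2 * l + 1 + 1 = 2 * (l + 1) by ring,
      bosX_pow_even, smul_mul_assoc, one_mul] at h2
    exact (Submodule.smul_mem_iff _ (pow_ne_zero _ hz')).mp h2

end Powers

/-! ### Products of the factors of the recurrence -/

section Products

/-- The first `2j` factors `c_1 ⋯ c_{2j}` as a Gamma quotient, for `M` not in `-2ℕ`. -/
lemma prod_dimFactor_even (M : ℤ) (hM : ∀ k : ℕ, M ≠ -2 * (k : ℤ)) (j : ℕ) :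
    (∏ l ∈ Finset.range j, dimFactor M (0 + 2 * l + 1) * dimFactor M (0 + 2 * l + 2)) *
      Real.Gamma (M / 2) = 4 ^ j * j.factorial * Real.Gamma (M / 2 - 1 + j + 1) := by
  induction j with
  | zero => simp
  | succ j ih =>
    have h1 : (M / 2 - 1 + j + 1 : ℝ) ≠ 0 := by
      intro h
      apply hM j
      have : (M : ℝ) = -2 * j := by linarith
      exact_mod_cast this
    have h2 : Real.Gamma (M / 2 - 1 + (j + 1 : ℕ) + 1) =
        (M / 2 - 1 + j + 1) * Real.Gamma (M / 2 - 1 + j + 1) := by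
      rw [← Real.Gamma_add_one h1]; push_cast; ring_nf
    rw [Finset.prod_range_succ, mul_right_comm, ih, h2, Nat.factorial_succ, zero_add,
      dimFactor_odd, show 2 * j + 2 = 2 * (j + 1) by ring, dimFactor_even]
    push_cast
    ring

/-- The first `2j + 1` factors `c_1 ⋯ c_{2j+1}` as a Gamma quotient, for `M` not in `-2ℕ`. -/
lemma prod_dimFactor_odd (M : ℤ) (hM : ∀ k : ℕ, M ≠ -2 * (k : ℤ)) (j : ℕ) :
    dimFactor M (0 + 1) * (∏ l ∈ Finset.range j,
      dimFactor M (0 + 1 + 2 * l + 1) * dimFactor M (0 + 1 + 2 * l + 2)) *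
      Real.Gamma (M / 2) = 2 * 4 ^ j * j.factorial * Real.Gamma (M / 2 + j + 1) := by
  have hne : ∀ j : ℕ, (M / 2 + j : ℝ) ≠ 0 := by
    intro j h
    apply hM j
    have : (M : ℝ) = -2 * j := by linarith
    exact_mod_cast this
  induction j with
  | zero =>
    have := Real.Gamma_add_one (hne 0)
    rw [Nat.cast_zero, add_zero] at this ⊢
    rw [this, show (0 + 1 : ℕ) = 2 * 0 + 1 by ring, dimFactor_odd]
    simp
    ring
  | succ j ih =>
    have h2 : Real.Gamma (M / 2 + (j + 1 : ℕ) + 1) =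
        (M / 2 + j + 1) * Real.Gamma (M / 2 + j + 1) := by
      have := Real.Gamma_add_one (hne (j + 1))
      push_cast at this ⊢
      rw [← add_assoc] at this ⊢
      exact this
    rw [Finset.prod_range_succ, ← mul_assoc (dimFactor M (0 + 1)), mul_right_comm, ih, h2,
      Nat.factorial_succ, show 0 + 1 + 2 * j + 1 = 2 * (j + 1) by ring,
      show 0 + 1 + 2 * j + 2 = 2 * (j + 1) + 1 by ring, dimFactor_odd, dimFactor_even]
    push_cast
    ring

variable {M : ℤ} {k : ℕ}

/-- The factors `c_1 ⋯ c_{2j}` for `M = -2k`, before the vanishing factor `c_{2k+1}`. -/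
lemma prod_dimFactor_even_of_eq (hM : M = -2 * (k : ℤ)) {j : ℕ} (hj : j ≤ k) :
    (∏ l ∈ Finset.range j, dimFactor M (0 + 2 * l + 1) * dimFactor M (0 + 2 * l + 2)) *
      (k - j).factorial = (-4) ^ j * j.factorial * k.factorial := by
  induction j with
  | zero => simp
  | succ j ih =>
    have h1 : ((k - j).factorial : ℝ) = (k - j) * (k - (j + 1)).factorial := by
      rw [show k - j = (k - (j + 1)) + 1 by omega, Nat.factorial_succ]
      have : ((k - (j + 1) + 1 : ℕ) : ℝ) = k - j := by
        rw [show k - (j + 1) + 1 = k - j by omega, Nat.cast_sub (by omega)]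
      rw [Nat.cast_mul, this]
    have ih' := ih (by omega)
    rw [h1] at ih'
    rw [Finset.prod_range_succ, Nat.factorial_succ, zero_add,
      dimFactor_odd, show 2 * j + 2 = 2 * (j + 1) by ring, dimFactor_even, hM]
    push_cast
    rw [hM] at ih'
    simp only [zero_add] at ih' ⊢
    linear_combination (-4 * ((j : ℝ) + 1)) * ih'

/-- The factors `c_1 ⋯ c_{2j+1}` for `M = -2(k+1)`, before the vanishing factor `c_{2k+3}`. -/
lemma prod_dimFactor_odd_of_eq (hM : M = -2 * ((k + 1 : ℕ) : ℤ)) {j : ℕ} (hj : j ≤ k) :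
    dimFactor M (0 + 1) * (∏ l ∈ Finset.range j,
      dimFactor M (0 + 1 + 2 * l + 1) * dimFactor M (0 + 1 + 2 * l + 2)) *
      (k - j).factorial = -2 * (-4) ^ j * j.factorial * (k + 1).factorial := by
  induction j with
  | zero =>
    rw [show (0 + 1 : ℕ) = 2 * 0 + 1 by ring, dimFactor_odd, hM, Nat.factorial_succ]
    simp
    ring
  | succ j ih =>
    have h1 : ((k - j).factorial : ℝ) = (k - j) * (k - (j + 1)).factorial := by
      rw [show k - j = (k - (j + 1)) + 1 by omega, Nat.factorial_succ]
      have : ((k - (j + 1) + 1 : ℕ) : ℝ) = k - j := by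
        rw [show k - (j + 1) + 1 = k - j by omega, Nat.cast_sub (by omega)]
      rw [Nat.cast_mul, this]
    have ih' := ih (by omega)
    rw [h1] at ih'
    rw [Finset.prod_range_succ, Nat.factorial_succ j, show 0 + 1 + 2 * j + 1 = 2 * (j + 1) by ring,
      show 0 + 1 + 2 * j + 2 = 2 * (j + 1) + 1 by ring, dimFactor_odd, dimFactor_even]
    have hM' : (M : ℝ) = -2 * (k + 1) := by rw [hM]; push_cast; ring
    rw [hM']
    push_cast
    linear_combination (-4 * ((j : ℝ) + 1)) * ih'

/-- The `2j` factors that follow the vanishing factor `c_{2k+1}` for `M = -2k`. -/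
lemma prod_dimFactor_tail_even (hM : M = -2 * (k : ℤ)) (j : ℕ) :
    (∏ l ∈ Finset.range j, dimFactor M (2 * k + 1 + 2 * l + 1) * dimFactor M (2 * k + 1 + 2 * l + 2)) *
      k.factorial = 4 ^ j * j.factorial * (k + j).factorial := by
  have hM' : (M : ℝ) = -2 * k := by rw [hM]; push_cast; ring
  induction j with
  | zero => simp
  | succ j ih =>
    rw [Finset.prod_range_succ, mul_right_comm, ih, Nat.factorial_succ, ← add_assoc k j 1,
      Nat.factorial_succ, show 2 * k + 1 + 2 * j + 1 = 2 * (k + j + 1) by ring,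
      show 2 * k + 1 + 2 * j + 2 = 2 * (k + j + 1) + 1 by ring, dimFactor_odd, dimFactor_even, hM']
    push_cast
    ring

/-- The `2j + 1` factors that follow the vanishing factor `c_{2k+1}` for `M = -2k`. -/
lemma prod_dimFactor_tail_odd (hM : M = -2 * (k : ℤ)) (j : ℕ) :
    dimFactor M (2 * k + 1 + 1) * (∏ l ∈ Finset.range j,
      dimFactor M (2 * k + 1 + 1 + 2 * l + 1) * dimFactor M (2 * k + 1 + 1 + 2 * l + 2)) *
      k.factorial = 2 * 4 ^ j * j.factorial * (k + 1 + j).factorial := by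
  have hM' : (M : ℝ) = -2 * k := by rw [hM]; push_cast; ring
  induction j with
  | zero =>
    rw [show 2 * k + 1 + 1 = 2 * (k + 1) by ring, dimFactor_even, add_zero, Nat.factorial_succ]
    simp
    ring
  | succ j ih =>
    rw [Finset.prod_range_succ, ← mul_assoc (dimFactor M (2 * k + 1 + 1)), mul_right_comm, ih,
      Nat.factorial_succ j, ← add_assoc (k + 1) j 1,
      Nat.factorial_succ (k + 1 + j), show 2 * k + 1 + 1 + 2 * j + 1 = 2 * (k + j + 1) + 1 by ring,
      show 2 * k + 1 + 1 + 2 * j + 2 = 2 * (k + j + 2) by ring, dimFactor_odd, dimFactor_even, hM']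
    push_cast
    ring

end Products

/-! ### The Bessel and Appell operators produce the terms `x^j F_j` -/

section Identification

variable {m n p q : ℕ} {U : Set (Fin p → ℝ)} {hU : IsOpen U} {M : ℤ}
  {f : ℕ → analyticFunctions U (Val m n p q)} {F : ℕ → (Fin p → ℝ) → Val m n p q}

lemma operatorTerm_eq (c : ℕ → ℝ) {G : Pt m p → Val m n p q} {g h : analyticFunctions U (Val m n p q)}
    (hG : ∀ z, z ∘ Sum.inr ∈ U → G z = g.1 (z ∘ Sum.inr)) {j : ℕ} {a : ℝ}
    (hg : (analyticLap hU Sum.inr ^ j) g = a • h) {z : Pt m p} (hz : z ∘ Sum.inr ∈ U) :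
    operatorTerm c G j z =
      (c j * (-1) ^ j / 4 ^ j * a) • (xVec z ^ (2 * j) * h.1 (z ∘ Sum.inr)) := by
  have h2 : (xNormSq z : Val m n p q) ^ j = (-1 : ℝ) ^ j • xVec z ^ (2 * j) := by
    rw [xNormSq, neg_pow, ← pow_mul, ← neg_one_smul ℝ (1 : Val m n p q), smul_pow, one_pow,
      smul_mul_assoc, one_mul]
  rw [operatorTerm, laplacianY_iterate_eq hU hG j z hz, hg, Submodule.coe_smul, Pi.smul_apply, h2,
    smul_mul_assoc, mul_smul_comm, smul_smul, smul_smul]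
  congr 1
  ring

lemma liftY_eq (hF : ∀ j, ∀ y ∈ U, F j y = (f j).1 y)
    (i : ℕ) (z : Pt m p) (hz : z ∘ Sum.inr ∈ U) :
    liftY (F i) z = (f i).1 (z ∘ Sum.inr) := hF i _ hz

lemma operatorTerm_lift (hF : ∀ j, ∀ y ∈ U, F j y = (f j).1 y)
    (hf : IsCKSequence M (analyticDirac hU Sum.inr Sum.inr) f)
    (c : ℕ → ℝ) (i j : ℕ) {z : Pt m p} (hz : z ∘ Sum.inr ∈ U) :
    operatorTerm c (liftY (F i)) j z = (c j * (-1) ^ j / 4 ^ j *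
      ∏ l ∈ Finset.range j, dimFactor M (i + 2 * l + 1) * dimFactor M (i + 2 * l + 2)) •
        (xVec z ^ (2 * j) * F (2 * j + i) (z ∘ Sum.inr)) := by
  rw [hF _ _ hz, add_comm (2 * j)]
  exact operatorTerm_eq c (liftY_eq hF i)
    (hf.lap_pow (analyticDirac_sq hU Sum.inr_injective Sum.inr_injective) i j) hz

lemma operatorTerm_dirac (hF : ∀ j, ∀ y ∈ U, F j y = (f j).1 y)
    (hf : IsCKSequence M (analyticDirac hU Sum.inr Sum.inr) f)
    (c : ℕ → ℝ) (i j : ℕ) {z : Pt m p} (hz : z ∘ Sum.inr ∈ U) :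
    operatorTerm c (diracY (liftY (F i))) j z = (c j * (-1) ^ j / 4 ^ j *
      ((-1) ^ (i + 1) * (dimFactor M (i + 1) * ∏ l ∈ Finset.range j,
        dimFactor M (i + 1 + 2 * l + 1) * dimFactor M (i + 1 + 2 * l + 2)))) •
        (xVec z ^ (2 * j) * F (2 * j + (i + 1)) (z ∘ Sum.inr)) := by
  rw [hF _ _ hz, ← mul_assoc ((-1 : ℝ) ^ (i + 1)), add_comm (2 * j)]
  exact operatorTerm_eq c (diracY_eq hU (liftY_eq hF i))
    (hf.lap_pow_dirac (analyticDirac_sq hU Sum.inr_injective Sum.inr_injective) i j) hz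

/-- The coefficients of the Bessel series cancel a product `P` of factors of the recurrence, up to the
normalizing constants `g` and `a`. -/
lemma besselCoeff_mul {ν g P a : ℝ} {j : ℕ} (hΓ : Real.Gamma (ν + j + 1) ≠ 0)
    (h : P * g = a * (4 ^ j * j.factorial * Real.Gamma (ν + j + 1))) :
    g * (besselCoeff ν j * (-1) ^ j / 4 ^ j * P) = a := by
  have hj : (j.factorial : ℝ) ≠ 0 := by exact_mod_cast j.factorial_ne_zero
  have h4 : (4 : ℝ) ^ j ≠ 0 := pow_ne_zero _ (by norm_num)
  have h1 : ((-1 : ℝ) ^ j) * (-1) ^ j = 1 := by rw [← mul_pow]; simp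
  have h2 : g * (besselCoeff ν j * (-1) ^ j / 4 ^ j * P) = ((-1 : ℝ) ^ j * (-1) ^ j) *
      (P * g) / (4 ^ j * j.factorial * Real.Gamma (ν + j + 1)) := by
    rw [besselCoeff]; ring
  rw [h2, h1, h, one_mul, mul_div_assoc, div_self (mul_ne_zero (mul_ne_zero h4 hj) hΓ), mul_one]

/-- Up to the factor `Γ(M/2)`, the terms of `B_{M/2-1}[F_0]` are the even terms of the series. -/
lemma besselTerm_lift_zero (hF : ∀ j, ∀ y ∈ U, F j y = (f j).1 y)
    (hf : IsCKSequence M (analyticDirac hU Sum.inr Sum.inr) f)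
    (hM : ∀ k : ℕ, M ≠ -2 * (k : ℤ)) (j : ℕ) {z : Pt m p} (hz : z ∘ Sum.inr ∈ U) :
    Real.Gamma (M / 2) • besselTerm (M / 2 - 1) (liftY (F 0)) j z =
      xVec z ^ (2 * j) * F (2 * j + 0) (z ∘ Sum.inr) := by
  have hG : Real.Gamma (M / 2 - 1 + j + 1) ≠ 0 := Real.Gamma_ne_zero fun l h => by
    apply hM (j + l)
    have : (M : ℝ) = -2 * ((j + l : ℕ) : ℤ) := by push_cast; linarith
    exact_mod_cast this
  rw [besselTerm, operatorTerm_lift hF hf _ _ _ hz, smul_smul, besselCoeff_mul hG (a := 1), one_smul]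
  rw [prod_dimFactor_even M hM, one_mul]

/-- Up to constants, the terms of `B_{M/2}[∂_y F_0]` are the odd terms of the series, divided by `x`. -/
lemma besselTerm_dirac_zero (hF : ∀ j, ∀ y ∈ U, F j y = (f j).1 y)
    (hf : IsCKSequence M (analyticDirac hU Sum.inr Sum.inr) f)
    (hM : ∀ k : ℕ, M ≠ -2 * (k : ℤ)) (j : ℕ) {z : Pt m p} (hz : z ∘ Sum.inr ∈ U) :
    Real.Gamma (M / 2) • besselTerm (M / 2) (diracY (liftY (F 0))) j z =
      (-2 : ℝ) • (xVec z ^ (2 * j) * F (2 * j + 1) (z ∘ Sum.inr)) := by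
  have hG : Real.Gamma (M / 2 + j + 1) ≠ 0 := Real.Gamma_ne_zero fun l h => by
    apply hM (j + 1 + l)
    have : (M : ℝ) = -2 * ((j + 1 + l : ℕ) : ℤ) := by push_cast; linarith
    exact_mod_cast this
  rw [besselTerm, operatorTerm_dirac hF hf _ _ _ hz, smul_smul, besselCoeff_mul hG (a := -2)]
  rw [mul_assoc, prod_dimFactor_odd M hM]
  ring

variable {k : ℕ}

/-- For `M = -2k` the terms of `B_k[F_{2k+1}]` are every other term of the series from the index
`2k + 1` on, divided by `x^{2k+1}`. -/
lemma besselTerm_lift_tail (hF : ∀ j, ∀ y ∈ U, F j y = (f j).1 y)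
    (hf : IsCKSequence M (analyticDirac hU Sum.inr Sum.inr) f)
    (hM : M = -2 * (k : ℤ)) (j : ℕ) {z : Pt m p} (hz : z ∘ Sum.inr ∈ U) :
    (k.factorial : ℝ) • besselTerm (k : ℝ) (liftY (F (2 * k + 1))) j z =
      xVec z ^ (2 * j) * F (2 * j + (2 * k + 1)) (z ∘ Sum.inr) := by
  have hG : Real.Gamma (k + j + 1) = (k + j).factorial := by
    rw [← Real.Gamma_nat_eq_factorial]; push_cast; rfl
  have hG0 : Real.Gamma (k + j + 1) ≠ 0 := by
    rw [hG]; exact_mod_cast Nat.factorial_ne_zero _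
  rw [besselTerm, operatorTerm_lift hF hf _ _ _ hz, smul_smul, besselCoeff_mul hG0 (a := 1),
    one_smul]
  rw [prod_dimFactor_tail_even hM, one_mul, hG]

/-- For `M = -2k` the terms of `B_{k+1}[∂_y F_{2k+1}]` are every other term of the series from the
index `2k + 2` on, divided by `x^{2k+2}`. -/
lemma besselTerm_dirac_tail (hF : ∀ j, ∀ y ∈ U, F j y = (f j).1 y)
    (hf : IsCKSequence M (analyticDirac hU Sum.inr Sum.inr) f)
    (hM : M = -2 * (k : ℤ)) (j : ℕ) {z : Pt m p} (hz : z ∘ Sum.inr ∈ U) :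
    (k.factorial : ℝ) • besselTerm ((k : ℝ) + 1) (diracY (liftY (F (2 * k + 1)))) j z =
      (2 : ℝ) • (xVec z ^ (2 * j) * F (2 * j + (2 * k + 1 + 1)) (z ∘ Sum.inr)) := by
  have hG : Real.Gamma ((k : ℝ) + 1 + j + 1) = (k + 1 + j).factorial := by
    rw [← Real.Gamma_nat_eq_factorial]; push_cast; rfl
  have hG0 : Real.Gamma ((k : ℝ) + 1 + j + 1) ≠ 0 := by
    rw [hG]; exact_mod_cast Nat.factorial_ne_zero _
  rw [besselTerm, operatorTerm_dirac hF hf _ _ _ hz, smul_smul, besselCoeff_mul hG0 (a := 2)]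
  rw [show (-1 : ℝ) ^ (2 * k + 1 + 1) = 1 from Even.neg_one_pow ⟨k + 1, by ring⟩, one_mul,
    prod_dimFactor_tail_odd hM, hG]
  ring

lemma appellP_coeff (k j : ℕ) :
    (appellP k).coeff j = if j ≤ k then ((k - j).factorial : ℝ) / j.factorial else 0 := by
  simp only [appellP, Polynomial.finsetSum_coeff, Polynomial.coeff_monomial,
    Finset.sum_ite_eq', Finset.mem_range, Nat.lt_succ_iff]

lemma polyOperator_appellP (G : Pt m p → Val m n p q) (z : Pt m p) :
    polyOperator (appellP k) G z = ∑ j ∈ Finset.range (k + 1), operatorTerm (appellP k).coeff G j z := by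
  refine Finset.sum_subset (fun j hj => ?_) fun j _ hj => ?_
  · rw [Polynomial.mem_support_iff, appellP_coeff] at hj
    rw [Finset.mem_range, Nat.lt_succ_iff]
    by_contra h
    simp [h] at hj
  · rw [Polynomial.notMem_support_iff] at hj
    rw [operatorTerm, hj, zero_div, zero_smul]

/-- The coefficients of `P_k` cancel a product `P` of factors of the recurrence. -/
lemma appell_coeff_mul {P a : ℝ} {j k : ℕ} (hj : j ≤ k)
    (h : P * (k - j).factorial = a * ((-4) ^ j * j.factorial)) :
    (appellP k).coeff j * (-1) ^ j / 4 ^ j * P = a := by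
  have hj0 : (j.factorial : ℝ) ≠ 0 := by exact_mod_cast j.factorial_ne_zero
  have h4 : (4 : ℝ) ^ j ≠ 0 := pow_ne_zero _ (by norm_num)
  have h1 : ((-1 : ℝ) ^ j) * (-1) ^ j = 1 := by rw [← mul_pow]; simp
  have h3 : (-4 : ℝ) ^ j = (-1) ^ j * 4 ^ j := by rw [← mul_pow]; norm_num
  have h2 : (appellP k).coeff j * (-1) ^ j / 4 ^ j * P =
      (-1 : ℝ) ^ j * (P * (k - j).factorial) / (4 ^ j * j.factorial) := by
    rw [appellP_coeff, if_pos hj]; ring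
  rw [h2, h, h3, show (-1 : ℝ) ^ j * (a * ((-1) ^ j * 4 ^ j * j.factorial)) =
    (-1) ^ j * (-1) ^ j * a * (4 ^ j * j.factorial) by ring, h1, one_mul, mul_div_assoc,
    div_self (mul_ne_zero h4 hj0), mul_one]

lemma polyOperator_lift (hF : ∀ j, ∀ y ∈ U, F j y = (f j).1 y)
    (hf : IsCKSequence M (analyticDirac hU Sum.inr Sum.inr) f)
    (hM : M = -2 * (k : ℤ)) {z : Pt m p} (hz : z ∘ Sum.inr ∈ U) :
    polyOperator (appellP k) (liftY (F 0)) z = (k.factorial : ℝ) •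
      ∑ j ∈ Finset.range (k + 1), ckTerm F (2 * j) z := by
  rw [polyOperator_appellP, Finset.smul_sum]
  refine Finset.sum_congr rfl fun j hj => ?_
  have hjk : j ≤ k := Nat.lt_succ_iff.mp (Finset.mem_range.mp hj)
  rw [operatorTerm_lift hF hf _ _ _ hz, appell_coeff_mul hjk (a := k.factorial)]
  · rfl
  · rw [prod_dimFactor_even_of_eq hM hjk]; ring

lemma xVec_mul_polyOperator_dirac (hF : ∀ j, ∀ y ∈ U, F j y = (f j).1 y)
    (hf : IsCKSequence M (analyticDirac hU Sum.inr Sum.inr) f)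
    (hM : M = -2 * (k : ℤ)) {z : Pt m p} (hz : z ∘ Sum.inr ∈ U) :
    xVec z * polyOperator (appellPred k) (diracY (liftY (F 0))) z =
      (2 * k.factorial : ℝ) • ∑ j ∈ Finset.range k, ckTerm F (2 * j + 1) z := by
  cases k with
  | zero => simp [appellPred, polyOperator]
  | succ k =>
    rw [appellPred, polyOperator_appellP, Finset.mul_sum, Finset.smul_sum]
    refine Finset.sum_congr rfl fun j hj => ?_
    have hjk : j ≤ k := Nat.lt_succ_iff.mp (Finset.mem_range.mp hj)
    rw [operatorTerm_dirac hF hf _ _ _ hz,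
      appell_coeff_mul hjk (a := 2 * (k + 1).factorial), mul_smul_comm, ← mul_assoc, ← pow_succ']
    · rfl
    · rw [mul_assoc, prod_dimFactor_odd_of_eq hM hjk]; ring

lemma sum_range_two_mul_add_one {B : Type*} [AddCommMonoid B] (T : ℕ → B) (k : ℕ) :
    ∑ j ∈ Finset.range (2 * k + 1), T j =
      ∑ j ∈ Finset.range (k + 1), T (2 * j) + ∑ j ∈ Finset.range k, T (2 * j + 1) := by
  induction k with
  | zero => simp
  | succ k ih =>
    rw [show 2 * (k + 1) + 1 = 2 * k + 1 + 1 + 1 by ring, Finset.sum_range_succ,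
      Finset.sum_range_succ, ih, Finset.sum_range_succ _ (k + 1), Finset.sum_range_succ _ k,
      Finset.sum_range_succ (fun j => T (2 * j + 1)) k,
      show 2 * k + 1 + 1 = 2 * (k + 1) by ring]
    abel

/-- In the exceptional dimensions `M = -2k` the Appell polynomials produce the first `2k + 1`
terms of the series. -/
lemma appell_part_eq (hF : ∀ j, ∀ y ∈ U, F j y = (f j).1 y)
    (hf : IsCKSequence M (analyticDirac hU Sum.inr Sum.inr) f)
    (hM : M = -2 * (k : ℤ)) {z : Pt m p} (hz : z ∘ Sum.inr ∈ U) :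
    (1 / (k.factorial : ℝ)) • (polyOperator (appellP k) (liftY (F 0)) z
        + (1 / 2 : ℝ) • (xVec z * polyOperator (appellPred k) (diracY (liftY (F 0))) z)) =
      ∑ j ∈ Finset.range (2 * k + 1), ckTerm F j z := by
  have hk : (k.factorial : ℝ) ≠ 0 := by exact_mod_cast k.factorial_ne_zero
  rw [polyOperator_lift hF hf hM hz, xVec_mul_polyOperator_dirac hF hf hM hz, smul_smul, smul_add,
    smul_smul, smul_smul, sum_range_two_mul_add_one, one_div_mul_cancel hk,
    show 1 / (k.factorial : ℝ) * (1 / 2 * (2 * k.factorial)) = 1 by field_simp, one_smul, one_smul]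

/-- `∂_y^{2k} F_0` is a multiple of `F_{2k}`, and `∂_y F_{2k} = 0` because the factor `c_{2k+1}`
vanishes for `M = -2k`. -/
lemma diracY_iterate_eq_zero (hF : ∀ j, ∀ y ∈ U, F j y = (f j).1 y)
    (hf : IsCKSequence M (analyticDirac hU Sum.inr Sum.inr) f)
    (hM : M = -2 * (k : ℤ)) {z : Pt m p} (hz : z ∘ Sum.inr ∈ U) :
    (diracY^[2 * k + 1] (liftY (F 0))) z = 0 := by
  have h0 : (analyticDirac hU Sum.inr Sum.inr ^ (2 * k + 1)) (f 0) = 0 := by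
    obtain ⟨c, hc⟩ := hf.exists_dirac_pow (2 * k)
    have h1 : dimFactor M (2 * k + 1) = 0 := by rw [dimFactor_odd, hM]; push_cast; ring
    rw [pow_succ', Module.End.mul_apply, hc, map_smul, hf.dirac, h1, mul_zero, zero_smul, smul_zero]
  rw [diracY_iterate_eq hU (liftY_eq hF 0) _ z hz, h0]
  rfl

end Identification

/-! ### Iterated directional derivatives -/

section DirectionalDerivatives

variable {E : Type*} [NormedAddCommGroup E] [NormedSpace ℝ E] {U : Set E} {G H : E → ℝ}

/-- The derivative of `G` in the direction `v`. -/
def dirDeriv (v : E) (G : E → ℝ) (z : E) : ℝ := fderiv ℝ G z v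

lemma contDiffOn_dirDeriv (hU : IsOpen U) (hG : ContDiffOn ℝ ∞ G U) (v : E) :
    ContDiffOn ℝ ∞ (dirDeriv v G) U :=
  (hG.fderiv_of_isOpen hU (by simp)).clm_apply contDiffOn_const

lemma contDiffOn_iterate_dirDeriv (hU : IsOpen U) (hG : ContDiffOn ℝ ∞ G U) (v : E) (k : ℕ) :
    ContDiffOn ℝ ∞ ((dirDeriv v)^[k] G) U := by
  induction k with
  | zero => exact hG
  | succ k ih => rw [Function.iterate_succ_apply']; exact contDiffOn_dirDeriv hU ih v

lemma differentiableAt_of_contDiffOn (hU : IsOpen U) (hG : ContDiffOn ℝ ∞ G U) {z : E}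
    (hz : z ∈ U) : DifferentiableAt ℝ G z :=
  (hG.contDiffAt (hU.mem_nhds hz)).differentiableAt (by simp)

lemma dirDeriv_congr (hU : IsOpen U) (v : E) (h : Set.EqOn G H U) :
    Set.EqOn (dirDeriv v G) (dirDeriv v H) U := fun z hz => by
  have : G =ᶠ[𝓝 z] H := h.eventuallyEq_of_mem (hU.mem_nhds hz)
  rw [dirDeriv, dirDeriv, this.fderiv_eq]

lemma iterate_dirDeriv_congr (hU : IsOpen U) (v : E) (k : ℕ) (h : Set.EqOn G H U) :
    Set.EqOn ((dirDeriv v)^[k] G) ((dirDeriv v)^[k] H) U := by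
  induction k with
  | zero => exact h
  | succ k ih =>
    rw [Function.iterate_succ_apply', Function.iterate_succ_apply']
    exact dirDeriv_congr hU v ih

lemma iterate_dirDeriv_dirDeriv (hU : IsOpen U) (hG : ContDiffOn ℝ ∞ G U) (u v : E) (k : ℕ) :
    Set.EqOn ((dirDeriv u)^[k] (dirDeriv v G)) (dirDeriv v ((dirDeriv u)^[k] G)) U := by
  induction k with
  | zero => exact fun _ _ => rfl
  | succ k ih =>
    rw [Function.iterate_succ_apply', Function.iterate_succ_apply']
    refine (dirDeriv_congr hU u ih).trans fun z hz => ?_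
    refine fderiv_fderiv_comm (F := (dirDeriv u)^[k] G) ?_ v u
    exact ((contDiffOn_iterate_dirDeriv hU hG u k).contDiffAt (hU.mem_nhds hz)).of_le
      (WithTop.coe_le_coe.mpr (le_top : (2 : ℕ∞) ≤ ⊤))

lemma dirDeriv_sum {ι : Type*} (s : Finset ι) {G : ι → E → ℝ} (hU : IsOpen U)
    (hG : ∀ i ∈ s, ContDiffOn ℝ ∞ (G i) U) (v : E) :
    Set.EqOn (dirDeriv v fun z => ∑ i ∈ s, G i z) (fun z => ∑ i ∈ s, dirDeriv v (G i) z) U := by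
  intro z hz
  rw [dirDeriv, fderiv_fun_sum fun i hi => differentiableAt_of_contDiffOn hU (hG i hi) hz]
  simp [dirDeriv]

lemma iterate_dirDeriv_sum {ι : Type*} (s : Finset ι) {G : ι → E → ℝ} (hU : IsOpen U)
    (hG : ∀ i ∈ s, ContDiffOn ℝ ∞ (G i) U) (v : E) (k : ℕ) :
    Set.EqOn ((dirDeriv v)^[k] fun z => ∑ i ∈ s, G i z)
      (fun z => ∑ i ∈ s, (dirDeriv v)^[k] (G i) z) U := by
  induction k with
  | zero => exact fun _ _ => rfl
  | succ k ih =>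
    simp only [Function.iterate_succ_apply']
    exact (dirDeriv_congr hU v ih).trans (dirDeriv_sum s hU
      (fun i hi => contDiffOn_iterate_dirDeriv hU (hG i hi) v k) v)

lemma iterate_dirDeriv_sub (hU : IsOpen U) (hG : ContDiffOn ℝ ∞ G U) (hH : ContDiffOn ℝ ∞ H U)
    (v : E) (k : ℕ) :
    Set.EqOn ((dirDeriv v)^[k] fun z => G z - H z)
      (fun z => (dirDeriv v)^[k] G z - (dirDeriv v)^[k] H z) U := by
  induction k with
  | zero => exact fun _ _ => rfl
  | succ k ih =>
    simp only [Function.iterate_succ_apply']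
    refine (dirDeriv_congr hU v ih).trans fun z hz => ?_
    rw [dirDeriv, fderiv_fun_sub
      (differentiableAt_of_contDiffOn hU (contDiffOn_iterate_dirDeriv hU hG v k) hz)
      (differentiableAt_of_contDiffOn hU (contDiffOn_iterate_dirDeriv hU hH v k) hz)]
    rfl

lemma hasDerivAt_along (hU : IsOpen U) (hG : ContDiffOn ℝ ∞ G U) (z v : E) {t : ℝ}
    (ht : z + t • v ∈ U) : HasDerivAt (fun t : ℝ => G (z + t • v)) (dirDeriv v G (z + t • v)) t := by
  have h1 : HasDerivAt (fun t : ℝ => z + t • v) v t := by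
    simpa using ((hasDerivAt_id t).smul_const v).const_add z
  exact (differentiableAt_of_contDiffOn hU hG ht).hasFDerivAt.comp_hasDerivAt t h1

lemma iteratedDeriv_along (hU : IsOpen U) (hG : ContDiffOn ℝ ∞ G U) (z v : E) (k : ℕ) :
    ∀ t : ℝ, z + t • v ∈ U →
      iteratedDeriv k (fun t : ℝ => G (z + t • v)) t = (dirDeriv v)^[k] G (z + t • v) := by
  induction k with
  | zero => intro t _; simp
  | succ k ih =>
    intro t ht
    have hopen : ∀ᶠ t' in 𝓝 t, z + t' • v ∈ U := by
      have : ContinuousAt (fun t : ℝ => z + t • v) t := by fun_prop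
      exact this (hU.mem_nhds ht)
    have hev : iteratedDeriv k (fun t : ℝ => G (z + t • v)) =ᶠ[𝓝 t]
        fun t => (dirDeriv v)^[k] G (z + t • v) := hopen.mono fun t' ht' => ih t' ht'
    rw [iteratedDeriv_succ, hev.deriv_eq, Function.iterate_succ_apply']
    exact (hasDerivAt_along hU (contDiffOn_iterate_dirDeriv hU hG v k) z v ht).deriv

/-- If `G` is given by a power series along a line, the coefficients are its Taylor coefficients. -/
lemma iterate_dirDeriv_of_hasSum (hU : IsOpen U) (hG : ContDiffOn ℝ ∞ G U) {z : E} (hz : z ∈ U)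
    (v : E) {a : ℕ → ℝ}
    (h : ∀ᶠ t : ℝ in 𝓝 0, HasSum (fun k => t ^ k * a k) (G (z + t • v))) (k : ℕ) :
    (dirDeriv v)^[k] G z = k.factorial * a k := by
  have h1 : HasFPowerSeriesAt (fun t : ℝ => G (z + t • v))
      (FormalMultilinearSeries.ofScalars ℝ a) 0 := by
    rw [hasFPowerSeriesAt_iff]
    simpa using h
  have h2 := (AnalyticAt.hasFPowerSeriesAt ⟨_, h1⟩).eq_formalMultilinearSeries h1
  have h3 := congrArg (fun p => FormalMultilinearSeries.coeff p k) h2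
  simp only [FormalMultilinearSeries.coeff_ofScalars] at h3
  rw [iteratedDeriv_along hU hG z v k 0 (by simpa using hz), zero_smul, add_zero] at h3
  rw [← h3, mul_div_cancel₀]
  exact_mod_cast k.factorial_ne_zero

/-- An even-odd decomposition determines a derivative: the odd part is `s * Q s`. -/
lemma HasDerivAt.eq_of_sub_neg {D Q : ℝ → ℝ} {d : ℝ} (hD : HasDerivAt D d 0)
    (hQ : ContinuousAt Q 0) (h : ∀ᶠ s in 𝓝 0, D s - D (-s) = 2 * s * Q s) : d = Q 0 := by
  have h1 : HasDerivAt (fun s => D s - D (-s)) (d - -d) 0 := by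
    have h0 : HasDerivAt D d (-0) := by rwa [neg_zero]
    have := hD.fun_sub (h0.scomp (0 : ℝ) (hasDerivAt_neg (0 : ℝ)))
    simpa [Function.comp_def] using this
  rw [hasDerivAt_iff_tendsto_slope_zero] at h1
  have h2 : Tendsto (fun t => 2 * Q t) (𝓝[≠] 0) (𝓝 (2 * Q 0)) :=
    (hQ.tendsto.mono_left nhdsWithin_le_nhds).const_mul 2
  have h3 : ∀ᶠ t in 𝓝[≠] (0 : ℝ), t⁻¹ • ((D (0 + t) - D (-(0 + t))) - (D 0 - D (-0))) = 2 * Q t := by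
    filter_upwards [h.filter_mono nhdsWithin_le_nhds, self_mem_nhdsWithin] with t ht ht0
    have ht0' : t ≠ 0 := ht0
    rw [zero_add, ht, neg_zero, sub_self, sub_zero, smul_eq_mul]
    field_simp
  have := tendsto_nhds_unique (h1.congr' h3) h2
  linarith

end DirectionalDerivatives

/-! ### Smooth functions with values in a vector space without topology -/

section Smooth

variable {I A : Type} [Fintype I] [AddCommGroup A] [Module ℝ A] {Ω : Set (I → ℝ)}
  {S : (I → ℝ) → A}

lemma IsSmooth.contDiffOn_dual (hS : IsSmooth Ω S) (φ : Module.Dual ℝ A) :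
    ContDiffOn ℝ ∞ (fun z => φ (S z)) Ω := by
  obtain ⟨s, c, a, hc, hSa⟩ := hS
  have h : ContDiffOn ℝ ∞ (fun z => ∑ r, c r z * φ (a r)) Ω :=
    ContDiffOn.sum fun r _ => (hc r).mul contDiffOn_const
  refine h.congr fun z hz => ?_
  rw [hSa z hz, map_sum]
  simp

variable [DecidableEq I]

lemma IsSmooth.hasPartialDeriv (hΩ : IsOpen Ω) (hS : IsSmooth Ω S) (i : I) {z : I → ℝ}
    (hz : z ∈ Ω) : HasPartialDeriv i S (partialDeriv i S z) z := by
  obtain ⟨s, c, a, hc, hSa⟩ := id hS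
  have hd : ∀ φ : Module.Dual ℝ A, DifferentiableAt ℝ (fun z => φ (S z)) z := fun φ =>
    differentiableAt_of_contDiffOn hΩ (hS.contDiffOn_dual φ) hz
  have h : HasPartialDeriv i S (∑ r, fderiv ℝ (c r) z (Pi.single i 1) • a r) z := by
    refine hasPartialDeriv_of_fderiv hd fun φ => ?_
    have hev : (fun z => φ (S z)) =ᶠ[𝓝 z] fun z => ∑ r, c r z * φ (a r) := by
      filter_upwards [hΩ.mem_nhds hz] with z' hz'
      rw [hSa z' hz', map_sum]
      simp
    have hcd : ∀ r, DifferentiableAt ℝ (c r) z := fun r =>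
      differentiableAt_of_contDiffOn hΩ (hc r) hz
    rw [hev.fderiv_eq, fderiv_fun_sum fun r _ => (hcd r).mul_const _]
    simp [fderiv_mul_const, hcd, mul_comm]
  rw [h.partialDeriv_eq]
  exact h

lemma IsSmooth.dual_partialDeriv (hΩ : IsOpen Ω) (hS : IsSmooth Ω S) (i : I) {z : I → ℝ}
    (hz : z ∈ Ω) (φ : Module.Dual ℝ A) :
    φ (partialDeriv i S z) = dirDeriv (Pi.single i 1) (fun z => φ (S z)) z :=
  (hS.hasPartialDeriv hΩ i hz).dual_eq_fderiv φ
    (differentiableAt_of_contDiffOn hΩ (hS.contDiffOn_dual φ) hz)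

end Smooth

/-! ### The coefficients as vector-valued analytic functions -/

section Coefficients

variable {m n p q : ℕ} {Ωp : Set (Fin p → ℝ)} {G : (Fin p → ℝ) → Val m n p q}

lemma IsAnalyticInY.exists_analyticFunctions (hG : IsAnalyticInY Ωp G) :
    ∃ f : analyticFunctions Ωp (Val m n p q), ∀ y ∈ Ωp, G y = f.1 y := by
  obtain ⟨s, f, g, c, hf, -, hG⟩ := hG
  refine ⟨∑ r, ⟨_, indicator_smul_mem (hf r) (g r ⊗ₜ[ℝ] c r)⟩, fun y hy => ?_⟩
  rw [hG y hy]
  simp [hy]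

/-- Functions of the super vector `y` do not involve the fermionic variables of `x`. -/
lemma IsAnalyticInY.body_eq (hG : IsAnalyticInY Ωp G) {y : Fin p → ℝ} (hy : y ∈ Ωp) :
    body (G y) = G y := by
  obtain ⟨s, f, g, c, -, hg, hG⟩ := hG
  have h : ∀ r, ExteriorAlgebra.map (dropLeft (Fin n) (Fin q)) (g r) = g r := by
    intro r
    have hle : Algebra.adjoin ℝ (Set.range fun a : Fin q × Fin 2 =>
        (fermVar ((Sum.inr a.1 : Fin n ⊕ Fin q), a.2) : Grassmann (Fin n ⊕ Fin q))) ≤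
        AlgHom.equalizer (ExteriorAlgebra.map (dropLeft (Fin n) (Fin q))) (AlgHom.id ℝ _) := by
      refine Algebra.adjoin_le ?_
      rintro _ ⟨a, rfl⟩
      exact map_dropLeft_fermVar a.1 a.2
    exact hle (hg r)
  rw [hG y hy, map_sum]
  exact Finset.sum_congr rfl fun r _ => by rw [map_smul, body_tmul, h]

end Coefficients

section AnticommutingFactors

variable {I J I' J' : Type} [DecidableEq I] [DecidableEq J] [DecidableEq I'] [Fintype I']
  [Fintype J'] {U : Set (I' → ℝ)}

/-- A constant that anticommutes with the Dirac operator can be pulled out of it. -/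
lemma analyticDirac_mulLeft_pow (hU : IsOpen U) {ι : I' → I} {κ : J' → J} {a : SuperAlg I J}
    (h1 : ∀ g, fermDirac κ (a * g) = -(a * fermDirac κ g))
    (h2 : ∀ i, eBos (ι i) * a = -(a * eBos (ι i))) (k : ℕ)
    (G : analyticFunctions U (SuperAlg I J)) :
    analyticDirac hU ι κ (postEnd U _ (LinearMap.mulLeft ℝ (a ^ k)) G) =
      (-1 : ℝ) ^ k • postEnd U _ (LinearMap.mulLeft ℝ (a ^ k)) (analyticDirac hU ι κ G) := by
  induction k with
  | zero =>
    rw [pow_zero, pow_zero, one_smul, show LinearMap.mulLeft ℝ (1 : SuperAlg I J) = 1 from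
      LinearMap.mulLeft_one ℝ _, map_one]
    rfl
  | succ k ih =>
    have h3 : ∀ H : analyticFunctions U (SuperAlg I J),
        analyticDirac hU ι κ (postEnd U _ (LinearMap.mulLeft ℝ a) H) =
          -postEnd U _ (LinearMap.mulLeft ℝ a) (analyticDirac hU ι κ H) := by
      intro H
      have hm : ∀ i, pderiv hU i (postEnd U _ (LinearMap.mulLeft ℝ a) H) =
          postEnd U _ (LinearMap.mulLeft ℝ a) (pderiv hU i H) := fun i => pderiv_postcomp hU i _ H
      simp only [analyticDirac, LinearMap.sub_apply, LinearMap.sum_apply, Module.End.mul_apply, hm,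
        map_sub, map_sum, neg_sub', ← Finset.sum_neg_distrib]
      congr 1
      · ext y
        exact h1 _
      · refine Finset.sum_congr rfl fun i _ => ?_
        ext y
        change eBos _ * (a * _) = -(a * (eBos _ * _))
        rw [← mul_assoc, ← mul_assoc, h2, neg_mul]
    have h4 : ∀ H : analyticFunctions U (SuperAlg I J),
        postEnd U _ (LinearMap.mulLeft ℝ (a ^ (k + 1))) H =
          postEnd U _ (LinearMap.mulLeft ℝ a) (postEnd U _ (LinearMap.mulLeft ℝ (a ^ k)) H) := by
      intro H
      rw [pow_succ', LinearMap.mulLeft_mul]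
      rfl
    rw [h4, h3, ih, h4, map_smul, pow_succ', neg_one_mul]
    exact (neg_smul ((-1 : ℝ) ^ k) (_ : analyticFunctions U (SuperAlg I J))).symm

end AnticommutingFactors

/-! ### Summation near the bosonic origin -/

section NearOrigin

variable {m n p q : ℕ} {F : ℕ → (Fin p → ℝ) → Val m n p q} {Ω : Set (Pt m p)}
  {S : Pt m p → Val m n p q}

lemma ConvergesAt.hasSum {I A : Type} [AddCommGroup A] [Module ℝ A] {T : ℕ → (I → ℝ) → A}
    {z : I → ℝ} {s : A} (h : ConvergesAt T z s) {φ : Module.Dual ℝ A}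
    (hs : Summable fun j => φ (T j z)) : HasSum (fun j => φ (T j z)) (φ s) := by
  have := tendsto_nhds_unique (h φ) hs.hasSum.tendsto_sum_nat
  rw [this]
  exact hs.hasSum

lemma bosNormSq_elim_single (i₀ : Fin m) (t : ℝ) (y : Fin p → ℝ) :
    bosNormSq (Sum.elim (Pi.single i₀ t) y : Pt m p) = t ^ 2 := by
  rw [bosNormSq, Finset.sum_eq_single i₀]
  · simp
  · intro i _ hi; simp [hi]
  · simp

lemma exists_box_subset (hΩ : IsOpen Ω) {y : Fin p → ℝ} (hy : Sum.elim (0 : Fin m → ℝ) y ∈ Ω) :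
    ∃ ε > 0, ∀ z : Pt m p, bosNormSq z < ε ^ 2 → z ∘ Sum.inr ∈ Metric.ball y ε → z ∈ Ω := by
  obtain ⟨ε, hε, hball⟩ := Metric.isOpen_iff.mp hΩ _ hy
  refine ⟨ε, hε, fun z hn hz => hball ?_⟩
  rw [Metric.mem_ball, dist_pi_lt_iff hε] at hz ⊢
  rintro (i | i)
  · rw [Sum.elim_inl, Pi.zero_apply, Real.dist_eq, sub_zero]
    refine abs_lt_of_sq_lt_sq (lt_of_le_of_lt ?_ hn) hε.le
    exact Finset.single_le_sum (f := fun i : Fin m => z (Sum.inl i) ^ 2)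
      (fun i _ => sq_nonneg _) (Finset.mem_univ i)
  · exact hz i

/-- Convergence at one point `(x, y)` with `x ≠ 0` yields absolute convergence at all `(x', y)`
with `x'` small. -/
lemma exists_hasSum_near (i₀ : Fin m) (hΩ : IsOpen Ω)
    (hsum : ∀ z ∈ Ω, ConvergesAt (ckTerm F) z (S z)) {y : Fin p → ℝ}
    (hy : Sum.elim (0 : Fin m → ℝ) y ∈ Ω) (hb : ∀ j, body (F j y) = F j y) :
    ∃ ρ δ : ℝ, 0 < δ ∧ δ < ρ ∧ GeomBound {y} F ρ ∧
      ∀ z : Pt m p, z ∘ Sum.inr = y → bosNormSq z ≤ δ ^ 2 →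
        z ∈ Ω ∧ ∀ φ : Module.Dual ℝ (Val m n p q),
          HasSum (fun j => φ (ckTerm F j z)) (φ (S z)) := by
  obtain ⟨ε, hε, hbox⟩ := exists_box_subset hΩ hy
  have hmem : ∀ z : Pt m p, z ∘ Sum.inr = y → bosNormSq z ≤ (ε / 2) ^ 2 → z ∈ Ω := fun z hz hn =>
    hbox z (hn.trans_lt (pow_lt_pow_left₀ (half_lt_self hε) (by positivity) two_ne_zero))
      (by rw [hz]; exact Metric.mem_ball_self hε)
  set z₁ : Pt m p := Sum.elim (Pi.single i₀ (ε / 2)) y with hz₁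
  have hn₁ : bosNormSq z₁ = (ε / 2) ^ 2 := bosNormSq_elim_single i₀ _ y
  have hG := geomBound_of_ckTerm_bound (z := z₁) hb (by rw [hn₁]; positivity)
    fun φ => (hsum z₁ (hmem z₁ rfl hn₁.le)).exists_bound φ
  rw [hn₁, Real.sqrt_sq (by positivity), show z₁ ∘ Sum.inr = y from rfl] at hG
  have h4 : ε / 4 < ε / 2 := by linarith
  refine ⟨ε / 2, ε / 4, by positivity, h4, hG, fun z hz hn => ?_⟩
  have hzΩ : z ∈ Ω := hmem z hz (hn.trans (pow_le_pow_left₀ (by positivity) h4.le 2))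
  refine ⟨hzΩ, fun φ => (hsum z hzΩ).hasSum ?_⟩
  obtain ⟨u, hu, hle⟩ := hG.exists_ckTerm_bound (by positivity) (by positivity) h4 φ
  exact Summable.of_norm_bounded hu fun j => hle j z hn hz

end NearOrigin

/-! ### The fermionic part of `∂_x` on the terms of the series -/

section FermionicDerivative

variable {m n p q : ℕ}

lemma fermDirac_inl_eq_zero {g : Val m n p q} (hg : body g = g) : fermDirac Sum.inl g = 0 := by
  rw [← hg, fermDirac_apply]
  simp [fermDeriv_inl_body]

lemma fermDirac_fermVec_mul_of_body {g : Val m n p q} (hg : body g = g) :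
    fermDirac Sum.inl (fermVec Sum.inl * g) = (-2 * (n : ℝ)) • g := by
  rw [fermDirac_fermVec_mul Sum.inl_injective fun j u => by rw [← hg, fermDeriv_inl_body],
    Fintype.card_fin]

/-- Factors `x²` pass through the fermionic part of `∂_x` modulo the fermionic variables of `x`: the
commutator and the nilpotent part of `x²` are killed by `body`. -/
lemma body_fermDirac_xVec_sq_pow_mul (z : Pt m p) (l : ℕ) (g : Val m n p q) :
    body (fermDirac Sum.inl ((xVec z ^ 2) ^ l * g)) =
      (-bosNormSq z) ^ l • body (fermDirac Sum.inl g) := by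
  induction l with
  | zero => simp
  | succ l ih =>
    rw [pow_succ', mul_assoc]
    generalize (xVec z ^ 2) ^ l * g = g' at ih ⊢
    rw [xVec_sq, add_mul, smul_mul_assoc, one_mul, map_add, map_smul, map_add, map_smul,
      fermDirac_fermNil_mul Sum.inl_injective, map_add, map_smul, map_mul, map_mul,
      body_fermVec_inl, body_fermNil_inl, ih, pow_succ', mul_smul]
    simp

lemma fermDirac_xVec_mul_of_body (z : Pt m p) {g : Val m n p q} (hg : body g = g) :
    fermDirac Sum.inl (xVec z * g) = (-2 * (n : ℝ)) • g := by
  rw [xVec_eq, add_mul, map_add, fermDirac_fermVec_mul_of_body hg, bosX, bosVec, Finset.sum_mul,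
    map_sum, Finset.sum_eq_zero, zero_add]
  intro i _
  rw [smul_mul_assoc, map_smul, fermDirac_eBos_mul, fermDirac_inl_eq_zero hg, mul_zero, neg_zero,
    smul_zero]

lemma body_fermDirac_ckTerm_even {F : ℕ → (Fin p → ℝ) → Val m n p q} {z : Pt m p} (l : ℕ)
    (hF : body (F (2 * l) (z ∘ Sum.inr)) = F (2 * l) (z ∘ Sum.inr)) :
    body (fermDirac Sum.inl (ckTerm F (2 * l) z)) = 0 := by
  rw [ckTerm, pow_mul, body_fermDirac_xVec_sq_pow_mul, liftY, fermDirac_inl_eq_zero hF, map_zero,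
    smul_zero]

lemma body_fermDirac_ckTerm_odd {F : ℕ → (Fin p → ℝ) → Val m n p q} {z : Pt m p} (l : ℕ)
    (hF : body (F (2 * l + 1) (z ∘ Sum.inr)) = F (2 * l + 1) (z ∘ Sum.inr)) :
    body (fermDirac Sum.inl (ckTerm F (2 * l + 1) z)) =
      ((-bosNormSq z) ^ l * (-2 * (n : ℝ))) • F (2 * l + 1) (z ∘ Sum.inr) := by
  rw [ckTerm, pow_succ, pow_mul, mul_assoc, body_fermDirac_xVec_sq_pow_mul, liftY,
    fermDirac_xVec_mul_of_body z hF, map_smul, hF, smul_smul]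

end FermionicDerivative

/-! ### Taylor coefficients at the bosonic origin -/

section TaylorCoefficients

variable {m n p q : ℕ}

lemma add_smul_single_comp_inr (z : Pt m p) (s : ℝ) (i : Fin m) :
    (z + s • (Pi.single (Sum.inl i) 1 : Pt m p)) ∘ Sum.inr = z ∘ Sum.inr := by
  ext j; simp

lemma bosX_add_smul_single (z : Pt m p) (s : ℝ) (i : Fin m) :
    (bosX (z + s • (Pi.single (Sum.inl i) 1 : Pt m p)) : Val m n p q) =
      bosX z + s • eBos (Sum.inl i) := by
  simp only [bosX, bosVec, Pi.add_apply, Pi.smul_apply, add_smul, Finset.sum_add_distrib]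
  congr 1
  rw [Finset.sum_eq_single i]
  · simp
  · intro k _ hk; simp [hk]
  · simp

lemma bosX_elim_zero (y : Fin p → ℝ) :
    (bosX (Sum.elim (0 : Fin m → ℝ) y) : Val m n p q) = 0 := by
  simp [bosX, bosVec]

lemma bosNormSq_add_smul_single (z : Pt m p) (s : ℝ) (i : Fin m) :
    bosNormSq (z + s • (Pi.single (Sum.inl i) 1 : Pt m p)) =
      bosNormSq z + 2 * s * z (Sum.inl i) + s ^ 2 := by
  have h : ∀ k : Fin m, (z + s • (Pi.single (Sum.inl i) 1 : Pt m p)) (Sum.inl k) ^ 2 =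
      z (Sum.inl k) ^ 2 + if k = i then 2 * s * z (Sum.inl i) + s ^ 2 else 0 := by
    intro k
    split_ifs with hk
    · subst hk; simp; ring
    · simp [hk]
  simp only [bosNormSq, h, Finset.sum_add_distrib, Finset.sum_ite_eq', Finset.mem_univ, if_true]
  ring

lemma bosNormSq_elim_zero (y : Fin p → ℝ) : bosNormSq (Sum.elim (0 : Fin m → ℝ) y) = 0 := by
  simp [bosNormSq]

lemma eBos_pow_even {I J : Type} [DecidableEq I] [DecidableEq J] (i : I) (l : ℕ) :
    (eBos i : SuperAlg I J) ^ (2 * l) = (-1 : ℝ) ^ l • 1 := by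
  rw [pow_mul, pow_two, eBos_sq, show (-1 : SuperAlg I J) = (-1 : ℝ) • 1 by simp, smul_pow, one_pow]

lemma hasSum_of_eq {g a : ℕ → ℝ} {s : ℝ} (h : HasSum g s) (ha : ∀ j, a j = g j) : HasSum a s := by
  rwa [show a = g from funext ha]

/-- A sum over the odd indices, regarded as a sum over all shifted indices. -/
lemma hasSum_of_hasSum_odd {g a : ℕ → ℝ} {s : ℝ} (h : HasSum g s) (h0 : ∀ l, g (2 * l) = 0)
    (ha : ∀ l, a (2 * l) = g (2 * l + 1)) (ha' : ∀ l, a (2 * l + 1) = 0) : HasSum a s := by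
  have h1 : HasSum (fun j => g (j + 1)) s := by
    have := (hasSum_nat_add_iff' (f := g) 1).mpr h
    simpa [show g 0 = 0 from h0 0] using this
  refine hasSum_of_eq h1 fun j => ?_
  rcases Nat.even_or_odd' j with ⟨l, rfl | rfl⟩
  · exact ha l
  · rw [ha', show 2 * l + 1 + 1 = 2 * (l + 1) by ring, h0]

variable {F : ℕ → (Fin p → ℝ) → Val m n p q} {Ω : Set (Pt m p)}
  {S : Pt m p → Val m n p q} {y : Fin p → ℝ} {ρ δ : ℝ}

lemma eventually_sq_le (hδ : 0 < δ) : ∀ᶠ t : ℝ in 𝓝 0, t ^ 2 ≤ δ ^ 2 := by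
  have : ∀ᶠ t : ℝ in 𝓝 0, t ^ 2 < δ ^ 2 := by
    have hc : ContinuousAt (fun t : ℝ => t ^ 2) 0 := by fun_prop
    exact hc.eventually_lt continuousAt_const (by simpa using pow_pos hδ 2)
  exact this.mono fun t ht => ht.le

/-- The Taylor coefficients of the body of `S` along the line `t e` are `e^k F_k`. -/
lemma iterate_dirDeriv_body (i₀ : Fin m) (hΩ : IsOpen Ω) (hS : IsSmooth Ω S)
    (hb : ∀ j, body (F j y) = F j y) (hδ : 0 < δ)
    (hnear : ∀ z : Pt m p, z ∘ Sum.inr = y → bosNormSq z ≤ δ ^ 2 →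
      z ∈ Ω ∧ ∀ φ : Module.Dual ℝ (Val m n p q), HasSum (fun j => φ (ckTerm F j z)) (φ (S z)))
    (φ : Module.Dual ℝ (Val m n p q)) (k : ℕ) :
    (dirDeriv (Pi.single (Sum.inl i₀) 1))^[k] (fun z => φ (body (S z))) (Sum.elim (0 : Fin m → ℝ) y) =
      k.factorial * φ (eBos (Sum.inl i₀) ^ k * F k y) := by
  refine iterate_dirDeriv_of_hasSum hΩ (hS.contDiffOn_dual (φ ∘ₗ body.toLinearMap))
    (hnear _ rfl (by rw [bosNormSq_elim_zero]; positivity)).1 _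
    (a := fun k => φ (eBos (Sum.inl i₀) ^ k * F k y)) ?_ k
  refine (eventually_sq_le hδ).mono fun t ht => ?_
  set z : Pt m p := Sum.elim (0 : Fin m → ℝ) y + t • (Pi.single (Sum.inl i₀) 1 : Pt m p) with hz
  have hzy : z ∘ Sum.inr = y := add_smul_single_comp_inr _ _ _
  have hn : bosNormSq z = t ^ 2 := by
    rw [hz, bosNormSq_add_smul_single, bosNormSq_elim_zero]; simp
  have h := (hnear z hzy (hn.trans_le ht)).2 (φ ∘ₗ body.toLinearMap)
  refine hasSum_of_eq h fun j => ?_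
  change _ = φ (body (ckTerm F j z))
  rw [body_ckTerm (by rwa [hzy]), hzy, hz, bosX_add_smul_single, bosX_elim_zero, zero_add,
    smul_pow, smul_mul_assoc, map_smul, smul_eq_mul]

/-- The Taylor coefficients of the fermionic part of `∂_x S` along the line `t e`: an odd power of `x`
contributes `-2n` times the power one lower, an even power nothing. -/
lemma iterate_dirDeriv_body_fermDirac (i₀ : Fin m) (hΩ : IsOpen Ω) (hS : IsSmooth Ω S)
    (hb : ∀ j, body (F j y) = F j y) (hδ : 0 < δ)
    (hnear : ∀ z : Pt m p, z ∘ Sum.inr = y → bosNormSq z ≤ δ ^ 2 →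
      z ∈ Ω ∧ ∀ φ : Module.Dual ℝ (Val m n p q), HasSum (fun j => φ (ckTerm F j z)) (φ (S z)))
    (φ : Module.Dual ℝ (Val m n p q)) (k : ℕ) :
    (dirDeriv (Pi.single (Sum.inl i₀) 1))^[k] (fun z => φ (body (fermDirac Sum.inl (S z))))
        (Sum.elim (0 : Fin m → ℝ) y) =
      k.factorial *
        if Even k then -2 * (n : ℝ) * φ (eBos (Sum.inl i₀) ^ k * F (k + 1) y) else 0 := by
  refine iterate_dirDeriv_of_hasSum hΩ
    (hS.contDiffOn_dual (φ ∘ₗ body.toLinearMap ∘ₗ fermDirac Sum.inl))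
    (hnear _ rfl (by rw [bosNormSq_elim_zero]; positivity)).1 _
    (a := fun k => if Even k then -2 * (n : ℝ) * φ (eBos (Sum.inl i₀) ^ k * F (k + 1) y) else 0)
    ?_ k
  refine (eventually_sq_le hδ).mono fun t ht => ?_
  set z : Pt m p := Sum.elim (0 : Fin m → ℝ) y + t • (Pi.single (Sum.inl i₀) 1 : Pt m p) with hz
  have hzy : z ∘ Sum.inr = y := add_smul_single_comp_inr _ _ _
  have hn : bosNormSq z = t ^ 2 := by
    rw [hz, bosNormSq_add_smul_single, bosNormSq_elim_zero]; simp
  have h := (hnear z hzy (hn.trans_le ht)).2 (φ ∘ₗ body.toLinearMap ∘ₗ fermDirac Sum.inl)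
  refine hasSum_of_hasSum_odd h (fun l => ?_) (fun l => ?_) (fun l => ?_)
  · change φ (body (fermDirac Sum.inl (ckTerm F (2 * l) z))) = 0
    rw [body_fermDirac_ckTerm_even l (by rw [hzy, hb]), map_zero]
  · change _ = φ (body (fermDirac Sum.inl (ckTerm F (2 * l + 1) z)))
    rw [body_fermDirac_ckTerm_odd l (by rw [hzy, hb]), hzy, hn, if_pos (even_two_mul l),
      eBos_pow_even, smul_mul_assoc, one_mul, map_smul, map_smul, smul_eq_mul, smul_eq_mul,
      neg_pow, pow_mul]
    ring
  · simp

/-- In a direction `e_i` orthogonal to `e_{i₀}`, the first derivative along the line `t e_{i₀}`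
is read off from `(t e_{i₀} + s e_i)² = -(t² + s²)`. -/
lemma iterate_dirDeriv_dirDeriv_body {i i₀ : Fin m} (hi : i ≠ i₀) (hΩ : IsOpen Ω)
    (hS : IsSmooth Ω S) (hb : ∀ j, body (F j y) = F j y) (hδ : 0 < δ) (hδρ : δ < ρ)
    (hG : GeomBound {y} F ρ)
    (hnear : ∀ z : Pt m p, z ∘ Sum.inr = y → bosNormSq z ≤ δ ^ 2 →
      z ∈ Ω ∧ ∀ φ : Module.Dual ℝ (Val m n p q), HasSum (fun j => φ (ckTerm F j z)) (φ (S z)))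
    (φ : Module.Dual ℝ (Val m n p q)) (k : ℕ) :
    (dirDeriv (Pi.single (Sum.inl i₀) 1))^[k]
        (dirDeriv (Pi.single (Sum.inl i) 1) fun z => φ (body (S z))) (Sum.elim (0 : Fin m → ℝ) y) =
      k.factorial *
        if Even k then φ (eBos (Sum.inl i₀) ^ k * (eBos (Sum.inl i) * F (k + 1) y)) else 0 := by
  have hcd := hS.contDiffOn_dual (φ ∘ₗ body.toLinearMap)
  refine iterate_dirDeriv_of_hasSum hΩ (contDiffOn_dirDeriv hΩ hcd _)
    (hnear _ rfl (by rw [bosNormSq_elim_zero]; positivity)).1 _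
    (a := fun k => if Even k then φ (eBos (Sum.inl i₀) ^ k * (eBos (Sum.inl i) * F (k + 1) y))
      else 0) ?_ k
  refine (eventually_sq_le (half_pos hδ)).mono fun t ht => ?_
  have htδ : t ^ 2 < δ ^ 2 := by nlinarith
  set z : Pt m p := Sum.elim (0 : Fin m → ℝ) y + t • (Pi.single (Sum.inl i₀) 1 : Pt m p) with hz
  set v : Pt m p := Pi.single (Sum.inl i) 1 with hv
  have hzy : ∀ s : ℝ, (z + s • v) ∘ Sum.inr = y := fun s => by
    rw [hv, add_smul_single_comp_inr, hz, add_smul_single_comp_inr]; rfl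
  have hn : ∀ s : ℝ, bosNormSq (z + s • v) = t ^ 2 + s ^ 2 := fun s => by
    rw [hv, bosNormSq_add_smul_single, hz, bosNormSq_add_smul_single, bosNormSq_elim_zero]
    simp [hi]
  set c : ℕ → ℝ := fun l => φ (eBos (Sum.inl i) * F (2 * l + 1) y) with hc
  -- The part of `φ (body S)` at `t e_{i₀} + s e_i` that is odd in `s` is `s * Q s`.
  set Q : ℝ → ℝ := fun s => ∑' l, (-(t ^ 2 + s ^ 2)) ^ l * c l with hQ
  have hρ : 0 < ρ := hδ.trans hδρ
  obtain ⟨C, hC⟩ := ((hG.shift hρ 1).comp_linear (LinearMap.mulLeft ℝ (eBos (Sum.inl i)))) φ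
  have hcl : ∀ l, |c l| * (ρ ^ 2) ^ l ≤ C := fun l => hC y rfl l
  have hC0 : 0 ≤ C := le_trans (by positivity) (hcl 0)
  have hr1 : (δ ^ 2 / ρ ^ 2) < 1 := by
    rw [div_lt_one (by positivity)]; exact pow_lt_pow_left₀ hδρ hδ.le two_ne_zero
  have hgeo : Summable fun l => C * (δ ^ 2 / ρ ^ 2) ^ l :=
    (summable_geometric_of_lt_one (by positivity) hr1).mul_left C
  have hle : ∀ l, ∀ s : ℝ, t ^ 2 + s ^ 2 ≤ δ ^ 2 →
      ‖(-(t ^ 2 + s ^ 2)) ^ l * c l‖ ≤ C * (δ ^ 2 / ρ ^ 2) ^ l := by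
    intro l s hs
    have h1 : |c l| ≤ C / (ρ ^ 2) ^ l := by rw [le_div_iff₀ (by positivity)]; exact hcl l
    rw [norm_mul, norm_pow, norm_neg, Real.norm_eq_abs, Real.norm_eq_abs,
      abs_of_nonneg (by positivity), div_pow]
    calc _ ≤ (δ ^ 2) ^ l * (C / (ρ ^ 2) ^ l) := by gcongr
      _ = _ := by ring
  have hsm : ∀ s : ℝ, t ^ 2 + s ^ 2 ≤ δ ^ 2 → Summable fun l => (-(t ^ 2 + s ^ 2)) ^ l * c l :=
    fun s hs => Summable.of_norm_bounded hgeo fun l => hle l s hs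
  have hopen : ∀ᶠ s : ℝ in 𝓝 0, t ^ 2 + s ^ 2 < δ ^ 2 := by
    have hc : ContinuousAt (fun s : ℝ => t ^ 2 + s ^ 2) 0 := by fun_prop
    exact hc.eventually_lt continuousAt_const (by simpa using htδ)
  have hQc : ContinuousAt Q 0 := by
    have : ContinuousOn Q {s | t ^ 2 + s ^ 2 ≤ δ ^ 2} :=
      continuousOn_tsum (fun l => by fun_prop) hgeo fun l s hs => hle l s hs
    exact this.continuousAt (hopen.mono fun s hs => le_of_lt hs)
  have hz0 : z + (0 : ℝ) • v = z := by simp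
  have hzΩ : z ∈ Ω := by
    have := (hnear (z + (0 : ℝ) • v) (hzy 0) (by rw [hn]; simpa using htδ.le)).1
    rwa [hz0] at this
  have hD : HasDerivAt (fun s : ℝ => φ (body (S (z + s • v))))
      (dirDeriv v (fun z => φ (body (S z))) z) 0 := by
    have := hasDerivAt_along hΩ hcd z v (t := 0) (by rwa [hz0])
    rwa [hz0] at this
  have hval := HasDerivAt.eq_of_sub_neg hD hQc (hopen.mono fun s hs => ?_)
  · change HasSum _ (dirDeriv v (fun z => φ (body (S z))) z)
    rw [hval]
    have h1 : HasSum (fun l => (-(t ^ 2)) ^ l * c l) (Q 0) := by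
      have := (hsm 0 (by simpa using htδ.le)).hasSum
      simpa [hQ] using this
    have h2 := HasSum.even_add_odd (f := fun k => t ^ k * if Even k then
      φ (eBos (Sum.inl i₀) ^ k * (eBos (Sum.inl i) * F (k + 1) y)) else 0) (m := Q 0) (m' := 0)
      ?_ ?_
    · rwa [add_zero] at h2
    · refine hasSum_of_eq h1 fun l => ?_
      simp only [even_two_mul, if_true, hc]
      rw [eBos_pow_even, smul_mul_assoc, one_mul, map_smul, smul_eq_mul, neg_pow (t ^ 2), pow_mul]
      ring
    · simp
  · have hp := (hnear (z + s • v) (hzy s) (by rw [hn]; exact hs.le)).2 (φ ∘ₗ body.toLinearMap)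
    have hm := (hnear (z + (-s) • v) (hzy (-s)) (by rw [hn, neg_sq]; exact hs.le)).2
      (φ ∘ₗ body.toLinearMap)
    have hsub := hp.sub hm
    have hX : ∀ s : ℝ, (bosX (z + s • v) : Val m n p q) = bosX z + s • eBos (Sum.inl i) :=
      fun s => bosX_add_smul_single _ _ _
    have hterm : ∀ (s : ℝ) (j : ℕ), (φ ∘ₗ body.toLinearMap) (ckTerm F j (z + s • v)) =
        φ (bosX (z + s • v) ^ j * F j y) := fun s j => by
      change φ (body (ckTerm F j (z + s • v))) = _
      rw [body_ckTerm (by rwa [hzy]), hzy]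
    have hodd := hasSum_of_hasSum_odd hsub (a := fun k => if Even k then
      2 * s * ((-(t ^ 2 + s ^ 2)) ^ (k / 2) * c (k / 2)) else 0) (fun l => ?_) (fun l => ?_)
      (fun l => by simp)
    · have hev := (hsm s hs.le).hasSum.mul_left (2 * s)
      have h2 := HasSum.even_add_odd (f := fun k => if Even k then
        2 * s * ((-(t ^ 2 + s ^ 2)) ^ (k / 2) * c (k / 2)) else 0) (m := 2 * s * Q s) (m' := 0)
        (by simpa [hQ] using hev) (by simp)
      rw [add_zero] at h2
      exact hodd.unique h2
    · simp only [hterm]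
      rw [bosX_pow_even, bosX_pow_even, hn, hn, neg_sq, sub_self]
    · simp only [hterm, even_two_mul, if_true]
      rw [pow_succ (bosX _), pow_succ (bosX _), bosX_pow_even, bosX_pow_even, hn, hn, neg_sq, hX, hX,
        show 2 * l / 2 = l by omega]
      simp only [smul_mul_assoc, one_mul, add_mul, map_smul, map_add, smul_eq_mul, neg_mul, hc]
      ring

end TaylorCoefficients

/-! ### The recurrence for monogenic series, when `x` has bosonic coordinates -/

section MonogenicRecurrence

lemma isUnit_eBos {I J : Type} [DecidableEq I] [DecidableEq J] (i : I) :
    IsUnit (eBos i : SuperAlg I J) :=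
  ⟨⟨eBos i, -eBos i, by rw [mul_neg, eBos_sq, neg_neg], by rw [neg_mul, eBos_sq, neg_neg]⟩, rfl⟩

lemma analyticDirac_apply {I J I' J' : Type} [DecidableEq I] [DecidableEq J] [DecidableEq I']
    [Fintype I'] [Fintype J'] {U : Set (I' → ℝ)} (hU : IsOpen U) (ι : I' → I) (κ : J' → J)
    (G : analyticFunctions U (SuperAlg I J)) (y : I' → ℝ) :
    (analyticDirac hU ι κ G).1 y =
      fermDirac κ (G.1 y) - ∑ i, eBos (ι i) * (pderiv hU i G).1 y := by
  simp only [analyticDirac, LinearMap.sub_apply, LinearMap.sum_apply, Submodule.coe_sub,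
    AddSubmonoidClass.coe_finsetSum, Pi.sub_apply, Finset.sum_apply, Module.End.mul_apply,
    postEnd_apply, LinearMap.mulLeft_apply]

variable {m n p q : ℕ} {Ωp : Set (Fin p → ℝ)} {F : ℕ → (Fin p → ℝ) → Val m n p q}
  {Ω : Set (Pt m p)} {S : Pt m p → Val m n p q}

/-- The body of the equation `∂_x S = -∂_y S`, tested against a linear functional. -/
lemma dual_body_dirac_eq (hΩ : IsOpen Ω) (hS : IsSmooth Ω S)
    (hmono : ∀ z ∈ Ω, diracX S z + diracY S z = 0) (φ : Module.Dual ℝ (Val m n p q)) :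
    Set.EqOn
      (fun z => φ (body (fermDirac Sum.inl (S z))) - ∑ i : Fin m,
        dirDeriv (Pi.single (Sum.inl i) 1)
          (fun z => (φ ∘ₗ LinearMap.mulLeft ℝ (eBos (Sum.inl i))) (body (S z))) z)
      (fun z => ∑ i : Fin p, dirDeriv (Pi.single (Sum.inr i) 1)
          (fun z => (φ ∘ₗ LinearMap.mulLeft ℝ (eBos (Sum.inr i))) (body (S z))) z -
        (φ ∘ₗ fermDirac Sum.inr) (body (S z))) Ω := by
  intro z hz
  have hd : ∀ i : Fin m ⊕ Fin p, dirDeriv (Pi.single i 1)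
      (fun z => (φ ∘ₗ LinearMap.mulLeft ℝ (eBos i)) (body (S z))) z =
        φ (body (eBos i * partialDeriv i S z)) := by
    intro i
    rw [map_mul, body_eBos]
    exact (hS.dual_partialDeriv hΩ i hz
      ((φ ∘ₗ LinearMap.mulLeft ℝ (eBos i)) ∘ₗ body.toLinearMap)).symm
  have h := congrArg (fun v => φ (body v)) (hmono z hz)
  simp only [diracX, diracY, superDirac, map_add, map_sub, map_sum, map_zero] at h
  simp only [hd]
  simp only [LinearMap.comp_apply, fermDirac_inr_body]
  simp only [fermDirac_apply, map_smul, map_sum, map_sub] at h ⊢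
  linarith

/-- The Taylor coefficients of `∂_{y_i} S` along the line `t e`: the derivative in `y_i` may be taken
after those in `t`, and thus of the Taylor coefficient `e^k F_k`. -/
lemma iterate_dirDeriv_inr (i₀ : Fin m) (hΩp : IsOpen Ωp) (hΩ : IsOpen Ω)
    (hΩ_nhd : ∀ y ∈ Ωp, Sum.elim (0 : Fin m → ℝ) y ∈ Ω)
    (hS : IsSmooth Ω S) (hsum : ∀ z ∈ Ω, ConvergesAt (ckTerm F) z (S z))
    {f : ℕ → analyticFunctions Ωp (Val m n p q)} (hf : ∀ j, ∀ y ∈ Ωp, F j y = (f j).1 y)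
    (hb : ∀ j, ∀ y ∈ Ωp, body (F j y) = F j y) (φ : Module.Dual ℝ (Val m n p q)) (k : ℕ)
    (i : Fin p) {y : Fin p → ℝ} (hy : y ∈ Ωp) :
    (dirDeriv (Pi.single (Sum.inl i₀) 1))^[k]
        (dirDeriv (Pi.single (Sum.inr i) 1) fun z => φ (body (S z)))
        (Sum.elim (0 : Fin m → ℝ) y) =
      k.factorial * φ (eBos (Sum.inl i₀) ^ k * (pderiv hΩp i (f k)).1 y) := by
  have hcd : ContDiffOn ℝ ∞ (fun z => φ (body (S z))) Ω :=
    hS.contDiffOn_dual (φ ∘ₗ body.toLinearMap)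
  have h0 := hΩ_nhd y hy
  rw [iterate_dirDeriv_dirDeriv hΩ hcd _ _ k h0]
  set H := (dirDeriv (Pi.single (Sum.inl i₀) 1 : Pt m p))^[k]
    (fun z => φ (body (S z))) with hH
  set ψ : Module.Dual ℝ (Val m n p q) :=
    (k.factorial : ℝ) • (φ ∘ₗ LinearMap.mulLeft ℝ (eBos (Sum.inl i₀) ^ k)) with hψ
  have hHy : ∀ y ∈ Ωp, H (Sum.elim (0 : Fin m → ℝ) y) = ψ ((f k).1 y) := by
    intro y hy
    obtain ⟨ρ, δ, hδ, -, -, hnear⟩ :=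
      exists_hasSum_near i₀ hΩ hsum (hΩ_nhd y hy) fun j => hb j y hy
    rw [← hf k y hy]
    exact iterate_dirDeriv_body i₀ hΩ hS (fun j => hb j y hy) hδ hnear φ k
  -- The function `t ↦ H (0, y + t e_i)` is differentiated in two ways.
  have h1 : HasDerivAt (fun t : ℝ => H (Sum.elim (0 : Fin m → ℝ) y + t • Pi.single (Sum.inr i) 1))
      (dirDeriv (Pi.single (Sum.inr i) 1) H (Sum.elim (0 : Fin m → ℝ) y)) 0 := by
    have := hasDerivAt_along hΩ (contDiffOn_iterate_dirDeriv hΩ hcd (Pi.single (Sum.inl i₀) 1) k)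
      (Sum.elim (0 : Fin m → ℝ) y) (Pi.single (Sum.inr i) 1) (t := 0) (by simpa using h0)
    simpa using this
  have h2 : HasDerivAt (fun t : ℝ => ψ ((f k).1 (y + t • Pi.single i 1)))
      (ψ ((pderiv hΩp i (f k)).1 y)) 0 := by
    rw [dual_pderiv hΩp i (f k) ψ hy]
    have h3 : HasDerivAt (fun t : ℝ => y + t • (Pi.single i 1 : Fin p → ℝ)) (Pi.single i 1) 0 := by
      simpa using ((hasDerivAt_id (0 : ℝ)).smul_const (Pi.single i 1 : Fin p → ℝ)).const_add y
    have h4 : HasFDerivAt (fun y => ψ ((f k).1 y)) (fderiv ℝ (fun y => ψ ((f k).1 y)) y)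
        (y + (0 : ℝ) • (Pi.single i 1 : Fin p → ℝ)) := by
      rw [zero_smul, add_zero]
      exact (analyticOnNhd_dual hΩp (f k).2 ψ y hy).differentiableAt.hasFDerivAt
    exact h4.comp_hasDerivAt (0 : ℝ) h3
  refine h1.unique (h2.congr_of_eventuallyEq ?_)
  have h5 : ∀ᶠ t : ℝ in 𝓝 0, y + t • (Pi.single i 1 : Fin p → ℝ) ∈ Ωp := by
    have : ContinuousAt (fun t : ℝ => y + t • (Pi.single i 1 : Fin p → ℝ)) 0 := by fun_prop
    exact this (hΩp.mem_nhds (by simpa using hy))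
  refine h5.mono fun t ht => ?_
  have h6 : Sum.elim (0 : Fin m → ℝ) y + t • (Pi.single (Sum.inr i) 1 : Pt m p) =
      Sum.elim (0 : Fin m → ℝ) (y + t • (Pi.single i 1 : Fin p → ℝ)) := by
    ext (j | j)
    · simp
    · by_cases hj : j = i
      · subst hj; simp
      · simp [hj]
  simp only [h6]
  exact hHy _ ht

/-- The coefficients of a monogenic series satisfy the recurrence. Both sides of
`∂_x S = -∂_y S` are expanded along the line spanned by one basis vector `e`. -/
theorem isCKSequence_of_monogenic (i₀ : Fin m) (hΩp : IsOpen Ωp) (hΩ : IsOpen Ω)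
    (hΩ_nhd : ∀ y ∈ Ωp, Sum.elim (0 : Fin m → ℝ) y ∈ Ω)
    (hS : IsSmooth Ω S) (hsum : ∀ z ∈ Ω, ConvergesAt (ckTerm F) z (S z))
    (hmono : ∀ z ∈ Ω, diracX S z + diracY S z = 0)
    {f : ℕ → analyticFunctions Ωp (Val m n p q)} (hf : ∀ j, ∀ y ∈ Ωp, F j y = (f j).1 y)
    (hb : ∀ j, ∀ y ∈ Ωp, body (F j y) = F j y) :
    IsCKSequence (superdim m n) (analyticDirac hΩp Sum.inr Sum.inr) f := by
  intro k
  refine analyticFunctions_ext fun y hy =>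
    ((isUnit_eBos (Sum.inl i₀)).pow k).mul_left_cancel (eq_of_forall_dual fun φ => ?_)
  set e : Val m n p q := eBos (Sum.inl i₀) with he
  have hby : ∀ j, body (F j y) = F j y := fun j => hb j y hy
  have h0 := hΩ_nhd y hy
  obtain ⟨ρ, δ, hδ, hδρ, hG, hnear⟩ := exists_hasSum_near i₀ hΩ hsum h0 hby
  have hcd : ∀ ψ : Module.Dual ℝ (Val m n p q), ContDiffOn ℝ ∞ (fun z => ψ (body (S z))) Ω :=
    fun ψ => hS.contDiffOn_dual (ψ ∘ₗ body.toLinearMap)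
  have hcd' : ∀ (i : Fin m ⊕ Fin p) (ψ : Module.Dual ℝ (Val m n p q)),
      ContDiffOn ℝ ∞ (dirDeriv (Pi.single i 1) fun z => ψ (body (S z))) Ω :=
    fun i ψ => contDiffOn_dirDeriv hΩ (hcd ψ) _
  have hmain := iterate_dirDeriv_congr hΩ (Pi.single (Sum.inl i₀) 1) k
    (dual_body_dirac_eq hΩ hS hmono φ) h0
  have hcdf : ContDiffOn ℝ ∞ (fun z => φ (body (fermDirac Sum.inl (S z)))) Ω :=
    hS.contDiffOn_dual (φ ∘ₗ body.toLinearMap ∘ₗ fermDirac Sum.inl)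
  rw [iterate_dirDeriv_sub hΩ hcdf
      (ContDiffOn.sum fun i _ => hcd' _ _) _ k h0,
    iterate_dirDeriv_sub hΩ (ContDiffOn.sum fun i _ => hcd' _ _) (hcd _) _ k h0] at hmain
  simp only [iterate_dirDeriv_sum _ hΩ (fun i _ => hcd' _ _) _ k h0] at hmain
  set X := φ (e ^ k * F (k + 1) y) with hX
  -- The four contributions: the fermionic and the bosonic part of `∂_x`, then those of `∂_y`.
  have h1 := iterate_dirDeriv_body_fermDirac i₀ hΩ hS hby hδ hnear φ k
  have h2 : ∀ i : Fin m, (dirDeriv (Pi.single (Sum.inl i₀) 1))^[k]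
      (dirDeriv (Pi.single (Sum.inl i) 1)
        fun z => (φ ∘ₗ LinearMap.mulLeft ℝ (eBos (Sum.inl i))) (body (S z)))
        (Sum.elim (0 : Fin m → ℝ) y) =
      k.factorial * ((if Even k then -X else 0) +
        if i = i₀ then -(k + 1) * X - (if Even k then -X else 0) else 0) := by
    intro i
    by_cases hi : i = i₀
    · subst hi
      rw [← Function.iterate_succ_apply, iterate_dirDeriv_body i hΩ hS hby hδ hnear, if_pos rfl,
        LinearMap.comp_apply, LinearMap.mulLeft_apply, pow_succ', mul_assoc (eBos _), ← mul_assoc,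
        eBos_sq, neg_one_mul, map_neg, Nat.factorial_succ]
      push_cast
      ring
    · rw [iterate_dirDeriv_dirDeriv_body hi hΩ hS hby hδ hδρ hG hnear, if_neg hi, add_zero]
      congr 1
      split_ifs with hk
      · obtain ⟨l, rfl⟩ := even_iff_exists_two_mul.mp hk
        rw [hX, he, LinearMap.comp_apply, LinearMap.mulLeft_apply, eBos_pow_even, smul_mul_assoc,
          smul_mul_assoc, one_mul, one_mul, mul_smul_comm, ← mul_assoc, eBos_sq, neg_one_mul,
          smul_neg, map_neg]
      · rfl
  have h3 := iterate_dirDeriv_body i₀ hΩ hS hby hδ hnear (φ ∘ₗ fermDirac Sum.inr) k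
  have h4 := fun i : Fin p => iterate_dirDeriv_inr i₀ hΩp hΩ hΩ_nhd hS hsum hf hb
    (φ ∘ₗ LinearMap.mulLeft ℝ (eBos (Sum.inr i))) k i hy
  -- `∂_y` is recombined and the constant `e ^ k` pulled out of it.
  have h5 : φ (fermDirac Sum.inr (e ^ k * F k y)) -
      ∑ i : Fin p, φ (eBos (Sum.inr i) * (e ^ k * (pderiv hΩp i (f k)).1 y)) =
      (-1) ^ k * φ (e ^ k * (analyticDirac hΩp Sum.inr Sum.inr (f k)).1 y) := by
    have h6 := congrArg (fun G => φ (G.1 y)) (analyticDirac_mulLeft_pow hΩp (ι := Sum.inr)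
      (κ := Sum.inr) (a := e) (fun g => fermDirac_eBos_mul _ _ _)
      (fun i => eBos_anticomm Sum.inr_ne_inl) k (f k))
    have hm : ∀ i, pderiv hΩp i (postEnd Ωp _ (LinearMap.mulLeft ℝ (e ^ k)) (f k)) =
        postEnd Ωp _ (LinearMap.mulLeft ℝ (e ^ k)) (pderiv hΩp i (f k)) :=
      fun i => pderiv_postcomp hΩp i _ _
    simp only [analyticDirac_apply, hm, postEnd_apply, LinearMap.mulLeft_apply, map_sub, map_sum,
      Submodule.coe_smul, Pi.smul_apply, map_smul, smul_eq_mul] at h6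
    rw [hf k y hy, h6, analyticDirac_apply]
    simp only [mul_sub, map_sub, Finset.mul_sum, map_sum]
  rw [h1, h3] at hmain
  simp only [h2, h4] at hmain
  rw [← Finset.mul_sum, ← Finset.mul_sum, ← mul_sub, ← mul_sub, Finset.sum_add_distrib,
    Finset.sum_ite_eq', if_pos (Finset.mem_univ _), Finset.sum_const, Finset.card_univ,
    Fintype.card_fin, nsmul_eq_mul] at hmain
  have hmain' := mul_left_cancel₀ (by exact_mod_cast k.factorial_ne_zero) hmain
  simp only [LinearMap.comp_apply, LinearMap.mulLeft_apply] at hmain'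
  simp only [Submodule.coe_smul, Pi.smul_apply, mul_smul_comm, map_smul, smul_eq_mul, ← hf _ y hy]
  rw [← hX, pow_succ, mul_neg_one, neg_mul, ← h5]
  have hM : ((superdim m n : ℤ) : ℝ) = m - 2 * n := by simp [superdim]
  rw [dimFactor, hM]
  have hpar : Even (k + 1) ↔ ¬ Even k := Nat.even_add_one
  by_cases hk : Even k
  · rw [if_neg (by rw [hpar]; simpa using hk)]
    simp only [hk, if_true] at hmain'
    push_cast
    linarith
  · rw [if_pos (hpar.mpr hk)]
    simp only [hk, if_false] at hmain'
    push_cast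
    linarith

end MonogenicRecurrence

/-! ### The recurrence for monogenic series, when `x` is purely fermionic -/

section FermionicRecurrence

variable {m n p q : ℕ}

lemma fermVec_inl_sq : (fermVec Sum.inl ^ 2 : Val m n p q) = fermNil Sum.inl := by
  rw [pow_two, fermVec_sq Sum.inl_injective]

lemma fermVec_inl_pow_eq_zero {j : ℕ} (hj : 2 * n < j) :
    (fermVec Sum.inl ^ j : Val m n p q) = 0 := by
  have h : (fermVec Sum.inl ^ (2 * n + 1) : Val m n p q) = 0 := by
    rw [pow_succ, pow_mul, fermVec_inl_sq]
    simpa using fermNil_pow_card_mul_fermVec (I := Fin m ⊕ Fin p) (κ := (Sum.inl : Fin n → Fin n ⊕ Fin q))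
  rw [show j = (2 * n + 1) + (j - (2 * n + 1)) by omega, pow_add, h, zero_mul]

/-- On powers of a purely fermionic vector, `∂_x` acts by the factors of the recurrence. -/
lemma fermDirac_fermVec_pow_succ_mul {g : Val m n p q} (hg : body g = g) (j : ℕ) :
    fermDirac Sum.inl (fermVec Sum.inl ^ (j + 1) * g) =
      dimFactor (-2 * (n : ℤ)) (j + 1) • (fermVec Sum.inl ^ j * g) := by
  induction j using Nat.twoStepInduction with
  | zero =>
    rw [pow_zero, zero_add, pow_one, one_mul, fermDirac_fermVec_mul_of_body hg]
    simp [dimFactor]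
  | one =>
    rw [fermVec_inl_sq, fermDirac_fermNil_mul Sum.inl_injective, fermDirac_inl_eq_zero hg]
    simp [dimFactor]
  | more j ih _ =>
    have h : (fermVec Sum.inl ^ (j + 2 + 1) : Val m n p q) =
        fermNil Sum.inl * fermVec Sum.inl ^ (j + 1) := by
      rw [← fermVec_inl_sq, ← pow_add]; congr 1; ring
    have h' : (fermVec Sum.inl ^ (j + 2) : Val m n p q) =
        fermNil Sum.inl * fermVec Sum.inl ^ j := by
      rw [← fermVec_inl_sq, ← pow_add]; congr 1; ring
    rw [h, mul_assoc, fermDirac_fermNil_mul Sum.inl_injective, ih, mul_smul_comm, ← mul_assoc,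
      ← mul_assoc, ← h', ← pow_succ', show j + 1 + 1 = j + 2 from rfl]
    have hc : dimFactor (-2 * (n : ℤ)) (j + 2 + 1) = 2 + dimFactor (-2 * (n : ℤ)) (j + 1) := by
      rw [dimFactor, dimFactor]
      have : Even (j + 2 + 1) ↔ Even (j + 1) := by simp [Nat.even_add_one]
      simp only [this]
      split_ifs <;> push_cast <;> ring
    rw [hc, add_smul]

/-- For `M = -2n` the first factor that vanishes is `c_{2n+1}`. -/
lemma dimFactor_ne_zero {j : ℕ} (hj0 : j ≠ 0) (hj : j ≤ 2 * n) :
    dimFactor (-2 * (n : ℤ)) j ≠ 0 := by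
  rcases Nat.even_or_odd' j with ⟨l, rfl | rfl⟩
  · rw [dimFactor_even]
    have : l ≠ 0 := by omega
    simpa using this
  · rw [dimFactor_odd]
    have h : ((2 * l + -2 * n : ℤ) : ℝ) ≠ 0 := by
      rw [Int.cast_ne_zero]; omega
    push_cast at h ⊢
    exact h

/-- The powers of the purely fermionic vector are independent over the functions of `y`: the
derivation `fermDirac` lowers the powers, and `body` isolates the lowest one. -/
lemma eq_zero_of_sum_fermVec_pow_mul {N : ℕ} (hN : N ≤ 2 * n) :
    ∀ {H : ℕ → Val m n p q}, (∀ j, body (H j) = H j) →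
      ∑ j ∈ Finset.range (N + 1), fermVec Sum.inl ^ j * H j = 0 → ∀ j ≤ N, H j = 0 := by
  induction N with
  | zero =>
    intro H _ h j hj
    rw [Nat.le_zero.mp hj]
    simpa using h
  | succ N ih =>
    intro H hb h
    have h0 : H 0 = 0 := by
      have := congrArg body h
      rw [map_sum, Finset.sum_range_succ', map_zero] at this
      simpa [body_fermVec_inl, hb] using this
    have h1 := congrArg (fermDirac Sum.inl) h
    rw [map_sum, Finset.sum_range_succ', map_zero, h0, mul_zero, map_zero, add_zero] at h1
    simp only [fermDirac_fermVec_pow_succ_mul (hb _), ← mul_smul_comm] at h1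
    have h2 := ih (by omega) (H := fun j => dimFactor (-2 * (n : ℤ)) (j + 1) • H (j + 1))
      (fun j => by rw [map_smul, hb]) h1
    intro j hj
    rcases j with - | j
    · exact h0
    · exact (smul_eq_zero.mp (h2 j (by omega))).resolve_left
        (dimFactor_ne_zero (by omega) (by omega))

/-- `∂_y` preserves the functions that do not involve the fermionic variables of `x`. -/
lemma body_analyticDirac {Ωp : Set (Fin p → ℝ)} (hΩp : IsOpen Ωp)
    {f : analyticFunctions Ωp (Val m n p q)} (hf : ∀ y ∈ Ωp, body (f.1 y) = f.1 y)
    (y : Fin p → ℝ) :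
    body ((analyticDirac hΩp Sum.inr Sum.inr f).1 y) =
      (analyticDirac hΩp Sum.inr Sum.inr f).1 y := by
  have h1 : postEnd Ωp _ body.toLinearMap f = f := analyticFunctions_ext hf
  have h2 : ∀ i, body ((pderiv hΩp i f).1 y) = (pderiv hΩp i f).1 y := fun i => by
    have h3 := pderiv_postcomp hΩp i (body (I := Fin m ⊕ Fin p)).toLinearMap f
    change pderiv hΩp i (postEnd Ωp _ body.toLinearMap f) = _ at h3
    rw [h1] at h3
    exact (congrFun (congrArg Subtype.val h3) y).symm
  have h4 : body (f.1 y) = f.1 y := congrFun (congrArg Subtype.val h1) y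
  rw [analyticDirac_apply, map_sub, map_sum, ← fermDirac_inr_body, h4]
  simp only [map_mul, body_eBos, h2]

variable {Ωp : Set (Fin p → ℝ)} {F : ℕ → (Fin p → ℝ) → Val 0 n p q}
  {Ω : Set (Pt 0 p)} {S : Pt 0 p → Val 0 n p q}

lemma xVec_eq_fermVec (z : Pt 0 p) : (xVec z : Val 0 n p q) = fermVec Sum.inl := by
  rw [xVec_eq, bosX, bosVec]
  simp

lemma ConvergesAt.eq_sum_range {I A : Type} [AddCommGroup A] [Module ℝ A] {T : ℕ → (I → ℝ) → A}
    {z : I → ℝ} {s : A} (h : ConvergesAt T z s) {N : ℕ} (hN : ∀ j, N ≤ j → T j z = 0) :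
    s = ∑ j ∈ Finset.range N, T j z := by
  refine eq_of_forall_dual fun φ => ?_
  rw [map_sum]
  refine tendsto_nhds_unique (h φ) (tendsto_const_nhds.congr' ?_)
  filter_upwards [eventually_ge_atTop N] with N' hN'
  refine Finset.sum_subset (Finset.range_mono hN') fun j _ hj => ?_
  rw [hN j (by simpa using hj), map_zero]

/-- The coefficients of a monogenic polynomial in a purely fermionic vector satisfy the
recurrence, after those that multiply vanishing powers have been discarded. -/
theorem isCKSequence_of_monogenic_fermionic (hΩp : IsOpen Ωp)
    (hΩ_nhd : ∀ y ∈ Ωp, Sum.elim (0 : Fin 0 → ℝ) y ∈ Ω)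
    (hsum : ∀ z ∈ Ω, ConvergesAt (ckTerm F) z (S z))
    (hmono : ∀ z ∈ Ω, diracX S z + diracY S z = 0)
    {f : ℕ → analyticFunctions Ωp (Val 0 n p q)} (hf : ∀ j, ∀ y ∈ Ωp, F j y = (f j).1 y)
    (hb : ∀ j, ∀ y ∈ Ωp, body (F j y) = F j y) :
    IsCKSequence (-2 * (n : ℤ)) (analyticDirac hΩp Sum.inr Sum.inr)
      (fun j => if j ≤ 2 * n then f j else 0) := by
  set D := analyticDirac (I := Fin 0 ⊕ Fin p) (J := Fin n ⊕ Fin q) hΩp Sum.inr Sum.inr with hD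
  set w : Val 0 n p q := fermVec Sum.inl with hw
  have hΩ_mem : ∀ z : Pt 0 p, z ∘ Sum.inr ∈ Ωp → z ∈ Ω := fun z hz => by
    have h : z = Sum.elim (0 : Fin 0 → ℝ) (z ∘ Sum.inr) := by
      ext (i | i)
      · exact i.elim0
      · rfl
    rw [h]
    exact hΩ_nhd _ hz
  have hSz : ∀ z : Pt 0 p, z ∘ Sum.inr ∈ Ωp →
      S z = ∑ j ∈ Finset.range (2 * n + 1), w ^ j * (f j).1 (z ∘ Sum.inr) := fun z hz => by
    rw [(hsum z (hΩ_mem z hz)).eq_sum_range (N := 2 * n + 1) fun j hj => by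
      rw [ckTerm, xVec_eq_fermVec, fermVec_inl_pow_eq_zero hj, zero_mul]]
    refine Finset.sum_congr rfl fun j _ => ?_
    rw [ckTerm, xVec_eq_fermVec, liftY, hf j _ hz]
  set g : analyticFunctions Ωp (Val 0 n p q) :=
    ∑ j ∈ Finset.range (2 * n + 1), postEnd Ωp _ (LinearMap.mulLeft ℝ (w ^ j)) (f j) with hg
  have hgz : ∀ z : Pt 0 p, z ∘ Sum.inr ∈ Ωp → S z = g.1 (z ∘ Sum.inr) := fun z hz => by
    rw [hSz z hz, hg, AddSubmonoidClass.coe_finsetSum, Finset.sum_apply]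
    rfl
  have hDg : D g = ∑ j ∈ Finset.range (2 * n + 1),
      (-1 : ℝ) ^ j • postEnd Ωp _ (LinearMap.mulLeft ℝ (w ^ j)) (D (f j)) := by
    rw [hg, map_sum]
    exact Finset.sum_congr rfl fun j _ => analyticDirac_mulLeft_pow hΩp
      (fun g => fermDirac_fermVec_mul_of_disjoint (fun _ _ => Sum.inr_ne_inl) g)
      (fun i => eBos_mul_fermVec _ _) j (f j)
  have hfb : ∀ j, ∀ y ∈ Ωp, body ((f j).1 y) = (f j).1 y := fun j y hy => by
    rw [← hf j y hy, hb j y hy]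
  -- The coefficient of `w ^ j` in `(∂_x + ∂_y) S`; the top one has no contribution from `∂_x`.
  have hmain : ∀ y ∈ Ωp, ∀ j ≤ 2 * n,
      (if j + 1 ≤ 2 * n then dimFactor (-2 * (n : ℤ)) (j + 1) • (f (j + 1)).1 y else 0) +
        (-1 : ℝ) ^ j • (D (f j)).1 y = 0 := by
    intro y hy
    refine eq_zero_of_sum_fermVec_pow_mul le_rfl (fun j => ?_) ?_
    · rw [map_add, map_smul, body_analyticDirac hΩp (hfb j)]
      congr 1
      split_ifs
      · rw [map_smul, hfb _ y hy]
      · rw [map_zero]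
    · set z : Pt 0 p := Sum.elim (0 : Fin 0 → ℝ) y with hz
      have hzy : z ∘ Sum.inr = y := rfl
      have h1 := hmono z (hΩ_nhd y hy)
      rw [diracY_eq hΩp hgz z hy, diracX, superDirac, ← fermDirac_apply, Finset.univ_eq_empty,
        Finset.sum_empty, sub_zero, hSz z hy, ← hD, hDg, map_sum, Finset.sum_range_succ'] at h1
      simp only [hzy, fermDirac_fermVec_pow_succ_mul (hfb _ y hy), hw, pow_zero, one_mul,
        fermDirac_inl_eq_zero (hfb _ y hy), add_zero, AddSubmonoidClass.coe_finsetSum,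
        Finset.sum_apply, Submodule.coe_smul, Pi.smul_apply, postEnd_apply,
        LinearMap.mulLeft_apply] at h1
      simp only [mul_add, Finset.sum_add_distrib, mul_smul_comm]
      rw [Finset.sum_range_succ, if_neg (by omega), mul_zero, add_zero, ← h1]
      congr 1
      refine Finset.sum_congr rfl fun j hj => ?_
      rw [if_pos (by have := Finset.mem_range.mp hj; omega), mul_smul_comm]
  intro j
  refine analyticFunctions_ext fun y hy => ?_
  by_cases hj : j ≤ 2 * n
  · have h1 := hmain y hy j hj
    simp only [hj, if_true]
    split_ifs at h1 ⊢ with hj1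
    · rw [Submodule.coe_smul, Submodule.coe_smul, Pi.smul_apply, Pi.smul_apply,
        eq_neg_of_add_eq_zero_left h1, pow_succ, mul_neg_one, neg_smul]
    · rw [zero_add] at h1
      rw [Submodule.coe_smul, Submodule.coe_smul, Pi.smul_apply, Pi.smul_apply, pow_succ,
        mul_neg_one, neg_smul, h1]
      simp
  · simp only [hj, if_false, if_neg (show ¬ j + 1 ≤ 2 * n by omega), smul_zero, map_zero]

end FermionicRecurrence

/-! ### The coefficient sequence of a monogenic series -/

section CoefficientSequence

variable {m n p q : ℕ} {Ωp : Set (Fin p → ℝ)} {F : ℕ → (Fin p → ℝ) → Val m n p q}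
  {Ω : Set (Pt m p)} {S : Pt m p → Val m n p q}

/-- A monogenic series has coefficients that satisfy the recurrence. For `m = 0` the powers of `x`
beyond `x^{2n}` vanish, and their coefficients, about which nothing is known, are replaced by zero. -/
theorem exists_ckSequence (hΩp : IsOpen Ωp) (hF : ∀ j, IsAnalyticInY Ωp (F j)) (hΩ : IsOpen Ω)
    (hΩ_nhd : ∀ y ∈ Ωp, Sum.elim (0 : Fin m → ℝ) y ∈ Ω)
    (hS : IsSmooth Ω S) (hsum : ∀ z ∈ Ω, ConvergesAt (ckTerm F) z (S z))
    (hmono : ∀ z ∈ Ω, diracX S z + diracY S z = 0) :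
    ∃ f : ℕ → analyticFunctions Ωp (Val m n p q),
      IsCKSequence (superdim m n) (analyticDirac hΩp Sum.inr Sum.inr) f ∧
      (∀ j, ∀ y ∈ Ωp, body ((f j).1 y) = (f j).1 y) ∧
      (∀ j, ∀ z : Pt m p, z ∘ Sum.inr ∈ Ωp →
        ckTerm F j z = ckTerm (fun j y => (f j).1 y) j z) ∧
      ∀ j, m ≠ 0 ∨ j ≤ 2 * n → ∀ y ∈ Ωp, F j y = (f j).1 y := by
  choose f hf using fun j => (hF j).exists_analyticFunctions
  have hb : ∀ j, ∀ y ∈ Ωp, body (F j y) = F j y := fun j y hy => (hF j).body_eq hy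
  have hfb : ∀ j, ∀ y ∈ Ωp, body ((f j).1 y) = (f j).1 y := fun j y hy => by
    rw [← hf j y hy, hb j y hy]
  rcases Nat.eq_zero_or_pos m with rfl | hm
  · refine ⟨fun j => if j ≤ 2 * n then f j else 0, ?_, fun j y hy => ?_, fun j z hz => ?_,
      fun j hj y hy => ?_⟩
    · have := isCKSequence_of_monogenic_fermionic hΩp hΩ_nhd hsum hmono hf hb
      rwa [show superdim 0 n = -2 * (n : ℤ) by simp [superdim]]
    · dsimp only
      split_ifs
      · exact hfb j y hy
      · exact map_zero _
    · rw [ckTerm, ckTerm, xVec_eq_fermVec, liftY, liftY, hf j _ hz]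
      by_cases hj : j ≤ 2 * n
      · simp only [hj, if_true]
      · rw [fermVec_inl_pow_eq_zero (not_le.mp hj), zero_mul, zero_mul]
    · simp only [hj.resolve_left (by simp), if_true]
      exact hf j y hy
  · exact ⟨f, isCKSequence_of_monogenic ⟨0, hm⟩ hΩp hΩ hΩ_nhd hS hsum hmono hf hb, hfb,
      fun j z hz => by rw [ckTerm, ckTerm, liftY, liftY, hf j _ hz], fun j _ => hf j⟩

end CoefficientSequence

/-! ### Convergence on the whole domain of monogenicity -/

section Convergence

variable {m n p q : ℕ}

/-- The point `(c x, y)`. -/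
def scaleX (c : ℝ) (z : Pt m p) : Pt m p := Sum.elim (fun i => c * z (Sum.inl i)) (z ∘ Sum.inr)

lemma scaleX_one (z : Pt m p) : scaleX 1 z = z := by
  ext (i | i) <;> simp [scaleX]

lemma bosNormSq_scaleX (c : ℝ) (z : Pt m p) : bosNormSq (scaleX c z) = c ^ 2 * bosNormSq z := by
  simp [bosNormSq, scaleX, mul_pow, Finset.mul_sum]

lemma exists_one_lt_scaleX_mem {O : Set (Pt m p)} (hO : IsOpen O) {z : Pt m p} (hz : z ∈ O) :
    ∃ c : ℝ, 1 < c ∧ scaleX c z ∈ O := by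
  have hc : ContinuousAt (fun c : ℝ => scaleX c z) 1 := by
    refine continuousAt_pi.mpr ?_
    rintro (i | i)
    · change ContinuousAt (fun c : ℝ => c * z (Sum.inl i)) 1
      fun_prop
    · exact continuousAt_const
  have h1 : ∀ᶠ c : ℝ in 𝓝 1, scaleX c z ∈ O := hc (hO.mem_nhds (by simpa only [scaleX_one] using hz))
  obtain ⟨c, hc1, hc2⟩ :=
    ((h1.filter_mono nhdsWithin_le_nhds).and (self_mem_nhdsWithin (s := Set.Ioi (1 : ℝ)))).exists
  exact ⟨c, hc2, hc1⟩

variable {Ωp : Set (Fin p → ℝ)} {F : ℕ → (Fin p → ℝ) → Val m n p q}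
  {f : ℕ → analyticFunctions Ωp (Val m n p q)} {Ω : Set (Pt m p)}

/-- At each point of `Ω` the coefficients decay faster than `|x| ^ (-j)`: for `x ≠ 0` because the
series still converges slightly further out. -/
lemma exists_geomBound (hΩp : IsOpen Ωp) (hF : ∀ j, ∀ y ∈ Ωp, F j y = (f j).1 y)
    (hb : ∀ j, ∀ y ∈ Ωp, body (F j y) = F j y) {M : ℤ}
    (hf : IsCKSequence M (analyticDirac hΩp Sum.inr Sum.inr) f) (hΩ : IsOpen Ω)
    (hover : ∀ z ∈ Ω, z ∘ Sum.inr ∈ Ωp)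
    (hbd : ∀ z ∈ Ω, ∀ φ : Module.Dual ℝ (Val m n p q), ∃ C, ∀ j, |φ (ckTerm F j z)| ≤ C)
    {z : Pt m p} (hz : z ∈ Ω) :
    ∃ s, 0 < s ∧ √(bosNormSq z) < s ∧ GeomBound {z ∘ Sum.inr} F s := by
  have hy := hover z hz
  rcases (bosNormSq_nonneg z).eq_or_lt with h0 | h0
  · obtain ⟨s, hs, W, hW, -, hWb⟩ :=
      hf.exists_local_bound hΩp Sum.inr_injective Sum.inr_injective hy
    refine ⟨s, hs, by rwa [← h0, Real.sqrt_zero], fun φ => ?_⟩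
    obtain ⟨C, hC⟩ := hWb φ
    refine ⟨C, ?_⟩
    rintro _ rfl j
    rw [hF j _ hy]
    exact hC _ (mem_of_mem_nhds hW) j
  · obtain ⟨c, hc, hcz⟩ := exists_one_lt_scaleX_mem hΩ hz
    have hc0 : 0 < c := zero_lt_one.trans hc
    have hn := bosNormSq_scaleX c z
    have hlt : √(bosNormSq z) < √(bosNormSq (scaleX c z)) := by
      refine Real.sqrt_lt_sqrt h0.le ?_
      rw [hn]
      exact lt_mul_of_one_lt_left h0 (one_lt_pow₀ hc two_ne_zero)
    refine ⟨√(bosNormSq (scaleX c z)), (Real.sqrt_nonneg _).trans_lt hlt, hlt, ?_⟩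
    exact geomBound_of_ckTerm_bound (z := scaleX c z) (fun j => hb j _ hy)
      (by rw [hn]; positivity) (hbd _ hcz)

/-- One finite-dimensional space contains all products `x^i F_j` on `Ω`. Over each `y` the coefficients
are recovered from the terms at a point `(x, y)` of `Ω` with `x ≠ 0`. -/
lemma exists_xVec_pow_mul_coeff_mem (i₀ : Fin m) (hb : ∀ j, ∀ y ∈ Ωp, body (F j y) = F j y)
    (hΩ : IsOpen Ω) (hΩ_nhd : ∀ y ∈ Ωp, Sum.elim (0 : Fin m → ℝ) y ∈ Ω)
    (hover : ∀ z ∈ Ω, z ∘ Sum.inr ∈ Ωp) (hspan : FinitelySpanned (ckTerm F) Ω) :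
    ∃ V : Submodule ℝ (Val m n p q), FiniteDimensional ℝ V ∧
      ∀ z ∈ Ω, ∀ i j, xVec z ^ i * F j (z ∘ Sum.inr) ∈ V := by
  obtain ⟨V₀, hV₀, hT⟩ := hspan
  obtain ⟨V₁, hV₁, hV₁F⟩ := exists_coeff_mem (F := F) (Module.Finite.iff_fg.mp hV₀)
  obtain ⟨V₂, hV₂, hV₂x⟩ := exists_xVec_pow_mul_mem hV₁
  refine ⟨V₂, hV₂, fun z hz i j => hV₂x z i _ ?_⟩
  have hy := hover z hz
  obtain ⟨ε, hε, hbox⟩ := exists_box_subset hΩ (hΩ_nhd _ hy)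
  set z₁ : Pt m p := Sum.elim (Pi.single i₀ (ε / 2)) (z ∘ Sum.inr) with hz₁
  have hn₁ : bosNormSq z₁ = (ε / 2) ^ 2 := bosNormSq_elim_single i₀ _ _
  have hmem : z₁ ∈ Ω := hbox z₁
    (by rw [hn₁]; exact pow_lt_pow_left₀ (half_lt_self hε) (by positivity) two_ne_zero)
    (Metric.mem_ball_self hε)
  exact hV₁F z₁ (fun j => hb j _ hy) (by rw [hn₁]; positivity) (fun j => hT j z₁ hmem) j

lemma GeomBound.mono {A : Type} {Y : Type*} [AddCommGroup A] [Module ℝ A] {W W' : Set Y} {b : ℕ → Y → A}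
    {T : ℝ} (h : GeomBound W b T) (hW : W' ⊆ W) : GeomBound W' b T := fun φ => by
  obtain ⟨C, hC⟩ := h φ
  exact ⟨C, fun y hy => hC y (hW hy)⟩

/-- The even-indexed parts `∑ x^{2j} F_{2j+d}` of all shifted series converge on `Ω`. -/
lemma exists_hasSum_xVec_pow_even (hΩp : IsOpen Ωp) (hF : ∀ j, ∀ y ∈ Ωp, F j y = (f j).1 y)
    (hb : ∀ j, ∀ y ∈ Ωp, body (F j y) = F j y) {M : ℤ}
    (hf : IsCKSequence M (analyticDirac hΩp Sum.inr Sum.inr) f) (hΩ : IsOpen Ω)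
    (hover : ∀ z ∈ Ω, z ∘ Sum.inr ∈ Ωp)
    (hbd : ∀ z ∈ Ω, ∀ φ : Module.Dual ℝ (Val m n p q), ∃ C, ∀ j, |φ (ckTerm F j z)| ≤ C)
    {V : Submodule ℝ (Val m n p q)} (hV : FiniteDimensional ℝ V)
    (hVx : ∀ z ∈ Ω, ∀ i j, xVec z ^ i * F j (z ∘ Sum.inr) ∈ V) {z : Pt m p} (hz : z ∈ Ω) (d : ℕ) :
    ∃ s : Val m n p q, ∀ φ : Module.Dual ℝ (Val m n p q),
      HasSum (fun j => φ (xVec z ^ (2 * j) * F (2 * j + d) (z ∘ Sum.inr))) (φ s) := by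
  obtain ⟨s, hs, hlt, hG⟩ := exists_geomBound hΩp hF hb hf hΩ hover hbd hz
  obtain ⟨T, hT, hGT⟩ := hG.xVec_pow_even hs (Real.sqrt_nonneg _) hlt d
  refine exists_hasSum_of_finiteDimensional hV (fun j => hVx z hz _ _) fun φ => ?_
  refine GeomBound.summable (hGT.mono (W' := {z}) ?_) hT φ
  rintro _ rfl
  exact ⟨(Real.sq_sqrt (bosNormSq_nonneg _)).ge, rfl⟩

/-- The sums `s d = ∑ x^{2j} F_{2j+d}` as functions on `Ω`, together with a finite-dimensional space
that contains all the terms. -/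
lemma exists_evenPart (i₀ : Fin m) (hΩp : IsOpen Ωp) (hF : ∀ j, ∀ y ∈ Ωp, F j y = (f j).1 y)
    (hb : ∀ j, ∀ y ∈ Ωp, body (F j y) = F j y) {M : ℤ}
    (hf : IsCKSequence M (analyticDirac hΩp Sum.inr Sum.inr) f) (hΩ : IsOpen Ω)
    (hΩ_nhd : ∀ y ∈ Ωp, Sum.elim (0 : Fin m → ℝ) y ∈ Ω)
    (hover : ∀ z ∈ Ω, z ∘ Sum.inr ∈ Ωp) {S : Pt m p → Val m n p q}
    (hsum : ConvergesOn (ckTerm F) S Ω) :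
    ∃ V : Submodule ℝ (Val m n p q), FiniteDimensional ℝ V ∧
      (∀ z ∈ Ω, ∀ i j, xVec z ^ i * F j (z ∘ Sum.inr) ∈ V) ∧
      ∃ s : ℕ → Pt m p → Val m n p q, ∀ d, ∀ z ∈ Ω, ∀ φ : Module.Dual ℝ (Val m n p q),
        HasSum (fun j => φ (xVec z ^ (2 * j) * F (2 * j + d) (z ∘ Sum.inr))) (φ (s d z)) := by
  classical
  obtain ⟨V, hV, hVx⟩ := exists_xVec_pow_mul_coeff_mem i₀ hb hΩ hΩ_nhd hover hsum.1
  have hex : ∀ (d : ℕ) (z : Pt m p), ∃ s : Val m n p q, z ∈ Ω → ∀ φ : Module.Dual ℝ (Val m n p q),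
      HasSum (fun j => φ (xVec z ^ (2 * j) * F (2 * j + d) (z ∘ Sum.inr))) (φ s) := fun d z => by
    by_cases hz : z ∈ Ω
    · obtain ⟨s, hs⟩ := exists_hasSum_xVec_pow_even hΩp hF hb hf hΩ hover
        (fun z hz => (hsum.2 z hz).exists_bound) hV hVx hz d
      exact ⟨s, fun _ => hs⟩
    · exact ⟨0, fun h => absurd h hz⟩
  choose s hs using hex
  exact ⟨V, hV, hVx, s, hs⟩

/-- Splitting of the series after `L` terms and by parity. -/
lemma ConvergesAt.eq_sum_add {z : Pt m p} {S : Val m n p q} (hS : ConvergesAt (ckTerm F) z S)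
    {s : ℕ → Val m n p q} (hs : ∀ (d : ℕ) (φ : Module.Dual ℝ (Val m n p q)),
      HasSum (fun j => φ (xVec z ^ (2 * j) * F (2 * j + d) (z ∘ Sum.inr))) (φ (s d))) (L : ℕ) :
    S = ∑ j ∈ Finset.range L, ckTerm F j z + xVec z ^ L * (s L + xVec z * s (L + 1)) := by
  refine eq_of_forall_dual fun φ => ?_
  have h1 := hs L (φ ∘ₗ LinearMap.mulLeft ℝ (xVec z ^ L))
  have h2 := hs (L + 1) (φ ∘ₗ LinearMap.mulLeft ℝ (xVec z ^ L * xVec z))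
  have h3 := HasSum.even_add_odd (f := fun j => φ (ckTerm F (j + L) z))
    (hasSum_of_eq h1 fun j => ?_) (hasSum_of_eq h2 fun j => ?_)
  · have h4 := (hasSum_nat_add_iff (f := fun j => φ (ckTerm F j z)) L).mp h3
    rw [tendsto_nhds_unique (hS φ) h4.tendsto_sum_nat, map_add, map_sum]
    simp only [LinearMap.comp_apply, LinearMap.mulLeft_apply, mul_add, map_add, mul_assoc]
    ring
  · simp only [LinearMap.comp_apply, LinearMap.mulLeft_apply]
    rw [ckTerm, liftY, ← mul_assoc, ← pow_add, add_comm L]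
  · simp only [LinearMap.comp_apply, LinearMap.mulLeft_apply]
    rw [ckTerm, liftY, ← mul_assoc, ← pow_succ, ← pow_add, show 2 * j + 1 + L = L + 1 + 2 * j by ring,
      show 2 * j + (L + 1) = L + 1 + 2 * j by ring]

/-- A series whose terms are a fixed multiple of those of a convergent series converges. -/
lemma convergesOn_of_smul_eq {I A : Type} [AddCommGroup A] [Module ℝ A] {T R : ℕ → (I → ℝ) → A}
    {s : (I → ℝ) → A} {Ω : Set (I → ℝ)} {a b : ℝ} (ha : a ≠ 0)
    (h : ∀ j, ∀ z ∈ Ω, a • T j z = b • R j z) {V : Submodule ℝ A} (hV : FiniteDimensional ℝ V)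
    (hR : ∀ j, ∀ z ∈ Ω, R j z ∈ V)
    (hs : ∀ z ∈ Ω, ∀ φ : Module.Dual ℝ A, HasSum (fun j => φ (R j z)) (φ (s z))) :
    ConvergesOn T (fun z => (a⁻¹ * b) • s z) Ω := by
  have hT : ∀ j, ∀ z ∈ Ω, T j z = (a⁻¹ * b) • R j z := fun j z hz => by
    rw [mul_smul, ← h j z hz, smul_smul, inv_mul_cancel₀ ha, one_smul]
  refine ⟨⟨V, hV, fun j z hz => ?_⟩, fun z hz => convergesAt_of_hasSum fun φ => ?_⟩
  · rw [hT j z hz]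
    exact V.smul_mem _ (hR j z hz)
  · rw [map_smul, smul_eq_mul]
    refine hasSum_of_eq ((hs z hz φ).mul_left (a⁻¹ * b)) fun j => ?_
    rw [hT j z hz, map_smul, smul_eq_mul]

end Convergence

/-! ### The Bessel and Appell representations -/

section Representation

variable {m n p q : ℕ} {Ωp : Set (Fin p → ℝ)} {F : ℕ → (Fin p → ℝ) → Val m n p q}
  {f : ℕ → analyticFunctions Ωp (Val m n p q)} {Ω : Set (Pt m p)} {S : Pt m p → Val m n p q}
  {M : ℤ}

/-- The representation for `M` not in `-2ℕ`: the two Bessel series are the even and the odd part of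
`∑ x^j F_j`. -/
theorem exists_bessel_representation (i₀ : Fin m) (hΩp : IsOpen Ωp)
    (hF : ∀ j, ∀ y ∈ Ωp, F j y = (f j).1 y)
    (hb : ∀ j, ∀ y ∈ Ωp, body (F j y) = F j y)
    (hf : IsCKSequence M (analyticDirac hΩp Sum.inr Sum.inr) f) (hΩ : IsOpen Ω)
    (hΩ_nhd : ∀ y ∈ Ωp, Sum.elim (0 : Fin m → ℝ) y ∈ Ω)
    (hover : ∀ z ∈ Ω, z ∘ Sum.inr ∈ Ωp) (hsum : ConvergesOn (ckTerm F) S Ω)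
    (hM : ∀ k : ℕ, M ≠ -2 * (k : ℤ)) :
    ∃ A B : Pt m p → Val m n p q,
      ConvergesOn (besselTerm ((M : ℝ) / 2 - 1) (liftY (F 0))) A Ω ∧
      ConvergesOn (besselTerm ((M : ℝ) / 2) (diracY (liftY (F 0)))) B Ω ∧
      ∀ z ∈ Ω, S z = Real.Gamma ((M : ℝ) / 2) • (A z - (1 / 2 : ℝ) • (xVec z * B z)) := by
  obtain ⟨V, hV, hVx, s, hs⟩ := exists_evenPart i₀ hΩp hF hb hf hΩ hΩ_nhd hover hsum
  have hΓ : Real.Gamma ((M : ℝ) / 2) ≠ 0 := Real.Gamma_ne_zero fun k hk => hM k (by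
    have : (M : ℝ) = ((-2 * (k : ℤ) : ℤ) : ℝ) := by push_cast; linarith
    exact_mod_cast this)
  refine ⟨_, _,
    convergesOn_of_smul_eq (b := 1) hΓ
      (fun j z hz => by rw [one_smul]; exact besselTerm_lift_zero hF hf hM j (hover z hz)) hV
      (fun j z hz => hVx z hz _ _) (hs 0),
    convergesOn_of_smul_eq (b := -2) hΓ
      (fun j z hz => besselTerm_dirac_zero hF hf hM j (hover z hz)) hV
      (fun j z hz => hVx z hz _ _) (hs 1), fun z hz => ?_⟩
  have h := (hsum.2 z hz).eq_sum_add (fun d => hs d z hz) 0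
  rw [Finset.range_zero, Finset.sum_empty, zero_add, pow_zero, one_mul, zero_add] at h
  simp only [mul_smul_comm, smul_sub, smul_smul]
  rw [h, mul_one, mul_inv_cancel₀ hΓ, one_smul, sub_eq_add_neg, ← neg_smul,
    show -(Real.Gamma ((M : ℝ) / 2) * (1 / 2 * ((Real.Gamma ((M : ℝ) / 2))⁻¹ * -2))) = 1 by
      field_simp, one_smul]

/-- The representation for `M = -2k` and `m ≥ 1`: the Appell polynomials give the first `2k + 1` terms,
the two Bessel series the parts of either parity of the remainder. -/
theorem exists_appell_bessel_representation (i₀ : Fin m) (hΩp : IsOpen Ωp)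
    (hF : ∀ j, ∀ y ∈ Ωp, F j y = (f j).1 y)
    (hb : ∀ j, ∀ y ∈ Ωp, body (F j y) = F j y)
    (hf : IsCKSequence M (analyticDirac hΩp Sum.inr Sum.inr) f) (hΩ : IsOpen Ω)
    (hΩ_nhd : ∀ y ∈ Ωp, Sum.elim (0 : Fin m → ℝ) y ∈ Ω)
    (hover : ∀ z ∈ Ω, z ∘ Sum.inr ∈ Ωp) (hsum : ConvergesOn (ckTerm F) S Ω)
    {k : ℕ} (hM : M = -2 * (k : ℤ)) :
    ∃ A B : Pt m p → Val m n p q,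
      ConvergesOn (besselTerm (k : ℝ) (liftY (F (2 * k + 1)))) A Ω ∧
      ConvergesOn (besselTerm ((k : ℝ) + 1) (diracY (liftY (F (2 * k + 1))))) B Ω ∧
      ∀ z ∈ Ω, S z =
        (1 / (k.factorial : ℝ)) • (polyOperator (appellP k) (liftY (F 0)) z
          + (1 / 2 : ℝ) • (xVec z * polyOperator (appellPred k) (diracY (liftY (F 0))) z))
        + (k.factorial : ℝ) •
          (xVec z ^ (2 * k + 1) * (A z + (1 / 2 : ℝ) • (xVec z * B z))) := by
  obtain ⟨V, hV, hVx, s, hs⟩ := exists_evenPart i₀ hΩp hF hb hf hΩ hΩ_nhd hover hsum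
  have hk : (k.factorial : ℝ) ≠ 0 := by exact_mod_cast k.factorial_ne_zero
  refine ⟨_, _,
    convergesOn_of_smul_eq (b := 1) hk
      (fun j z hz => by rw [one_smul]; exact besselTerm_lift_tail hF hf hM j (hover z hz)) hV
      (fun j z hz => hVx z hz _ _) (hs (2 * k + 1)),
    convergesOn_of_smul_eq (b := 2) hk
      (fun j z hz => besselTerm_dirac_tail hF hf hM j (hover z hz)) hV
      (fun j z hz => hVx z hz _ _) (hs (2 * k + 1 + 1)), fun z hz => ?_⟩
  rw [appell_part_eq hF hf hM (hover z hz)]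
  refine ((hsum.2 z hz).eq_sum_add (fun d => hs d z hz) (2 * k + 1)).trans ?_
  congr 1
  rw [← mul_smul_comm]
  congr 1
  simp only [mul_smul_comm, smul_add, smul_smul]
  rw [mul_one, mul_inv_cancel₀ hk, one_smul,
    show (k.factorial : ℝ) * (1 / 2 * ((k.factorial : ℝ)⁻¹ * 2)) = 1 by field_simp, one_smul]

end Representation

/-! ### Normal neighbourhoods and the domain of convergence -/

section Domain

variable {m n p q : ℕ} {Ωp : Set (Fin p → ℝ)} {D : Set (Pt m p)}

lemma bosNormSq_mulVec {R : Matrix (Fin m) (Fin m) ℝ}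
    (hR : R ∈ Matrix.specialOrthogonalGroup (Fin m) ℝ) (x : Fin m → ℝ) (y : Fin p → ℝ) :
    bosNormSq (Sum.elim (R.mulVec x) y) = bosNormSq (Sum.elim x y) := by
  have h1 : R.transpose * R = 1 :=
    (Matrix.mem_orthogonalGroup_iff' (Fin m) ℝ).mp (Matrix.mem_specialOrthogonalGroup_iff.mp hR).1
  have h2 : ∀ x : Fin m → ℝ, bosNormSq (Sum.elim x y) = x ⬝ᵥ x := fun x => by
    simp [bosNormSq, dotProduct, pow_two]
  rw [h2, h2, Matrix.dotProduct_mulVec, Matrix.vecMul_mulVec, h1, Matrix.vecMul_one]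

lemma inl_eq_zero_of_bosNormSq {z : Pt m p} (h : bosNormSq z ≤ 0) (i : Fin m) :
    z (Sum.inl i) = 0 := by
  have h1 : z (Sum.inl i) ^ 2 ≤ 0 :=
    (Finset.single_le_sum (f := fun i : Fin m => z (Sum.inl i) ^ 2) (fun i _ => sq_nonneg _)
      (Finset.mem_univ i)).trans h
  exact pow_eq_zero_iff two_ne_zero |>.mp (le_antisymm h1 (sq_nonneg _))

/-- An open set whose slices are balls is an `SO(m)`-normal neighbourhood. -/
lemma isSONormalNhd_of_slices (hD : IsOpen D) (h0 : ∀ y ∈ Ωp, Sum.elim (0 : Fin m → ℝ) y ∈ D)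
    (hball : ∀ z ∈ D, 0 < bosNormSq z → ∀ z' : Pt m p, z' ∘ Sum.inr = z ∘ Sum.inr →
      bosNormSq z' ≤ bosNormSq z → z' ∈ D) : IsSONormalNhd Ωp D := by
  have hball' : ∀ z ∈ D, ∀ z' : Pt m p, z' ∘ Sum.inr = z ∘ Sum.inr →
      bosNormSq z' ≤ bosNormSq z → z' ∈ D := by
    intro z hz z' hzz' hn
    rcases (bosNormSq_nonneg z).eq_or_lt with h | h
    · have : z' = z := by
        ext (i | i)
        · rw [inl_eq_zero_of_bosNormSq (z := z') (h ▸ hn) i, inl_eq_zero_of_bosNormSq (z := z) h.ge i]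
        · exact congrFun hzz' i
      rwa [this]
    · exact hball z hz h z' hzz' hn
  refine ⟨hD, h0, fun R hR x y hxy => ?_, fun y x₁ hx₁ x₂ hx₂ a b ha hb hab => ?_⟩
  · exact hball' _ hxy _ rfl (bosNormSq_mulVec hR x y).le
  · have h1 : bosNormSq (Sum.elim (a • x₁ + b • x₂) y) ≤
        a * bosNormSq (Sum.elim x₁ y) + b * bosNormSq (Sum.elim x₂ y) := by
      simp only [bosNormSq, Sum.elim_inl, Finset.mul_sum, ← Finset.sum_add_distrib]
      refine Finset.sum_le_sum fun i _ => ?_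
      have := (even_two.convexOn_pow (𝕜 := ℝ)).2 (Set.mem_univ (x₁ i)) (Set.mem_univ (x₂ i))
        ha hb hab
      simpa using this
    rcases le_total (bosNormSq (Sum.elim x₁ y)) (bosNormSq (Sum.elim x₂ y)) with h | h
    · refine hball' _ hx₂ _ rfl (h1.trans ?_)
      calc _ ≤ a * bosNormSq (Sum.elim x₂ y) + b * bosNormSq (Sum.elim x₂ y) := by gcongr
        _ = _ := by rw [← add_mul, hab, one_mul]
    · refine hball' _ hx₁ _ rfl (h1.trans ?_)
      calc _ ≤ a * bosNormSq (Sum.elim x₁ y) + b * bosNormSq (Sum.elim x₁ y) := by gcongr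
        _ = _ := by rw [← add_mul, hab, one_mul]

variable {F : ℕ → (Fin p → ℝ) → Val m n p q} {Ω : Set (Pt m p)} {S : Pt m p → Val m n p q}

/-- Convergence at `(x, y)` implies convergence at all `(x', y)` with `|x'| < |x|`. -/
lemma exists_convergesOn_singleton {w z : Pt m p}
    (hb : ∀ j, body (F j (w ∘ Sum.inr)) = F j (w ∘ Sum.inr))
    (hw : ∃ S, ConvergesOn (ckTerm F) S {w}) (hzw : z ∘ Sum.inr = w ∘ Sum.inr)
    (hn : bosNormSq z < bosNormSq w) : ∃ S, ConvergesOn (ckTerm F) S {z} := by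
  obtain ⟨S, ⟨V, hV, hVT⟩, hS⟩ := hw
  have hw0 : 0 < bosNormSq w := (bosNormSq_nonneg z).trans_lt hn
  have hG := geomBound_of_ckTerm_bound hb hw0 (hS w rfl).exists_bound
  obtain ⟨V₁, hV₁, hV₁F⟩ := exists_coeff_mem (F := F) (Module.Finite.iff_fg.mp hV)
  obtain ⟨V₂, hV₂, hV₂x⟩ := exists_xVec_pow_mul_mem hV₁
  have hmem : ∀ j, ckTerm F j z ∈ V₂ := fun j => hV₂x z j _ (by
    rw [liftY, hzw]
    exact hV₁F w hb hw0 (fun j => hVT j w rfl) j)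
  obtain ⟨s, hs⟩ := exists_hasSum_of_finiteDimensional hV₂ hmem fun φ => by
    obtain ⟨u, hu, hle⟩ := hG.exists_ckTerm_bound (Real.sqrt_pos.mpr hw0) (Real.sqrt_nonneg _)
      (Real.sqrt_lt_sqrt (bosNormSq_nonneg z) hn) φ
    exact Summable.of_norm_bounded hu fun j =>
      hle j z (Real.sq_sqrt (bosNormSq_nonneg z)).ge hzw
  refine ⟨fun _ => s, ⟨V₂, hV₂, ?_⟩, ?_⟩
  · rintro j _ rfl
    exact hmem j
  · rintro _ rfl
    exact convergesAt_of_hasSum hs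

lemma ConvergesOn.mono {I A : Type} [AddCommGroup A] [Module ℝ A] {T : ℕ → (I → ℝ) → A}
    {S : (I → ℝ) → A} {Ω Ω' : Set (I → ℝ)} (h : ConvergesOn T S Ω) (hΩ : Ω' ⊆ Ω) :
    ConvergesOn T S Ω' := by
  obtain ⟨⟨V, hV, hVT⟩, hS⟩ := h
  exact ⟨⟨V, hV, fun j z hz => hVT j z (hΩ hz)⟩, fun z hz => hS z (hΩ hz)⟩

lemma ConvergesOn.congr {I A : Type} [AddCommGroup A] [Module ℝ A] {T T' : ℕ → (I → ℝ) → A}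
    {S : (I → ℝ) → A} {Ω : Set (I → ℝ)} (h : ConvergesOn T S Ω)
    (hT : ∀ j, ∀ z ∈ Ω, T' j z = T j z) : ConvergesOn T' S Ω := by
  obtain ⟨⟨V, hV, hVT⟩, hS⟩ := h
  refine ⟨⟨V, hV, fun j z hz => by rw [hT j z hz]; exact hVT j z hz⟩, fun z hz φ => ?_⟩
  simp only [hT _ z hz]
  exact hS z hz φ

/-- With a point `(x, y)`, the domain of convergence contains a neighbourhood of each `(x', y)` with
`|x'| ≤ |x|`. -/
theorem isSONormalNhd_convergenceDomain (hb : ∀ j, ∀ y ∈ Ωp, body (F j y) = F j y)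
    (hΩ : IsOpen Ω) (hΩ_nhd : ∀ y ∈ Ωp, Sum.elim (0 : Fin m → ℝ) y ∈ Ω)
    (hover : ∀ z ∈ Ω, z ∘ Sum.inr ∈ Ωp) (hsum : ConvergesOn (ckTerm F) S Ω) :
    IsSONormalNhd Ωp (convergenceDomain (m := m) Ωp F) := by
  set O : Set (Pt m p) := convergenceDomain Ωp F with hO
  have hOopen : IsOpen O := isOpen_interior
  have hOT : ∀ z ∈ O, z ∘ Sum.inr ∈ Ωp ∧ ∃ S, ConvergesOn (ckTerm F) S {z} :=
    fun _ hz => (interior_subset hz : _ ∈ {z | _})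
  refine isSONormalNhd_of_slices hOopen (fun y hy => ?_) fun z hz hz0 z' hzz' hn => ?_
  · have hsub : Ω ⊆ {z | z ∘ Sum.inr ∈ Ωp ∧ ∃ S, ConvergesOn (ckTerm F) S {z}} := fun z hz =>
      ⟨hover z hz, S, hsum.mono (Set.singleton_subset_iff.mpr hz)⟩
    exact interior_maximal hsub hΩ (hΩ_nhd y hy)
  · obtain ⟨c, hc, hcz⟩ := exists_one_lt_scaleX_mem hOopen hz
    -- The slices over nearby `y` contain the boundary point of a ball larger than that of `z`.
    set g : Pt m p → Pt m p := fun w => Sum.elim (fun i => c * z (Sum.inl i)) (w ∘ Sum.inr) with hg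
    have hgc : Continuous g := by
      refine continuous_pi ?_
      rintro (i | i)
      · exact continuous_const
      · exact continuous_apply (Sum.inr i)
    have hgn : ∀ w, bosNormSq (g w) = c ^ 2 * bosNormSq z := fun w => by
      rw [← bosNormSq_scaleX]; rfl
    have hN : IsOpen ({w : Pt m p | bosNormSq w < c ^ 2 * bosNormSq z} ∩ g ⁻¹' O) :=
      (isOpen_lt continuous_bosNormSq continuous_const).inter (hOopen.preimage hgc)
    refine interior_maximal (fun w hw => ?_) hN ⟨?_, ?_⟩
    · obtain ⟨hw1, hw2⟩ := hOT _ hw.2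
      exact ⟨hw1, exists_convergesOn_singleton (fun j => hb j _ hw1) hw2 rfl (by
        rw [hgn]; exact hw.1)⟩
    · exact hn.trans_lt (lt_mul_of_one_lt_left hz0 (one_lt_pow₀ hc two_ne_zero))
    · change Sum.elim _ (z' ∘ Sum.inr) ∈ O
      rw [hzz']
      exact hcz

/-- The set `D` is the union of all cylinders `{|x| < r} × W` inside `Ω` on which the series has a
summable majorant. -/
theorem exists_normal_convergence {f : ℕ → analyticFunctions Ωp (Val m n p q)} {M : ℤ}
    (hΩp : IsOpen Ωp) (hF : ∀ j, ∀ y ∈ Ωp, F j y = (f j).1 y)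
    (hf : IsCKSequence M (analyticDirac hΩp Sum.inr Sum.inr) f)
    (hΩ : IsOpen Ω) (hΩ_nhd : ∀ y ∈ Ωp, Sum.elim (0 : Fin m → ℝ) y ∈ Ω)
    (hsum : ConvergesOn (ckTerm F) S Ω) :
    ∃ D : Set (Pt m p), IsSONormalNhd Ωp D ∧ D ⊆ Ω ∧ ConvergesNormallyOn (ckTerm F) D := by
  set box : ℝ → Set (Fin p → ℝ) → Set (Pt m p) :=
    fun r W => {z | bosNormSq z < r ^ 2 ∧ z ∘ Sum.inr ∈ W} with hbox
  have hbox_open : ∀ r W, IsOpen W → IsOpen (box r W) := fun r W hW =>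
    (isOpen_lt continuous_bosNormSq continuous_const).inter
      (hW.preimage (continuous_pi fun i => continuous_apply (Sum.inr i)))
  set good : ℝ → Set (Fin p → ℝ) → Prop := fun r W => IsOpen W ∧ box r W ⊆ Ω ∧
    ∀ φ : Module.Dual ℝ (Val m n p q), ∃ u : ℕ → ℝ, Summable u ∧
      ∀ j, ∀ z ∈ box r W, |φ (ckTerm F j z)| ≤ u j with hgood
  set D : Set (Pt m p) := {z | ∃ r W, good r W ∧ z ∈ box r W} with hD
  have hDopen : IsOpen D := by
    refine isOpen_iff_mem_nhds.mpr fun z hz => ?_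
    obtain ⟨r, W, hrW, hzb⟩ := hz
    exact mem_of_superset ((hbox_open r W hrW.1).mem_nhds hzb) fun w hw => ⟨r, W, hrW, hw⟩
  have hDΩ : D ⊆ Ω := by
    rintro z ⟨r, W, hrW, hzb⟩
    exact hrW.2.1 hzb
  refine ⟨D, isSONormalNhd_of_slices hDopen (fun y hy => ?_) ?_, hDΩ, ?_, ?_⟩
  · obtain ⟨s, hs, W, hW, hWΩ, hWb⟩ :=
      hf.exists_local_bound hΩp Sum.inr_injective Sum.inr_injective hy
    obtain ⟨ε, hε, hεΩ⟩ := exists_box_subset hΩ (hΩ_nhd y hy)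
    have hG : GeomBound W F s := fun φ => by
      obtain ⟨C, hC⟩ := hWb φ
      exact ⟨C, fun y hy j => by rw [hF j y (hWΩ hy)]; exact hC y hy j⟩
    have hmin : 0 < min (s / 2) ε := lt_min (half_pos hs) hε
    -- The coefficients allow any radius below `s`; the radius `ε` keeps the cylinder inside `Ω`.
    refine ⟨min (s / 2) ε, interior W ∩ Metric.ball y ε,
      ⟨isOpen_interior.inter Metric.isOpen_ball, fun z hz => ?_, fun φ => ?_⟩, ?_, ?_, ?_⟩
    · exact hεΩ z (hz.1.trans_le (pow_le_pow_left₀ hmin.le (min_le_right _ _) 2)) hz.2.2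
    · obtain ⟨u, hu, hle⟩ := hG.exists_ckTerm_bound hs (half_pos hs).le (half_lt_self hs) φ
      exact ⟨u, hu, fun j z hz => hle j z
        (hz.1.le.trans (pow_le_pow_left₀ hmin.le (min_le_left _ _) 2)) (interior_subset hz.2.1)⟩
    · rw [bosNormSq_elim_zero]; positivity
    · exact mem_interior_iff_mem_nhds.mpr hW
    · exact Metric.mem_ball_self hε
  · rintro z ⟨r, W, hrW, hz⟩ - z' hzz' hn
    exact ⟨r, W, hrW, hn.trans_lt hz.1, by rw [hzz']; exact hz.2⟩
  · exact (hsum.mono hDΩ).1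
  · intro φ K hKD hK
    refine hK.induction_on (p := fun K => ∃ u : ℕ → ℝ, Summable u ∧
      ∀ j, ∀ z ∈ K, |φ (ckTerm F j z)| ≤ u j) ⟨0, summable_zero, fun _ _ hz => hz.elim⟩
      (fun s t hst ⟨u, hu, hle⟩ => ⟨u, hu, fun j z hz => hle j z (hst hz)⟩) ?_ fun z hz => ?_
    · rintro s t ⟨u, hu, hle⟩ ⟨u', hu', hle'⟩
      refine ⟨fun j => |u j| + |u' j|, hu.abs.add hu'.abs, fun j z hz => ?_⟩
      rcases hz with hz | hz
      · exact (hle j z hz).trans ((le_abs_self _).trans (le_add_of_nonneg_right (abs_nonneg _)))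
      · exact (hle' j z hz).trans ((le_abs_self _).trans (le_add_of_nonneg_left (abs_nonneg _)))
    · obtain ⟨r, W, hrW, hzb⟩ := hKD hz
      exact ⟨box r W, mem_nhdsWithin_of_mem_nhds ((hbox_open r W hrW.1).mem_nhds hzb),
        hrW.2.2 φ⟩

end Domain

end SuperCK

end

open SuperCK in
theorem mainTheorem1 (m n p q : ℕ)
    (Ωp : Set (Fin p → ℝ)) (hΩp : IsOpen Ωp)
    (F : ℕ → (Fin p → ℝ) → Val m n p q) (hF : ∀ j, IsAnalyticInY Ωp (F j))
    (Ω : Set (Pt m p)) (hΩ : IsOpen Ω)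
    (hΩ_nhd : ∀ y ∈ Ωp, Sum.elim (0 : Fin m → ℝ) y ∈ Ω)
    (hΩ_over : ∀ z ∈ Ω, z ∘ Sum.inr ∈ Ωp)
    (S : Pt m p → Val m n p q) (hS : IsSmooth Ω S)
    (hsum : ConvergesOn (ckTerm F) S Ω)
    (hmono : ∀ z ∈ Ω, diracX S z + diracY S z = 0) :
    ((∀ k : ℕ, superdim m n ≠ -2 * (k : ℤ)) →
      ∃ A B : Pt m p → Val m n p q,
        ConvergesOn (besselTerm ((superdim m n : ℝ) / 2 - 1) (liftY (F 0))) A Ω ∧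
        ConvergesOn (besselTerm ((superdim m n : ℝ) / 2) (diracY (liftY (F 0)))) B Ω ∧
        ∀ z ∈ Ω, S z = Real.Gamma ((superdim m n : ℝ) / 2) •
          (A z - (1 / 2 : ℝ) • (xVec z * B z))) ∧
    (∀ k : ℕ, superdim m n = -2 * (k : ℤ) → m ≠ 0 →
      (∀ z : Pt m p, z ∘ Sum.inr ∈ Ωp → (diracY^[2 * k + 1] (liftY (F 0))) z = 0) ∧
      ∃ A B : Pt m p → Val m n p q,
        ConvergesOn (besselTerm (k : ℝ) (liftY (F (2 * k + 1)))) A Ω ∧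
        ConvergesOn (besselTerm ((k : ℝ) + 1) (diracY (liftY (F (2 * k + 1))))) B Ω ∧
        ∀ z ∈ Ω, S z =
          (1 / (k.factorial : ℝ)) • (polyOperator (appellP k) (liftY (F 0)) z
            + (1 / 2 : ℝ) • (xVec z * polyOperator (appellPred k) (diracY (liftY (F 0))) z))
          + (k.factorial : ℝ) •
            (xVec z ^ (2 * k + 1) * (A z + (1 / 2 : ℝ) • (xVec z * B z)))) ∧
    (m = 0 →
      (∀ z : Pt m p, z ∘ Sum.inr ∈ Ωp → (diracY^[2 * n + 1] (liftY (F 0))) z = 0) ∧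
      ∀ z ∈ Ω, S z =
        (1 / (n.factorial : ℝ)) • (polyOperator (appellP n) (liftY (F 0)) z
          + (1 / 2 : ℝ) • (xVec z * polyOperator (appellPred n) (diracY (liftY (F 0))) z))) ∧
    IsSONormalNhd Ωp (convergenceDomain Ωp F) ∧
    (∃ D : Set (Pt m p), IsSONormalNhd Ωp D ∧ D ⊆ Ω ∧ ConvergesNormallyOn (ckTerm F) D) := by
  obtain ⟨f, hf, hfb, hfT, hfF⟩ := exists_ckSequence hΩp hF hΩ hΩ_nhd hS hsum.2 hmono
  -- For `m = 0` the coefficients of the vanishing powers of `x` are arbitrary; they are replaced.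
  set G : ℕ → (Fin p → ℝ) → Val m n p q :=
    fun j => if m ≠ 0 ∨ j ≤ 2 * n then F j else (f j).1 with hG
  have hGf : ∀ j, ∀ y ∈ Ωp, G j y = (f j).1 y := fun j y hy => by
    by_cases h : m ≠ 0 ∨ j ≤ 2 * n
    · simp only [hG, if_pos h]
      exact hfF j h y hy
    · simp only [hG, if_neg h]
  have hG0 : G 0 = F 0 := if_pos (Or.inr (Nat.zero_le _))
  have hGm : m ≠ 0 → G = F := fun h => funext fun j => if_pos (Or.inl h)
  have hGT : ∀ j, ∀ z : Pt m p, z ∘ Sum.inr ∈ Ωp → ckTerm F j z = ckTerm G j z := fun j z hz => by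
    rw [hfT j z hz, ckTerm, ckTerm, liftY, liftY, hGf j _ hz]
  have hGb : ∀ j, ∀ y ∈ Ωp, body (G j y) = G j y := fun j y hy => by rw [hGf j y hy, hfb j y hy]
  have hGsum : ConvergesOn (ckTerm G) S Ω :=
    hsum.congr fun j z hz => (hGT j z (hΩ_over z hz)).symm
  have hnil : ∀ k : ℕ, superdim m n = -2 * (k : ℤ) →
      ∀ z : Pt m p, z ∘ Sum.inr ∈ Ωp → (diracY^[2 * k + 1] (liftY (F 0))) z = 0 := by
    intro k hk z hz
    rw [← hG0]
    exact diracY_iterate_eq_zero hGf hf hk hz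
  refine ⟨fun hM => ?_, fun k hk hm => ⟨hnil k hk, ?_⟩, fun hm => ⟨hnil n (by simp [superdim, hm]), ?_⟩,
    ?_, ?_⟩
  · have hm : m ≠ 0 := by
      rintro rfl
      exact hM n (by simp [superdim])
    rw [← hGm hm]
    exact exists_bessel_representation ⟨0, Nat.pos_of_ne_zero hm⟩ hΩp hGf hGb hf hΩ hΩ_nhd hΩ_over
      hGsum hM
  · rw [← hGm hm]
    exact exists_appell_bessel_representation ⟨0, Nat.pos_of_ne_zero hm⟩ hΩp hGf hGb hf hΩ hΩ_nhd
      hΩ_over hGsum hk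
  · intro z hz
    subst hm
    rw [← hG0, appell_part_eq hGf hf (by simp [superdim]) (hΩ_over z hz)]
    refine (hGsum.2 z hz).eq_sum_range fun j hj => ?_
    rw [ckTerm, xVec_eq_fermVec, fermVec_inl_pow_eq_zero hj, zero_mul]
  · have hdom : convergenceDomain (m := m) Ωp F = convergenceDomain Ωp G := by
      have hset : ∀ z : Pt m p, (z ∘ Sum.inr ∈ Ωp ∧ ∃ S, ConvergesOn (ckTerm F) S {z}) ↔
          (z ∘ Sum.inr ∈ Ωp ∧ ∃ S, ConvergesOn (ckTerm G) S {z}) := fun z =>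
        and_congr_right fun hz => exists_congr fun S =>
          ⟨fun h => h.congr fun j w hw => by rw [Set.mem_singleton_iff.mp hw, hGT j z hz],
            fun h => h.congr fun j w hw => by rw [Set.mem_singleton_iff.mp hw, hGT j z hz]⟩
      exact congrArg interior (Set.ext hset)
    rw [hdom]
    exact isSONormalNhd_convergenceDomain hGb hΩ hΩ_nhd hΩ_over hGsum
  · obtain ⟨D, hD, hDΩ, ⟨V, hV, hVT⟩, hu⟩ :=
      exists_normal_convergence hΩp hGf hf hΩ hΩ_nhd hGsum
    have hT : ∀ j, ∀ z ∈ D, ckTerm F j z = ckTerm G j z :=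
      fun j z hz => hGT j z (hΩ_over z (hDΩ hz))
    refine ⟨D, hD, hDΩ, ⟨V, hV, fun j z hz => by rw [hT j z hz]; exact hVT j z hz⟩,
      fun φ K hKD hK => ?_⟩
    obtain ⟨u, hus, hle⟩ := hu φ K hKD hK
    exact ⟨u, hus, fun j z hz => by rw [hT j z (hKD hz)]; exact hle j z hz⟩
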